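/- Let $\mathcal S,\mathcal A,\mathcal B,\mathcal E$ be finite sets, $Q_S$ a probability distribution on $\mathcal S$, $\phi_0$ a probability distribution on $\mathcal A$ (the innocent input; a fixed symbol $x_0$ is the special case of a point mass), and $W_{BE|AS}$ a channel from $\mathcal A\times\mathcal S$ to $\mathcal B\times\mathcal E$; here $B$ is the receiver's output and $E$ the warden's. Put $Q_0(e)=\sum_{s,a,b}Q_S(s)\phi_0(a)W_{BE|AS}(b,e|a,s)$, the law of the warden's output when there is no communication. All logarithms are to base $2$. For $R,R_K\ge 0$, a $(2^{nR},2^{nR_K},n)$ code, when the state is known non-causally at both the transmitter and the receiver, consists of a stochastic encoder that maps a message $m\in\{1,\dots,\lfloor 2^{nR}\rfloor\}$ and the whole state sequence $s^n$ to a pair $(A^n,K)$, with $A^n\in\mathcal A^n$ and a key $K\in\{1,\dots,\lfloor 2^{nR_K}\rfloor\}$, and a stochastic decoder that maps $(B^n,s^n)$ to estimates $(\hat M,\hat K)$. The message $M$ is uniform, $S^n$ is i.i.d. with law $Q_S$ and independent of $M$, and $(B^n,E^n)$ is the output of $n$ memoryless uses of $W_{BE|AS}$. The pair $(R,R_K)$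 is achievable if there is a sequence of $(2^{nR},2^{nR_K},n)$ codes such that, as $n\to\infty$, $\Pr\{(\hat M,\hat K)\neq(M,K)\}\to 0$ and the total variation distance between the law $\hat P_{MKE^n}$ of $(M,K,E^n)$ and the product $P^{\mathrm{unif}}_M\times P^{\mathrm{unif}}_K\times Q_0^{\otimes n}$ tends to $0$, where $P^{\mathrm{unif}}_M$ and $P^{\mathrm{unif}}_K$ are the uniform distributions on the message set and on the key set. The covert-secure capacity region $\mathcal C_{\mathrm{CSC\text{-}CSK}}\subseteq\mathbb R^2$ is the closure of the set of achievable pairs. Then $\mathcal C_{\mathrm{CSC\text{-}CSK}}$ is exactly the set of pairs $(R,R_K)$ with $R,R_K\ge 0$ for which there are a finite set $\mathcal U$ and conditional distributions $P_{U|S}$ (on $\mathcal U$) and $P_{A|US}$ (on $\mathcal A$) such that the joint distribution $P_{SUABE}=Q_S\,P_{U|S}\,P_{A|US}\,W_{BE|AS}$ satisfies $P_E=Q_0$ and $$R\le I(U;B|S),\qquad R+R_K\le I(U;B|S)-I(U;E|S)+H(S|E).$$ -/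

import Mathlib

open Filter Topology

noncomputable section

namespace CovertSecure

/-! Probability mass functions on a finite set `α` are the elements of the simplex
`stdSimplex ℝ α`; a transition kernel from `α` to `β` is a map `α → stdSimplex ℝ β`.
All information measures are in bits. -/

section Information

variable {Ω α β γ : Type*} [Fintype Ω] [Fintype α] [Fintype β] [Fintype γ]

open Classical in
/-- The law of the random variable `X` on the finite sample space `Ω` with mass function `p`. -/
def law (p : Ω → ℝ) (X : Ω → α) : α → ℝ :=
  fun x => ∑ ω, if X ω = x then p ω else 0

/-- Conditional entropy `H(X|Y) = - ∑ P(x,y) log₂ (P(x,y) / P(y))`; terms with `P(x,y) = 0`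
contribute `0`. -/
def condEntropy (p : Ω → ℝ) (X : Ω → α) (Y : Ω → β) : ℝ :=
  -∑ x, ∑ y, law p (fun ω => (X ω, Y ω)) (x, y) *
    Real.logb 2 (law p (fun ω => (X ω, Y ω)) (x, y) / law p Y y)

/-- Conditional mutual information `I(X;Y|Z) = H(X|Z) - H(X|Y,Z)`. -/
def condMutualInfo (p : Ω → ℝ) (X : Ω → α) (Y : Ω → β) (Z : Ω → γ) : ℝ :=
  condEntropy p X Z - condEntropy p X (fun ω => (Y ω, Z ω))

/-- Total variation distance of two mass functions on a finite set. -/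
def tvDist (p q : α → ℝ) : ℝ := (1 / 2) * ∑ x, |p x - q x|

end Information

section Channel

variable {S A B E : Type*} [Fintype S] [Fintype A] [Fintype B] [Fintype E]

/-- The output law `Q₀` of the warden's channel for one channel use without communication:
the state has law `Q` and the input, independent of the state, has the innocent law `φ₀`. -/
def innocentOutput (Q : stdSimplex ℝ S) (φ₀ : stdSimplex ℝ A)
    (W : A → S → stdSimplex ℝ (B × E)) : E → ℝ :=
  fun e => ∑ s, ∑ a, ∑ b, Q s * φ₀ a * W a s (b, e)

/-- A code of block length `n` with `μ` messages and `κ` keys, when the whole state sequence is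
known at the transmitter and at the receiver. The stochastic encoder maps a message and the state
sequence to a channel input sequence and a key; the stochastic decoder maps the receiver's
output sequence and the state sequence to estimates of the message and of the key. -/
structure Code (S A B : Type*) [Fintype S] [Fintype A] [Fintype B] (n μ κ : ℕ) where
  /-- the stochastic encoder -/
  enc : Fin μ → (Fin n → S) → stdSimplex ℝ ((Fin n → A) × Fin κ)
  /-- the stochastic decoder -/
  dec : (Fin n → B) → (Fin n → S) → stdSimplex ℝ (Fin μ × Fin κ)

variable {n μ κ : ℕ}

/-- Outcomes of one transmission:
`(M, Sⁿ, (Aⁿ, K), (Bⁿ, Eⁿ), (M̂, K̂))`. -/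
abbrev Outcome (S A B E : Type*) (n μ κ : ℕ) : Type _ :=
  Fin μ × (Fin n → S) × ((Fin n → A) × Fin κ) × ((Fin n → B) × (Fin n → E)) × (Fin μ × Fin κ)

/-- The joint law induced by a code: `M` is uniform, `Sⁿ` is i.i.d. with law `Q` and independent
of `M`, and the channel `W` is used `n` times without memory. -/
def Code.inducedLaw (c : Code S A B n μ κ) (Q : stdSimplex ℝ S)
    (W : A → S → stdSimplex ℝ (B × E)) : Outcome S A B E n μ κ → ℝ :=
  fun ⟨m, s, ⟨a, k⟩, ⟨b, e⟩, d⟩ =>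
    (1 / (μ : ℝ)) * (∏ i, Q (s i)) * c.enc m s (a, k) *
      (∏ i, W (a i) (s i) (b i, e i)) * c.dec b s d

open Classical in
/-- The probability that `(M̂, K̂) ≠ (M, K)`. -/
def Code.errorProb (c : Code S A B n μ κ) (Q : stdSimplex ℝ S)
    (W : A → S → stdSimplex ℝ (B × E)) : ℝ :=
  ∑ ω : Outcome S A B E n μ κ,
    if ω.2.2.2.2 ≠ (ω.1, ω.2.2.1.2) then c.inducedLaw Q W ω else 0

/-- The joint law of `(M, K, Eⁿ)` induced by a code. -/
def Code.wardenLaw (c : Code S A B n μ κ) (Q : stdSimplex ℝ S)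
    (W : A → S → stdSimplex ℝ (B × E)) : Fin μ × Fin κ × (Fin n → E) → ℝ :=
  law (c.inducedLaw Q W) (fun ω => (ω.1, ω.2.2.1.2, ω.2.2.2.1.2))

/-- The ideal law of `(M, K, Eⁿ)`: `M` and `K` are uniform, `Eⁿ` is i.i.d. with law `Q₀`, and
the three are independent. -/
def idealLaw (Q₀ : E → ℝ) (n μ κ : ℕ) : Fin μ × Fin κ × (Fin n → E) → ℝ :=
  fun x => (1 / (μ : ℝ)) * (1 / (κ : ℝ)) * ∏ i, Q₀ (x.2.2 i)

/-- The number `⌊2^{nR}⌋` of messages or keys at rate `R` (in bits) and block length `n`. -/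
def numIndices (n : ℕ) (R : ℝ) : ℕ := ⌊(2 : ℝ) ^ ((n : ℝ) * R)⌋₊

/-- `(R, R_K)` is achievable: some sequence of codes with `⌊2^{nR}⌋` messages and `⌊2^{nR_K}⌋`
keys is reliable and covert secure in the limit. -/
def Achievable (Q : stdSimplex ℝ S) (φ₀ : stdSimplex ℝ A) (W : A → S → stdSimplex ℝ (B × E))
    (R RK : ℝ) : Prop :=
  0 ≤ R ∧ 0 ≤ RK ∧
    ∃ c : (n : ℕ) → Code S A B n (numIndices n R) (numIndices n RK),
      Tendsto (fun n => (c n).errorProb Q W) atTop (𝓝 0) ∧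
      Tendsto (fun n => tvDist ((c n).wardenLaw Q W)
        (idealLaw (innocentOutput Q φ₀ W) n (numIndices n R) (numIndices n RK))) atTop (𝓝 0)

/-- The covert-secure capacity region: the closure of the set of achievable rate pairs. -/
def capacityRegion (Q : stdSimplex ℝ S) (φ₀ : stdSimplex ℝ A)
    (W : A → S → stdSimplex ℝ (B × E)) : Set (ℝ × ℝ) :=
  closure {r | Achievable Q φ₀ W r.1 r.2}

/-- The joint law `P_{SUABE} = Q_S P_{U|S} P_{A|US} W_{BE|AS}`, on tuples `(s, u, a, b, e)`. -/
def jointLaw {U : Type*} [Fintype U] (Q : stdSimplex ℝ S) (pU : S → stdSimplex ℝ U)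
    (pA : U → S → stdSimplex ℝ A) (W : A → S → stdSimplex ℝ (B × E)) :
    S × U × A × B × E → ℝ :=
  fun ⟨s, u, a, b, e⟩ => Q s * pU s u * pA u s a * W a s (b, e)

end Channel

/-! The coordinates of a tuple `(s, u, a, b, e)`, as random variables. -/

section Coordinates

variable {S U A B E : Type*}

/-- The state `S`. -/
def rvS (ω : S × U × A × B × E) : S := ω.1

/-- The auxiliary variable `U`. -/
def rvU (ω : S × U × A × B × E) : U := ω.2.1

/-- The receiver's output `B`. -/
def rvB (ω : S × U × A × B × E) : B := ω.2.2.2.1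

/-- The warden's output `E`. -/
def rvE (ω : S × U × A × B × E) : E := ω.2.2.2.2

end Coordinates

end CovertSecure

end

noncomputable section

namespace CovertSecure

open Real

set_option linter.unusedSectionVars false

/-! ### Entropy of finite laws: data processing, Gibbs, submodularity, continuity -/

section Laws

variable {Ω α β γ δ : Type*} [Fintype Ω] [Fintype α] [Fintype β] [Fintype γ] [Fintype δ]

/-! Converse. For a code, let `U_i` consist of the receiver's outputs before time `i`, the warden's
outputs after `i`, the message, the key and the whole state sequence. Fano (`ent_le_of_estimator`)
and the chain rule bound the message rate by the average of `I(U_i;B_i|S_i)`. For the sum rate,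
closeness of the law of `(M,K,Eⁿ)` to the ideal one and continuity of entropy (`ent_le_ent_add`)
give `log μ + log κ + n H(Q₀) ≤ H(M,K,Eⁿ)` up to `o(n)`. Csiszár's telescoping (`ent_warden_le`)
then trades `Eⁿ` for `Bⁿ` given `(M,K,Sⁿ)`, and Fano removes `(M,K)`. The result is
`exists_feature_of_code`.

The alphabet of `U_i` grows with `n`, and the closure of the set of achievable pairs has to be
handled as well. Both are treated by convex geometry. For an unnormalized mass function `q` of state
and input let `h_B(q)`, `h_E(q)` be the output entropies given the state. With `ρ_u = P(u,·,·)` and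
`q = ∑ ρ_u`, one has `I(U;B|S) = h_B(q) - ∑ h_B(ρ_u)`, and the sum-rate bound is `h_B(q) - ∑
h_B(ρ_u) + ∑ h_E(ρ_u) + H(S) - H(E)`, because `h_E(q)` cancels between `I(U;E|S)` and `H(S|E)`. So
`U` matters only through a point of the convex hull of the points `(q, h_B(q), h_E(q))`, `q` in the
simplex. That hull is compact, and constraints that hold up to every slack hold exactly
(`mem_singleLetterRegion_of_forall_approx`).

Achievability. Draw `Uⁿ` memorylessly given `Sⁿ`, and hash the pair `(Uⁿ,Sⁿ)` by a uniformly random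
function to a message, a key and a public index of rate `R_F`. Leftover hashing
(`avg_leftover_hash_le`) makes message and public index nearly uniform and independent of `Sⁿ` if `R
+ R_F < H(U|S)`, and all three indices nearly uniform and independent of `Eⁿ` if `R + R_K + R_F <
H(U,S|E)`. Slepian-Wolf decoding (`exists_estimator`) recovers `Uⁿ` from `(Bⁿ,Sⁿ)` and the public
index if `R_F > H(U|B,S)`. Reversing the binning, the encoder draws `Uⁿ` from its conditional law
given message, state and a fixed good value of the public index (`exists_public_index`). Taking
`R_F` just above `H(U|B,S)` leaves exactly the two stated constraints, since `H(U,S|E) = H(U|E,S) +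
H(S|E)` (`achievable_of_lt`).

The strict inequalities fail near some boundary points: if `I(U;B|S) = 0`, no message is sent and a
key is extracted from the state alone (`achievable_key_of_lt`), and the pair `(0,0)` needs no coding
(`achievable_zero_zero`). -/

theorem sum_law_mul (p : Ω → ℝ) (X : Ω → α) (F : α → ℝ) :
    ∑ x, law p X x * F x = ∑ ω, p ω * F (X ω) := by
  classical
  simp only [law, Finset.sum_mul]
  rw [Finset.sum_comm]
  refine Finset.sum_congr rfl fun ω _ => ?_
  simp [ite_mul]

theorem law_nonneg {p : Ω → ℝ} (hp : ∀ ω, 0 ≤ p ω) (X : Ω → α) (x : α) : 0 ≤ law p X x := by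
  classical
  exact Finset.sum_nonneg fun ω _ => by split_ifs <;> simp [hp]

theorem sum_law (p : Ω → ℝ) (X : Ω → α) : ∑ x, law p X x = ∑ ω, p ω := by
  simpa using sum_law_mul p X (fun _ => 1)

theorem le_law {p : Ω → ℝ} (hp : ∀ ω, 0 ≤ p ω) (X : Ω → α) (ω : Ω) : p ω ≤ law p X (X ω) := by
  classical
  have := Finset.single_le_sum (f := fun ω' => if X ω' = X ω then p ω' else 0)
    (fun ω' _ => by split_ifs <;> simp [hp]) (Finset.mem_univ ω)
  simpa [law] using this

open Classical in
theorem law_apply (p : Ω → ℝ) (X : Ω → α) (x : α) :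
    law p X x = ∑ ω, p ω * (if X ω = x then 1 else 0) := by
  simp [law]

theorem law_law (p : Ω → ℝ) (X : Ω → α) (f : α → β) :
    law (law p X) f = law p (fun ω => f (X ω)) := by
  classical
  funext y
  rw [law_apply, law_apply, sum_law_mul]

theorem law_fst (p : Ω → ℝ) (X : Ω → α) (Y : Ω → β) (x : α) :
    ∑ y, law p (fun ω => (X ω, Y ω)) (x, y) = law p X x := by
  classical
  simp only [law, Prod.mk.injEq]
  rw [Finset.sum_comm]
  refine Finset.sum_congr rfl fun ω _ => ?_
  by_cases h : X ω = x <;> simp [h]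

theorem law_snd (p : Ω → ℝ) (X : Ω → α) (Y : Ω → β) (y : β) :
    ∑ x, law p (fun ω => (X ω, Y ω)) (x, y) = law p Y y := by
  classical
  simp only [law, Prod.mk.injEq]
  rw [Finset.sum_comm]
  refine Finset.sum_congr rfl fun ω _ => ?_
  by_cases h : Y ω = y <;> simp [h]

theorem law_le_law_comp {p : Ω → ℝ} (hp : ∀ ω, 0 ≤ p ω) (X : Ω → α) (f : α → β) (x : α) :
    law p X x ≤ law p (fun ω => f (X ω)) (f x) := by
  exact (le_law (law_nonneg hp X) f x).trans_eq (congrFun (law_law p X f) _)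

/-- The entropy, in nats, of a mass function. -/
def ent (q : α → ℝ) : ℝ := ∑ x, negMulLog (q x)

/-- Moves entropies of different variables to one sum over `Ω`, so that they can be compared outcome
by outcome, with null outcomes dropping out. -/
theorem ent_law (p : Ω → ℝ) (X : Ω → α) :
    ent (law p X) = -∑ ω, p ω * log (law p X (X ω)) := by
  rw [← sum_law_mul p X (fun x => log (law p X x)), ent, ← Finset.sum_neg_distrib]
  exact Finset.sum_congr rfl fun x _ => by rw [negMulLog]; ring

/-- The fibre of the coarser variable contains that of `X`, so its probability is larger at every
outcome. No normalization of `p` is needed. -/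
theorem ent_law_comp_le {p : Ω → ℝ} (hp : ∀ ω, 0 ≤ p ω) (X : Ω → α) (f : α → β) :
    ent (law p (fun ω => f (X ω))) ≤ ent (law p X) := by
  rw [ent_law, ent_law]
  refine neg_le_neg (Finset.sum_le_sum fun ω _ => ?_)
  rcases (hp ω).eq_or_lt with h | h
  · simp [← h]
  · exact mul_le_mul_of_nonneg_left
      (log_le_log (h.trans_le (le_law hp X ω)) (law_le_law_comp hp X f (X ω))) (hp ω)

theorem ent_law_le_of_eq {p : Ω → ℝ} (hp : ∀ ω, 0 ≤ p ω) {X : Ω → α} {Y : Ω → β} (f : α → β)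
    (h : ∀ ω, Y ω = f (X ω)) : ent (law p Y) ≤ ent (law p X) := by
  obtain rfl : Y = fun ω => f (X ω) := funext h
  exact ent_law_comp_le hp X f

theorem ent_law_congr {p : Ω → ℝ} (hp : ∀ ω, 0 ≤ p ω) {X : Ω → α} {Y : Ω → β} (f : α → β)
    (g : β → α) (hf : ∀ ω, Y ω = f (X ω)) (hg : ∀ ω, X ω = g (Y ω)) :
    ent (law p Y) = ent (law p X) :=
  le_antisymm (ent_law_le_of_eq hp f hf) (ent_law_le_of_eq hp g hg)

/-- The chain rule; the factor `log 2` converts bits to nats, the unit of everything that follows.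
-/
theorem condEntropy_mul_log {p : Ω → ℝ} (hp : ∀ ω, 0 ≤ p ω) (X : Ω → α) (Y : Ω → β) :
    condEntropy p X Y * log 2 = ent (law p (fun ω => (X ω, Y ω))) - ent (law p Y) := by
  have hl : log 2 ≠ 0 := (log_pos one_lt_two).ne'
  rw [ent_law, ent_law, condEntropy, ← Fintype.sum_prod_type'
    (f := fun x y => law p (fun ω => (X ω, Y ω)) (x, y) *
      logb 2 (law p (fun ω => (X ω, Y ω)) (x, y) / law p Y y))]
  rw [sum_law_mul p (fun ω => (X ω, Y ω))
    (fun z => logb 2 (law p (fun ω => (X ω, Y ω)) z / law p Y z.2)), neg_mul, Finset.sum_mul,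
    sub_eq_add_neg, neg_neg, neg_add_eq_sub, ← Finset.sum_sub_distrib, ← Finset.sum_neg_distrib]
  refine Finset.sum_congr rfl fun ω _ => ?_
  rcases (hp ω).eq_or_lt with h | h
  · simp [← h]
  · have h1 := h.trans_le (le_law hp (fun ω => (X ω, Y ω)) ω)
    have h2 := h.trans_le (le_law hp Y ω)
    rw [logb, log_div h1.ne' h2.ne']
    field_simp
    ring

/-- Gibbs' inequality for unnormalized mass functions. -/
theorem sum_mul_log_le_sum_mul_log {p q : α → ℝ} (hp : ∀ x, 0 ≤ p x) (hq : ∀ x, 0 ≤ q x)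
    (hpq : ∀ x, 0 < p x → 0 < q x) (hsum : ∑ x, q x ≤ ∑ x, p x) :
    ∑ x, p x * log (q x) ≤ ∑ x, p x * log (p x) := by
  have key : ∀ x, p x * log (q x) - p x * log (p x) ≤ q x - p x := by
    intro x
    rcases (hp x).eq_or_lt with h | h
    · simp [← h, hq x]
    · have h2 := hpq x h
      have h3 := log_le_sub_one_of_pos (div_pos h2 h)
      rw [log_div h2.ne' h.ne'] at h3
      calc p x * log (q x) - p x * log (p x) = p x * (log (q x) - log (p x)) := by ring
        _ ≤ p x * (q x / p x - 1) := mul_le_mul_of_nonneg_left h3 h.le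
        _ = q x - p x := by field_simp
  have := Finset.sum_le_sum fun x (_ : x ∈ Finset.univ) => key x
  simp only [Finset.sum_sub_distrib] at this
  linarith

/-- Nonnegativity of mutual information for an unnormalized matrix: Gibbs' inequality against the
product `r i * c j / t` of the marginals. It yields both strong subadditivity and the concavity of
the output entropy. -/
theorem sum_negMulLog_add_negMulLog_sum_le {x : α → β → ℝ} (hx : ∀ i j, 0 ≤ x i j) :
    (∑ i, ∑ j, negMulLog (x i j)) + negMulLog (∑ i, ∑ j, x i j) ≤
      (∑ i, negMulLog (∑ j, x i j)) + ∑ j, negMulLog (∑ i, x i j) := by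
  set r : α → ℝ := fun i => ∑ j, x i j with hr
  set c : β → ℝ := fun j => ∑ i, x i j with hc
  set t : ℝ := ∑ i, ∑ j, x i j with ht
  have hr0 : ∀ i, 0 ≤ r i := fun i => Finset.sum_nonneg fun j _ => hx i j
  have hc0 : ∀ j, 0 ≤ c j := fun j => Finset.sum_nonneg fun i _ => hx i j
  have ht0 : 0 ≤ t := Finset.sum_nonneg fun i _ => hr0 i
  have hrt : ∑ i, r i = t := rfl
  have hct : ∑ j, c j = t := Finset.sum_comm
  have hxr : ∀ i j, x i j ≤ r i := fun i j =>
    Finset.single_le_sum (f := fun j => x i j) (fun j _ => hx i j) (Finset.mem_univ j)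
  have hxc : ∀ i j, x i j ≤ c j := fun i j =>
    Finset.single_le_sum (f := fun i => x i j) (fun i _ => hx i j) (Finset.mem_univ i)
  have hrle : ∀ i, r i ≤ t := fun i =>
    Finset.single_le_sum (f := r) (fun i _ => hr0 i) (Finset.mem_univ i)
  have hpos : ∀ i j, 0 < x i j → 0 < r i * c j / t := fun i j h =>
    div_pos (mul_pos (h.trans_le (hxr i j)) (h.trans_le (hxc i j)))
      (h.trans_le ((hxr i j).trans (hrle i)))
  have hs : ∑ z : α × β, r z.1 * c z.2 / t ≤ ∑ z : α × β, x z.1 z.2 := by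
    rw [Fintype.sum_prod_type, Fintype.sum_prod_type]
    simp only [← Finset.sum_div, ← Finset.mul_sum, ← Finset.sum_mul, hct, hrt]
    -- The comparison weights have total mass `t * t / t`, which equals `t` even when `t = 0`.
    rw [mul_self_div_self]
  have key := sum_mul_log_le_sum_mul_log (p := fun z : α × β => x z.1 z.2)
    (q := fun z => r z.1 * c z.2 / t) (fun z => hx _ _)
    (fun z => div_nonneg (mul_nonneg (hr0 _) (hc0 _)) ht0) (fun z => hpos z.1 z.2) hs
  rw [Fintype.sum_prod_type, Fintype.sum_prod_type] at key
  have e1 : ∀ i j, x i j * log (r i * c j / t) =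
      x i j * log (r i) + x i j * log (c j) - x i j * log t := by
    intro i j
    rcases (hx i j).eq_or_lt with h | h
    · simp [← h]
    · rw [log_div (mul_pos (h.trans_le (hxr i j)) (h.trans_le (hxc i j))).ne'
        (h.trans_le ((hxr i j).trans (hrle i))).ne',
        log_mul (h.trans_le (hxr i j)).ne' (h.trans_le (hxc i j)).ne']
      ring
  simp only [e1, Finset.sum_sub_distrib, Finset.sum_add_distrib] at key
  have e2 : ∑ i, ∑ j, x i j * log (c j) = ∑ j, c j * log (c j) := by
    rw [Finset.sum_comm]; simp only [← Finset.sum_mul, hc]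
  rw [e2] at key
  simp only [← Finset.sum_mul] at key
  simp only [negMulLog, neg_mul, Finset.sum_neg_distrib]
  linarith

/-- Strong subadditivity of entropy. -/
theorem ent_submodular {p : Ω → ℝ} (hp : ∀ ω, 0 ≤ p ω) (X : Ω → α) (Y : Ω → β) (Z : Ω → γ) :
    ent (law p (fun ω => (X ω, Y ω, Z ω))) + ent (law p Z) ≤
      ent (law p (fun ω => (X ω, Z ω))) + ent (law p (fun ω => (Y ω, Z ω))) := by
  have key : ∀ z, _ := fun z => sum_negMulLog_add_negMulLog_sum_le
    (x := fun x y => law p (fun ω => (X ω, Y ω, Z ω)) (x, y, z)) (fun x y => law_nonneg hp _ _)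
  have e1 : ∀ x z, ∑ y, law p (fun ω => (X ω, Y ω, Z ω)) (x, y, z) =
      law p (fun ω => (X ω, Z ω)) (x, z) := by
    intro x z
    classical
    simp only [law, Prod.mk.injEq]
    rw [Finset.sum_comm]
    refine Finset.sum_congr rfl fun ω _ => ?_
    by_cases h : X ω = x <;> by_cases h' : Z ω = z <;> simp [h, h']
  have e2 : ∀ y z, ∑ x, law p (fun ω => (X ω, Y ω, Z ω)) (x, y, z) =
      law p (fun ω => (Y ω, Z ω)) (y, z) := fun y z => law_snd p X (fun ω => (Y ω, Z ω)) (y, z)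
  simp only [e1, e2, law_snd p X Z] at key
  have := Finset.sum_le_sum fun z (_ : z ∈ Finset.univ) => key z
  simp only [Finset.sum_add_distrib] at this
  simp only [ent, Fintype.sum_prod_type]
  have c1 : ∑ x, ∑ y, ∑ z, negMulLog (law p (fun ω => (X ω, Y ω, Z ω)) (x, y, z)) =
      ∑ z, ∑ x, ∑ y, negMulLog (law p (fun ω => (X ω, Y ω, Z ω)) (x, y, z)) := by
    rw [Finset.sum_comm_cycle]
  rw [c1, Finset.sum_comm (γ := α), Finset.sum_comm (γ := β)]
  exact this

/-- Continuity of entropy in total variation. -/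
theorem ent_le_ent_add [Nonempty α] {p q : α → ℝ} (hp : ∀ x, 0 ≤ p x) (hq : ∀ x, 0 ≤ q x)
    (hp1 : ∑ x, p x = 1) (hq1 : ∑ x, q x = 1) :
    ent q ≤ ent p + tvDist p q + tvDist p q * log (Fintype.card α) + negMulLog (tvDist p q) := by
  -- The overlap `m` has mass `1 - tvDist p q`. Subadditivity of `negMulLog` splits `q` into `m` and
  -- the excess `q - m`; returning from `m` to `p` costs at most the removed mass; the excess, of
  -- mass `tvDist p q`, is bounded by Jensen over the alphabet.
  set m : α → ℝ := fun x => min (p x) (q x) with hm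
  have hm0 : ∀ x, 0 ≤ m x := fun x => le_min (hp x) (hq x)
  have habs : ∀ x, |p x - q x| = (p x - m x) + (q x - m x) := by
    intro x
    rcases le_total (p x) (q x) with h | h
    · rw [abs_of_nonpos (by linarith)]; simp [hm, h]
    · rw [abs_of_nonneg (by linarith)]; simp [hm, h]
  have htv : tvDist p q = 1 - ∑ x, m x := by
    simp only [tvDist, habs, Finset.sum_add_distrib, Finset.sum_sub_distrib, hp1, hq1]; ring
  have hd1 : ∑ x, (q x - m x) = tvDist p q := by rw [Finset.sum_sub_distrib, hq1, htv]
  have hd2 : ∑ x, (p x - m x) = tvDist p q := by rw [Finset.sum_sub_distrib, hp1, htv]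
  have hqm : ∀ x, 0 ≤ q x - m x := fun x => sub_nonneg.2 (min_le_right _ _)
  have hpm : ∀ x, 0 ≤ p x - m x := fun x => sub_nonneg.2 (min_le_left _ _)
  have hsub : ∀ x y : ℝ, 0 ≤ x → 0 ≤ y → negMulLog (x + y) ≤ negMulLog x + negMulLog y := by
    intro x y hx hy
    rcases hx.eq_or_lt with rfl | hx
    · simp
    rcases hy.eq_or_lt with rfl | hy
    · simp
    have h1 : log x ≤ log (x + y) := log_le_log hx (by linarith)
    have h2 : log y ≤ log (x + y) := log_le_log hy (by linarith)
    simp only [negMulLog]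
    nlinarith [mul_le_mul_of_nonneg_left h1 hx.le, mul_le_mul_of_nonneg_left h2 hy.le]
  have hmono : ∀ x y : ℝ, 0 ≤ x → 0 ≤ y → x + y ≤ 1 → negMulLog x ≤ negMulLog (x + y) + y := by
    intro x y hx hy hxy
    rcases hx.eq_or_lt with rfl | hx
    · have := negMulLog_nonneg hy (by linarith)
      simp; linarith
    have h1 := log_le_sub_one_of_pos (show 0 < (x + y) / x by positivity)
    rw [log_div (by positivity) hx.ne'] at h1
    have h2 : log (x + y) ≤ 0 := log_nonpos (by linarith) hxy
    have h3 : x * ((x + y) / x - 1) = y := by field_simp; ring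
    simp only [negMulLog]
    nlinarith [mul_le_mul_of_nonneg_left h1 hx.le]
  have hp_le : ∀ x, p x ≤ 1 := fun x => hp1 ▸
    Finset.single_le_sum (fun x _ => hp x) (Finset.mem_univ x)
  have s1 : ent q ≤ ∑ x, negMulLog (m x) + ∑ x, negMulLog (q x - m x) := by
    rw [← Finset.sum_add_distrib]
    refine Finset.sum_le_sum fun x _ => ?_
    simpa using hsub (m x) (q x - m x) (hm0 x) (hqm x)
  have s2 : ∑ x, negMulLog (m x) ≤ ent p + tvDist p q := by
    rw [← hd2, ent, ← Finset.sum_add_distrib]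
    refine Finset.sum_le_sum fun x _ => ?_
    simpa using hmono (m x) (p x - m x) (hm0 x) (hpm x) (by simpa using hp_le x)
  have s3 : ∑ x, negMulLog (q x - m x) ≤
      tvDist p q * log (Fintype.card α) + negMulLog (tvDist p q) := by
    have hN : (0 : ℝ) < Fintype.card α := by exact_mod_cast Fintype.card_pos
    have := concaveOn_negMulLog.le_map_sum (t := Finset.univ)
      (w := fun _ : α => (1 : ℝ) / Fintype.card α) (p := fun x => q x - m x)
      (fun _ _ => by positivity) (by simp [hN.ne']) (fun x _ => hqm x)
    simp only [smul_eq_mul, ← Finset.mul_sum, hd1] at this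
    rw [negMulLog_mul, show negMulLog (1 / (Fintype.card α : ℝ)) =
      1 / (Fintype.card α : ℝ) * log (Fintype.card α) by simp [negMulLog], one_div] at this
    have h2 := mul_le_mul_of_nonneg_left this hN.le
    rw [mul_add, mul_inv_cancel_left₀ hN.ne', mul_inv_cancel_left₀ hN.ne'] at h2
    have e : (Fintype.card α : ℝ) * (tvDist p q * ((Fintype.card α : ℝ)⁻¹ * log (Fintype.card α)))
      = tvDist p q * log (Fintype.card α) := by field_simp
    linarith
  linarith

end Laws

/-- In finite dimension the convex hull of a nonempty compact set is compact. -/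
theorem isCompact_convexHull_of_isCompact {V : Type*} [NormedAddCommGroup V] [NormedSpace ℝ V]
    [FiniteDimensional ℝ V] {K : Set V} (hK : IsCompact K) (hne : K.Nonempty) :
    IsCompact (convexHull ℝ K) := by
  obtain ⟨x₀, hx₀⟩ := hne
  set N := Module.finrank ℝ V + 1 with hN
  set f : (Fin N → ℝ) × (Fin N → V) → V := fun y => ∑ i, y.1 i • y.2 i with hf
  have hcont : Continuous f := by fun_prop
  have hcomp : IsCompact (stdSimplex ℝ (Fin N) ×ˢ Set.univ.pi fun _ : Fin N => K) :=
    (isCompact_stdSimplex ℝ (Fin N)).prod (isCompact_univ_pi fun _ => hK)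
  convert hcomp.image hcont using 1
  apply Set.Subset.antisymm
  · intro x hx
    -- Carathéodory: at most `N` affinely independent points suffice. Missing slots are padded with
    -- weight zero at `x₀`, so the hull is the image of one fixed compact set.
    obtain ⟨ι, hι, z, w, hz, hind, hw, hw1, rfl⟩ := eq_pos_convex_span_of_mem_convexHull hx
    have hcard : Fintype.card ι ≤ Fintype.card (Fin N) := by
      rw [Fintype.card_fin]
      exact hind.card_le_finrank_succ.trans (Nat.add_le_add_right (Submodule.finrank_le _) 1)
    obtain ⟨e⟩ := Function.Embedding.nonempty_of_card_le hcard
    have hz' : ∀ i, z i ∈ K := fun i => hz ⟨i, rfl⟩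
    have hext : ∀ (j : Fin N), j ∉ Set.range e → Function.extend e w 0 j = 0 := fun j hj => by
      rw [Function.extend_apply' _ _ _ (by simpa using hj)]; rfl
    refine ⟨(Function.extend e w 0, Function.extend e z fun _ => x₀), ⟨⟨fun j => ?_, ?_⟩, ?_⟩, ?_⟩
    · by_cases hj : j ∈ Set.range e
      · obtain ⟨i, rfl⟩ := hj
        simpa [e.injective.extend_apply] using (hw i).le
      · exact (hext j hj).ge
    · rw [← hw1]
      exact (Fintype.sum_of_injective e e.injective _ _ (fun j hj => hext j hj)
        (fun i => (e.injective.extend_apply _ _ _).symm)).symm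
    · intro j _
      by_cases hj : j ∈ Set.range e
      · obtain ⟨i, rfl⟩ := hj
        simpa [e.injective.extend_apply] using hz' i
      · simpa [Function.extend_apply' _ _ _ (show ¬∃ a, e a = j by simpa using hj)] using hx₀
    · simp only [hf]
      exact (Fintype.sum_of_injective e e.injective _ _
        (fun j hj => by simp only [hext j hj, zero_smul])
        (fun i => by simp only [e.injective.extend_apply])).symm
  · rintro _ ⟨⟨w, z⟩, ⟨⟨hw0, hw1⟩, hz⟩, rfl⟩
    exact (convex_convexHull ℝ K).sum_mem (fun i _ => hw0 i) hw1
      (fun i _ => subset_convexHull ℝ K (hz i trivial))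

/-! ### Single-letter quantities as points of a compact convex hull -/

section Features

variable {S A B E : Type*} [Fintype S] [Fintype A] [Fintype B] [Fintype E]

/-- The conditional entropy, in nats, of the output of the channel `V` given the state, under an
unnormalized mass function of the state and the channel input. -/
def outputCondEnt (V : A → S → B → ℝ) (q : S × A → ℝ) : ℝ :=
  (∑ s, ∑ b, negMulLog (∑ a, q (s, a) * V a s b)) - ∑ s, negMulLog (∑ a, q (s, a))

/-- The channel to the receiver. -/
def receiverChannel (W : A → S → stdSimplex ℝ (B × E)) (a : A) (s : S) (b : B) : ℝ :=
  ∑ e, W a s (b, e)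

/-- The channel to the warden. -/
def wardenChannel (W : A → S → stdSimplex ℝ (B × E)) (a : A) (s : S) (e : E) : ℝ :=
  ∑ b, W a s (b, e)

theorem receiverChannel_nonneg (W : A → S → stdSimplex ℝ (B × E)) (a : A) (s : S) (b : B) :
    0 ≤ receiverChannel W a s b := Finset.sum_nonneg fun _ _ => stdSimplex.zero_le _ _

theorem wardenChannel_nonneg (W : A → S → stdSimplex ℝ (B × E)) (a : A) (s : S) (e : E) :
    0 ≤ wardenChannel W a s e := Finset.sum_nonneg fun _ _ => stdSimplex.zero_le _ _

theorem sum_receiverChannel (W : A → S → stdSimplex ℝ (B × E)) (a : A) (s : S) :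
    ∑ b, receiverChannel W a s b = 1 := by
  simp only [receiverChannel, ← Fintype.sum_prod_type (f := fun z => W a s z),
    stdSimplex.sum_eq_one]

theorem sum_wardenChannel (W : A → S → stdSimplex ℝ (B × E)) (a : A) (s : S) :
    ∑ e, wardenChannel W a s e = 1 := by
  simp only [wardenChannel]
  rw [Finset.sum_comm]
  simp only [← Fintype.sum_prod_type (f := fun z => W a s z), stdSimplex.sum_eq_one]

theorem sum_output {V : A → S → B → ℝ} (hV : ∀ a s, ∑ b, V a s b = 1) (q : S × A → ℝ) (s : S) :
    ∑ b, ∑ a, q (s, a) * V a s b = ∑ a, q (s, a) := by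
  rw [Finset.sum_comm]
  simp only [← Finset.mul_sum, hV, mul_one]

/-- The `c log c` terms cancel because the channel preserves the mass of each state. Homogeneity
lets unnormalized laws `P(u,·,·)` stand for weighted conditional laws. -/
theorem outputCondEnt_smul {V : A → S → B → ℝ} (hV : ∀ a s, ∑ b, V a s b = 1) (c : ℝ)
    (q : S × A → ℝ) : outputCondEnt V (c • q) = c * outputCondEnt V q := by
  simp only [outputCondEnt, Pi.smul_apply, smul_eq_mul, mul_assoc, ← Finset.mul_sum,
    negMulLog_mul, Finset.sum_add_distrib, ← Finset.sum_mul, sum_output hV]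
  ring

/-- Conditioning reduces entropy, applied state by state to the matrix indexed by `i` and the
output. With homogeneity this is concavity, used for time sharing. -/
theorem sum_outputCondEnt_le {ι : Type*} [Fintype ι] {V : A → S → B → ℝ}
    (hV0 : ∀ a s b, 0 ≤ V a s b) (hV : ∀ a s, ∑ b, V a s b = 1) {q : ι → S × A → ℝ}
    (hq : ∀ i x, 0 ≤ q i x) :
    ∑ i, outputCondEnt V (q i) ≤ outputCondEnt V (∑ i, q i) := by
  have key : ∀ s, _ := fun s => sum_negMulLog_add_negMulLog_sum_le
    (x := fun i b => ∑ a, q i (s, a) * V a s b)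
    (fun i b => Finset.sum_nonneg fun a _ => mul_nonneg (hq _ _) (hV0 _ _ _))
  have e : ∀ s b, ∑ a, (∑ i, q i) (s, a) * V a s b = ∑ i, ∑ a, q i (s, a) * V a s b := by
    intro s b
    rw [Finset.sum_comm]
    simp only [Finset.sum_apply, Finset.sum_mul]
  have e' : ∀ s, ∑ a, (∑ i, q i) (s, a) = ∑ i, ∑ a, q i (s, a) := by
    intro s
    rw [Finset.sum_comm]
    simp only [Finset.sum_apply]
  have h := Finset.sum_le_sum fun s (_ : s ∈ Finset.univ) => key s
  simp only [Finset.sum_add_distrib, sum_output hV] at h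
  simp only [outputCondEnt, e, e', Finset.sum_sub_distrib]
  have c1 : ∑ i, ∑ s, ∑ b, negMulLog (∑ a, q i (s, a) * V a s b) =
      ∑ s, ∑ i, ∑ b, negMulLog (∑ a, q i (s, a) * V a s b) := Finset.sum_comm
  have c2 : ∑ i, ∑ s, negMulLog (∑ a, q i (s, a)) =
      ∑ s, ∑ i, negMulLog (∑ a, q i (s, a)) := Finset.sum_comm
  linarith

theorem continuous_outputCondEnt (V : A → S → B → ℝ) : Continuous (outputCondEnt V) := by
  unfold outputCondEnt
  fun_prop

/-- A mass function of state and input together with the two output entropies given the state. -/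
def feature (W : A → S → stdSimplex ℝ (B × E)) (q : S × A → ℝ) : (S × A → ℝ) × ℝ × ℝ :=
  (q, outputCondEnt (receiverChannel W) q, outputCondEnt (wardenChannel W) q)

/-- The convex hull of all features. -/
def featureHull (W : A → S → stdSimplex ℝ (B × E)) : Set ((S × A → ℝ) × ℝ × ℝ) :=
  convexHull ℝ (feature W '' stdSimplex ℝ (S × A))

/-- Takes the place of a cardinality bound on the auxiliary alphabet: limits are taken among hull
points, whose dimension is fixed. -/
theorem isCompact_featureHull [Nonempty S] [Nonempty A] (W : A → S → stdSimplex ℝ (B × E)) :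
    IsCompact (featureHull W) := by
  classical
  refine isCompact_convexHull_of_isCompact ((isCompact_stdSimplex ℝ (S × A)).image ?_) ?_
  · exact continuous_id.prodMk
      ((continuous_outputCondEnt _).prodMk (continuous_outputCondEnt _))
  · exact ⟨_, _, single_mem_stdSimplex ℝ (Classical.arbitrary (S × A)), rfl⟩

/-- The law of the warden's output induced by a mass function of state and input. -/
def wardenOutput (W : A → S → stdSimplex ℝ (B × E)) (q : S × A → ℝ) (e : E) : ℝ :=
  ∑ s, ∑ a, q (s, a) * wardenChannel W a s e

/-- A mass function normalized to the simplex, when it is nonzero. -/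
theorem exists_stdSimplex_smul {α : Type*} [Fintype α] [Nonempty α] {f : α → ℝ}
    (hf : ∀ x, 0 ≤ f x) : ∃ q : stdSimplex ℝ α, ∀ x, (∑ y, f y) * q x = f x := by
  classical
  rcases (Finset.sum_nonneg fun x (_ : x ∈ Finset.univ) => hf x).eq_or_lt with h | h
  -- For the zero function any vertex will do, both sides being zero.
  · refine ⟨stdSimplex.vertex (Classical.arbitrary α), fun x => ?_⟩
    rw [← h, zero_mul]
    exact ((Finset.sum_eq_zero_iff_of_nonneg fun x _ => hf x).1 h.symm x (Finset.mem_univ x)).symm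
  · refine ⟨⟨fun x => f x / ∑ y, f y, fun x => div_nonneg (hf x) h.le, ?_⟩, fun x => ?_⟩
    · rw [← Finset.sum_div, div_self h.ne']
    · exact mul_div_cancel₀ _ h.ne'

/-- Disintegration of `ρ` in the order state, auxiliary variable, input. Kernels are arbitrary at
conditions of mass zero, where the product vanishes anyway. -/
theorem exists_jointLaw_eq {U : Type*} [Fintype U] [Nonempty U] [Nonempty A] (Q : stdSimplex ℝ S)
    (W : A → S → stdSimplex ℝ (B × E)) {ρ : U → S × A → ℝ} (hρ : ∀ u x, 0 ≤ ρ u x)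
    (hQ : ∀ s, ∑ u, ∑ a, ρ u (s, a) = Q s) :
    ∃ (pU : S → stdSimplex ℝ U) (pA : U → S → stdSimplex ℝ A), ∀ s u a b e,
      jointLaw Q pU pA W (s, u, a, b, e) = ρ u (s, a) * W a s (b, e) := by
  choose pU hU using fun s => exists_stdSimplex_smul (f := fun u => ∑ a, ρ u (s, a))
    (fun u => Finset.sum_nonneg fun a _ => hρ _ _)
  choose pA hA using fun u s => exists_stdSimplex_smul (f := fun a => ρ u (s, a))
    (fun a => hρ _ _)
  refine ⟨pU, pA, fun s u a b e => ?_⟩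
  simp only [jointLaw]
  rw [← hQ s, hU s u, hA u s a]

section JointLaw

variable {U : Type*} [Fintype U] {ρ : U → S × A → ℝ} {W : A → S → stdSimplex ℝ (B × E)}
  {P : S × U × A × B × E → ℝ}

theorem law_rvU_rvS (hP : ∀ s u a b e, P (s, u, a, b, e) = ρ u (s, a) * W a s (b, e)) (u : U)
    (s : S) : law P (fun ω => (rvU ω, rvS ω)) (u, s) = ∑ a, ρ u (s, a) := by
  classical
  simp [law, Fintype.sum_prod_type, rvU, rvS, ite_and, hP, ← Finset.mul_sum]

theorem law_rvU_rvB_rvS (hP : ∀ s u a b e, P (s, u, a, b, e) = ρ u (s, a) * W a s (b, e))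
    (u : U) (b : B) (s : S) : law P (fun ω => (rvU ω, rvB ω, rvS ω)) (u, b, s) =
      ∑ a, ρ u (s, a) * receiverChannel W a s b := by
  classical
  rw [← law_fst P (fun ω => (rvU ω, rvB ω, rvS ω)) rvE]
  simp only [receiverChannel, Finset.mul_sum]
  rw [Finset.sum_comm]
  simp [law, Fintype.sum_prod_type, rvU, rvS, rvB, rvE, ite_and, hP]

theorem law_rvU_rvE_rvS (hP : ∀ s u a b e, P (s, u, a, b, e) = ρ u (s, a) * W a s (b, e))
    (u : U) (e : E) (s : S) : law P (fun ω => (rvU ω, rvE ω, rvS ω)) (u, e, s) =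
      ∑ a, ρ u (s, a) * wardenChannel W a s e := by
  classical
  simp [law, Fintype.sum_prod_type, rvU, rvS, rvE, ite_and, hP, wardenChannel, Finset.mul_sum]

theorem law_rvS (hP : ∀ s u a b e, P (s, u, a, b, e) = ρ u (s, a) * W a s (b, e)) (s : S) :
    law P rvS s = ∑ a, (∑ u, ρ u) (s, a) := by
  rw [← law_snd P rvU rvS s]
  simp only [law_rvU_rvS hP, Finset.sum_apply]
  exact Finset.sum_comm

theorem law_rvB_rvS (hP : ∀ s u a b e, P (s, u, a, b, e) = ρ u (s, a) * W a s (b, e))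
    (b : B) (s : S) : law P (fun ω => (rvB ω, rvS ω)) (b, s) =
      ∑ a, (∑ u, ρ u) (s, a) * receiverChannel W a s b := by
  rw [← law_snd P rvU (fun ω => (rvB ω, rvS ω))]
  simp only [law_rvU_rvB_rvS hP, Finset.sum_apply, Finset.sum_mul]
  exact Finset.sum_comm

theorem law_rvE_rvS (hP : ∀ s u a b e, P (s, u, a, b, e) = ρ u (s, a) * W a s (b, e))
    (e : E) (s : S) : law P (fun ω => (rvE ω, rvS ω)) (e, s) =
      ∑ a, (∑ u, ρ u) (s, a) * wardenChannel W a s e := by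
  rw [← law_snd P rvU (fun ω => (rvE ω, rvS ω))]
  simp only [law_rvU_rvE_rvS hP, Finset.sum_apply, Finset.sum_mul]
  exact Finset.sum_comm

theorem law_rvE (hP : ∀ s u a b e, P (s, u, a, b, e) = ρ u (s, a) * W a s (b, e)) (e : E) :
    law P rvE e = wardenOutput W (∑ u, ρ u) e := by
  rw [← law_fst P rvE rvS e, wardenOutput]
  simp only [law_rvE_rvS hP]

/-- By symmetry of mutual information, `H(U|S) - H(U|B,S)` becomes `H(B|S) - H(B|U,S)`, whose terms
are output entropies of `∑ ρ u` and of the single `ρ u`. -/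
theorem condMutualInfo_rvB_mul_log (hP0 : ∀ ω, 0 ≤ P ω)
    (hP : ∀ s u a b e, P (s, u, a, b, e) = ρ u (s, a) * W a s (b, e)) :
    condMutualInfo P rvU rvB rvS * log 2 = outputCondEnt (receiverChannel W) (∑ u, ρ u) -
      ∑ u, outputCondEnt (receiverChannel W) (ρ u) := by
  rw [condMutualInfo, sub_mul, condEntropy_mul_log hP0, condEntropy_mul_log hP0]
  simp only [ent, Fintype.sum_prod_type, law_rvU_rvS hP, law_rvS hP, law_rvU_rvB_rvS hP,
    law_rvB_rvS hP, outputCondEnt, Finset.sum_sub_distrib]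
  rw [Finset.sum_comm (s := (Finset.univ : Finset B)) (t := (Finset.univ : Finset S))]
  have : ∀ u, ∑ b, ∑ s, negMulLog (∑ a, ρ u (s, a) * receiverChannel W a s b) =
    ∑ s, ∑ b, negMulLog (∑ a, ρ u (s, a) * receiverChannel W a s b) := fun u => Finset.sum_comm
  simp only [this]
  ring

theorem condMutualInfo_rvE_mul_log (hP0 : ∀ ω, 0 ≤ P ω)
    (hP : ∀ s u a b e, P (s, u, a, b, e) = ρ u (s, a) * W a s (b, e)) :
    condMutualInfo P rvU rvE rvS * log 2 = outputCondEnt (wardenChannel W) (∑ u, ρ u) -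
      ∑ u, outputCondEnt (wardenChannel W) (ρ u) := by
  rw [condMutualInfo, sub_mul, condEntropy_mul_log hP0, condEntropy_mul_log hP0]
  simp only [ent, Fintype.sum_prod_type, law_rvU_rvS hP, law_rvS hP, law_rvU_rvE_rvS hP,
    law_rvE_rvS hP, outputCondEnt, Finset.sum_sub_distrib]
  rw [Finset.sum_comm (s := (Finset.univ : Finset E)) (t := (Finset.univ : Finset S))]
  have : ∀ u, ∑ e, ∑ s, negMulLog (∑ a, ρ u (s, a) * wardenChannel W a s e) =
    ∑ s, ∑ e, negMulLog (∑ a, ρ u (s, a) * wardenChannel W a s e) := fun u => Finset.sum_comm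
  simp only [this]
  ring

/-- This is `H(S|E) = H(E|S) + H(S) - H(E)`; its first term cancels against the one in `I(U;E|S)`.
-/
theorem condEntropy_rvS_rvE_mul_log (hP0 : ∀ ω, 0 ≤ P ω)
    (hP : ∀ s u a b e, P (s, u, a, b, e) = ρ u (s, a) * W a s (b, e)) :
    condEntropy P rvS rvE * log 2 = outputCondEnt (wardenChannel W) (∑ u, ρ u) +
      ent (law P rvS) - ent (law P rvE) := by
  rw [condEntropy_mul_log hP0, show ent (law P fun ω => (rvS ω, rvE ω)) =
    ent (law P fun ω => (rvE ω, rvS ω)) from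
    ent_law_congr hP0 Prod.swap Prod.swap (fun _ => rfl) (fun _ => rfl)]
  simp only [ent, Fintype.sum_prod_type, law_rvS hP, law_rvE_rvS hP, outputCondEnt]
  rw [Finset.sum_comm (s := (Finset.univ : Finset E)) (t := (Finset.univ : Finset S))]
  ring

end JointLaw

theorem jointLaw_nonneg {U : Type*} [Fintype U] (Q : stdSimplex ℝ S) (pU : S → stdSimplex ℝ U)
    (pA : U → S → stdSimplex ℝ A) (W : A → S → stdSimplex ℝ (B × E)) (ω : S × U × A × B × E) :
    0 ≤ jointLaw Q pU pA W ω := by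
  simp only [jointLaw]
  exact mul_nonneg (mul_nonneg (mul_nonneg (stdSimplex.zero_le _ _) (stdSimplex.zero_le _ _))
    (stdSimplex.zero_le _ _)) (stdSimplex.zero_le _ _)

/-- The single-letter description of the region. -/
def singleLetterRegion (Q : stdSimplex ℝ S) (φ₀ : stdSimplex ℝ A)
    (W : A → S → stdSimplex ℝ (B × E)) : Set (ℝ × ℝ) :=
  {r : ℝ × ℝ | 0 ≤ r.1 ∧ 0 ≤ r.2 ∧
    ∃ (k : ℕ) (pU : S → stdSimplex ℝ (Fin k)) (pA : Fin k → S → stdSimplex ℝ A)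
      (P : S × Fin k × A × B × E → ℝ),
      P = jointLaw Q pU pA W ∧
      law P rvE = innocentOutput Q φ₀ W ∧
      r.1 ≤ condMutualInfo P rvU rvB rvS ∧
      r.1 + r.2 ≤ condMutualInfo P rvU rvB rvS - condMutualInfo P rvU rvE rvS
        + condEntropy P rvS rvE}

/-- The index of a convex combination representing the hull point serves as auxiliary variable, with
`P(u,·,·) = w u • q u`. -/
theorem mem_singleLetterRegion_of_feature {Q : stdSimplex ℝ S} {φ₀ : stdSimplex ℝ A}
    {W : A → S → stdSimplex ℝ (B × E)} {r : ℝ × ℝ} (h1 : 0 ≤ r.1) (h2 : 0 ≤ r.2)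
    {g : (S × A → ℝ) × ℝ × ℝ} (hg : g ∈ featureHull W) (hQ : ∀ s, ∑ a, g.1 (s, a) = Q s)
    (hE : wardenOutput W g.1 = innocentOutput Q φ₀ W)
    (hr1 : r.1 * log 2 ≤ outputCondEnt (receiverChannel W) g.1 - g.2.1)
    (hr2 : (r.1 + r.2) * log 2 ≤ outputCondEnt (receiverChannel W) g.1 - g.2.1 + g.2.2 +
      ent (Q : S → ℝ) - ent (innocentOutput Q φ₀ W)) :
    r ∈ singleLetterRegion Q φ₀ W := by
  have hl : 0 < log 2 := log_pos one_lt_two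
  obtain ⟨ι, _, w, z, hw, hw1, hz, hgz⟩ := mem_convexHull_iff_exists_fintype.1 hg
  choose q hq hqz using hz
  obtain ⟨a₀, -⟩ : ∃ a, φ₀ a ≠ 0 := by
    by_contra! h
    have := stdSimplex.sum_eq_one φ₀
    simp [h] at this
  have : Nonempty A := ⟨a₀⟩
  set e := Fintype.equivFin ι
  set ρ : Fin (Fintype.card ι) → S × A → ℝ := fun u => w (e.symm u) • q (e.symm u) with hρ
  have hsum : ∀ F : ι → ℝ, ∑ u, F (e.symm u) = ∑ i, F i := fun F => e.symm.sum_comp F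
  have hρ1 : ∑ u, ρ u = g.1 := by
    rw [← hgz, Prod.fst_sum, hρ, e.symm.sum_comp (fun i => w i • q i)]
    exact Finset.sum_congr rfl fun i _ => by rw [← hqz]; rfl
  have hρB : ∑ u, outputCondEnt (receiverChannel W) (ρ u) = g.2.1 := by
    rw [← hgz, Prod.snd_sum, Prod.fst_sum, hρ,
      e.symm.sum_comp (fun i => outputCondEnt (receiverChannel W) (w i • q i))]
    exact Finset.sum_congr rfl fun i _ => by
      rw [← hqz, outputCondEnt_smul (sum_receiverChannel W)]; rfl
  have hρE : ∑ u, outputCondEnt (wardenChannel W) (ρ u) = g.2.2 := by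
    rw [← hgz, Prod.snd_sum, Prod.snd_sum, hρ,
      e.symm.sum_comp (fun i => outputCondEnt (wardenChannel W) (w i • q i))]
    exact Finset.sum_congr rfl fun i _ => by
      rw [← hqz, outputCondEnt_smul (sum_wardenChannel W)]; rfl
  have hρ0 : ∀ u x, 0 ≤ ρ u x := fun u x => mul_nonneg (hw _) ((hq _).1 x)
  have hρQ : ∀ s, ∑ u, ∑ a, ρ u (s, a) = Q s := by
    intro s
    rw [Finset.sum_comm, ← hQ s, ← hρ1]
    simp only [Finset.sum_apply]
  have : Nonempty ι := by
    by_contra h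
    rw [not_nonempty_iff] at h
    simp at hw1
  have : Nonempty (Fin (Fintype.card ι)) := ⟨e (Classical.arbitrary ι)⟩
  obtain ⟨pU, pA, hP⟩ := exists_jointLaw_eq Q W hρ0 hρQ
  have hP0 := jointLaw_nonneg Q pU pA W
  have hS : law (jointLaw Q pU pA W) rvS = Q := funext fun s => by rw [law_rvS hP, hρ1, hQ]
  have hE' : law (jointLaw Q pU pA W) rvE = innocentOutput Q φ₀ W := by
    rw [← hE]; exact funext fun s => by rw [law_rvE hP, hρ1]
  have i1 := condMutualInfo_rvB_mul_log hP0 hP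
  have i2 := condMutualInfo_rvE_mul_log hP0 hP
  have i3 := condEntropy_rvS_rvE_mul_log hP0 hP
  rw [hρ1] at i1 i2 i3
  rw [hρB] at i1
  rw [hρE] at i2
  rw [hS, hE'] at i3
  refine ⟨h1, h2, Fintype.card ι, pU, pA, _, rfl, hE', ?_, ?_⟩
  · refine le_of_mul_le_mul_right ?_ hl
    rw [i1]; exact hr1
  · refine le_of_mul_le_mul_right ?_ hl
    rw [add_mul _ (condEntropy _ _ _), sub_mul, i1, i2, i3]
    linarith

theorem continuous_wardenOutput (W : A → S → stdSimplex ℝ (B × E)) :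
    Continuous (wardenOutput W) := by
  unfold wardenOutput
  fun_prop

/-- The single-letter region contains every pair that satisfies its constraints up to an
arbitrarily small slack. -/
theorem mem_singleLetterRegion_of_forall_approx {Q : stdSimplex ℝ S} {φ₀ : stdSimplex ℝ A}
    {W : A → S → stdSimplex ℝ (B × E)} {r : ℝ × ℝ} (h1 : 0 ≤ r.1) (h2 : 0 ≤ r.2)
    (h : ∀ ε > 0, ∃ g ∈ featureHull W, (∀ s, ∑ a, g.1 (s, a) = Q s) ∧
      (∀ e, |wardenOutput W g.1 e - innocentOutput Q φ₀ W e| ≤ ε) ∧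
      r.1 * log 2 ≤ outputCondEnt (receiverChannel W) g.1 - g.2.1 + ε ∧
      (r.1 + r.2) * log 2 ≤ outputCondEnt (receiverChannel W) g.1 - g.2.1 + g.2.2 +
        ent (Q : S → ℝ) - ent (innocentOutput Q φ₀ W) + ε) :
    r ∈ singleLetterRegion Q φ₀ W := by
  have hA : Nonempty A := by
    by_contra h
    rw [not_nonempty_iff] at h
    simpa using stdSimplex.sum_eq_one φ₀
  have hS : Nonempty S := by
    by_contra h
    rw [not_nonempty_iff] at h
    simpa using stdSimplex.sum_eq_one Q
  -- Along a convergent subsequence for slacks `1/(j+1)` every constraint passes to the limit, being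
  -- continuous in the hull point.
  choose g hg hQ hE hr1 hr2 using fun j : ℕ => h (1 / ((j : ℝ) + 1)) Nat.one_div_pos_of_nat
  obtain ⟨g', hg', σ, hσ, hlim⟩ := (isCompact_featureHull W).tendsto_subseq hg
  have hε : Tendsto (fun j => 1 / ((σ j : ℝ) + 1)) atTop (𝓝 0) :=
    tendsto_one_div_add_atTop_nhds_zero_nat.comp hσ.tendsto_atTop
  have l1 : Tendsto (fun j => (g (σ j)).1) atTop (𝓝 g'.1) :=
    (continuous_fst.tendsto _).comp hlim
  have l2 : Tendsto (fun j => (g (σ j)).2.1) atTop (𝓝 g'.2.1) :=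
    ((continuous_fst.comp continuous_snd).tendsto _).comp hlim
  have l3 : Tendsto (fun j => (g (σ j)).2.2) atTop (𝓝 g'.2.2) :=
    ((continuous_snd.comp continuous_snd).tendsto _).comp hlim
  have l4 : Tendsto (fun j => outputCondEnt (receiverChannel W) (g (σ j)).1) atTop
      (𝓝 (outputCondEnt (receiverChannel W) g'.1)) :=
    ((continuous_outputCondEnt _).tendsto _).comp l1
  refine mem_singleLetterRegion_of_feature h1 h2 hg' (fun s => ?_) ?_ ?_ ?_
  · have : Continuous fun q : S × A → ℝ => ∑ a, q (s, a) := by fun_prop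
    have := (this.tendsto _).comp l1
    refine tendsto_nhds_unique this ?_
    simp only [Function.comp_def, hQ]
    exact tendsto_const_nhds
  · funext e
    have t := ((continuous_apply e).tendsto _).comp
      (((continuous_wardenOutput W).tendsto _).comp l1)
    have t' := (t.sub_const (innocentOutput Q φ₀ W e)).abs
    exact sub_eq_zero.1 (abs_nonpos_iff.1
      (le_of_tendsto_of_tendsto' t' hε fun j => hE (σ j) e))
  · refine ge_of_tendsto' (x := atTop) ?_ fun j => hr1 (σ j)
    simpa using (l4.sub l2).add hε
  · refine ge_of_tendsto' (x := atTop) ?_ fun j => hr2 (σ j)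
    simpa using ((((l4.sub l2).add l3).add_const _).sub_const _).add hε

end Features

/-! ### Entropy of product laws, Fano's inequality, averaging out one coordinate -/

section Entropy

variable {Ω α β γ : Type*} [Fintype Ω] [Fintype α] [Fintype β] [Fintype γ]

theorem ent_law_le_of_factors {p : Ω → ℝ} (hp : ∀ ω, 0 ≤ p ω) {X : Ω → α} {Y : Ω → β}
    (h : ∀ ω ω', X ω = X ω' → Y ω = Y ω') : ent (law p Y) ≤ ent (law p X) := by
  rcases isEmpty_or_nonempty Ω with hΩ | ⟨⟨ω₀⟩⟩
  · simp [ent, law]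
  · have hf : Function.FactorsThrough Y X := fun ω ω' => h ω ω'
    exact ent_law_le_of_eq hp (Function.extend X Y fun _ => Y ω₀)
      fun ω => (hf.extend_apply _ ω).symm

theorem ent_prod (p : α → ℝ) (q : β → ℝ) :
    ent (fun z : α × β => p z.1 * q z.2) = (∑ y, q y) * ent p + (∑ x, p x) * ent q := by
  simp only [ent, Fintype.sum_prod_type, negMulLog_mul, Finset.sum_add_distrib,
    ← Finset.sum_mul, ← Finset.mul_sum]

theorem sum_prod_pi (n : ℕ) (q : α → ℝ) : ∑ x : Fin n → α, ∏ i, q (x i) = (∑ y, q y) ^ n := by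
  rw [Finset.sum_pow', Finset.sum_congr]
  · simp
  · simp

theorem ent_pi (n : ℕ) {q : α → ℝ} (hq : ∑ x, q x = 1) :
    ent (fun x : Fin n → α => ∏ i, q (x i)) = n * ent q := by
  induction n with
  | zero => simp [ent]
  | succ n ih =>
    have h1 : ent (fun x : Fin (n + 1) → α => ∏ i, q (x i)) =
        ent (fun z : α × (Fin n → α) => q z.1 * ∏ i, q (z.2 i)) := by
      rw [ent, ent, ← (Fin.consEquiv fun _ : Fin (n + 1) => α).sum_comp]
      refine Finset.sum_congr rfl fun z _ => ?_
      simp [Fin.consEquiv, Fin.prod_univ_succ]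
    rw [h1, ent_prod q (fun x : Fin n → α => ∏ i, q (x i)), ih, sum_prod_pi, hq]
    push_cast
    ring

theorem ent_const (N : ℕ) (hN : 0 < N) : ent (fun _ : Fin N => 1 / (N : ℝ)) = log N := by
  have : (N : ℝ) ≠ 0 := by positivity
  simp only [ent, Finset.sum_const, Finset.card_univ, Fintype.card_fin, negMulLog, one_div,
    log_inv, nsmul_eq_mul]
  field_simp

/-- Fano's inequality for a stochastic estimator `d`. -/
theorem ent_le_of_estimator [Nonempty α] {p : Ω → ℝ} (hp : ∀ ω, 0 ≤ p ω) (hp1 : ∑ ω, p ω = 1)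
    (X : Ω → α) (Y : Ω → β) (d : β → stdSimplex ℝ α) :
    ent (law p fun ω => (X ω, Y ω)) ≤ ent (law p Y) + log 2 +
      (∑ ω, p ω * (1 - d (Y ω) (X ω))) * log (Fintype.card α) := by
  have hN : (0 : ℝ) < Fintype.card α := by exact_mod_cast Fintype.card_pos
  set N : ℝ := (Fintype.card α : ℝ) with hNdef
  have hN1 : 1 ≤ N := by
    rw [hNdef]; exact_mod_cast Fintype.card_pos (α := α)
  -- Gibbs' inequality is applied to an equal mixture of the estimator and a uniform guess: it is
  -- positive everywhere, and by concavity of `log` its surprisal is at most `log 2 + (1 - d) log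
  -- N`.
  set t : α × β → ℝ := fun z => (d z.2 z.1 + 1 / N) / 2 with ht
  have ht0 : ∀ z, 0 < t z := fun z => by
    have := stdSimplex.zero_le (d z.2) z.1
    simp only [ht]; positivity
  have hlog : ∀ z, -log (t z) ≤ log 2 + (1 - d z.2 z.1) * log N := by
    intro z
    have h0 := stdSimplex.zero_le (d z.2) z.1
    have h1 := stdSimplex.le_one (d z.2) z.1
    simp only [ht]
    rw [log_div (by positivity) two_ne_zero]
    have hconc := strictConcaveOn_log_Ioi.concaveOn.2 (show (1 : ℝ) ∈ Set.Ioi 0 by simp)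
      (show 1 / N ∈ Set.Ioi 0 by simpa using hN) h0 (sub_nonneg.2 h1) (by ring)
    simp only [smul_eq_mul, log_one, mul_zero, zero_add, mul_one, one_div, log_inv] at hconc
    have : log (d z.2 z.1 + (1 - d z.2 z.1) * N⁻¹) ≤ log (d z.2 z.1 + 1 / N) := by
      refine log_le_log ?_ ?_
      · rcases h0.eq_or_lt with h | h
        · rw [← h]; simpa using hN
        · have : 0 ≤ (1 - d z.2 z.1) * N⁻¹ := mul_nonneg (sub_nonneg.2 h1) (by positivity)
          linarith
      · rw [one_div]
        have : 0 ≤ N⁻¹ := by positivity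
        nlinarith
    linarith
  have hgibbs := sum_mul_log_le_sum_mul_log (p := law p fun ω => (X ω, Y ω))
    (q := fun z => law p Y z.2 * t z) (fun z => law_nonneg hp _ _)
    (fun z => mul_nonneg (law_nonneg hp _ _) (ht0 z).le) (fun z hz => mul_pos
      (hz.trans_le (law_le_law_comp hp (fun ω => (X ω, Y ω)) Prod.snd z)) (ht0 z)) (by
        rw [sum_law, hp1, Fintype.sum_prod_type, Finset.sum_comm]
        simp only [ht, ← Finset.mul_sum, ← Finset.sum_div, Finset.sum_add_distrib,
          stdSimplex.sum_eq_one, Finset.sum_const, Finset.card_univ, nsmul_eq_mul, ← hNdef]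
        rw [mul_one, div_self hN.ne', ← Finset.sum_mul, sum_law, hp1]
        norm_num)
  rw [sum_law_mul p (fun ω => (X ω, Y ω)) (fun z => log (law p Y z.2 * t z)),
    sum_law_mul p (fun ω => (X ω, Y ω)) (fun z => log (law p (fun ω => (X ω, Y ω)) z))] at hgibbs
  have hsplit : ∀ ω, p ω * log (law p Y (Y ω)) - p ω * (log 2 + (1 - d (Y ω) (X ω)) * log N) ≤
      p ω * log (law p Y (Y ω) * t (X ω, Y ω)) := by
    intro ω
    rcases (hp ω).eq_or_lt with h | h
    · simp [← h]
    · rw [log_mul (h.trans_le (le_law hp Y ω)).ne' (ht0 _).ne', ← mul_sub]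
      refine mul_le_mul_of_nonneg_left ?_ h.le
      have := hlog (X ω, Y ω)
      simp only at this
      linarith
  have hs := Finset.sum_le_sum fun ω (_ : ω ∈ Finset.univ) => hsplit ω
  simp only [Finset.sum_sub_distrib, mul_add, Finset.sum_add_distrib, ← Finset.sum_mul, hp1,
    ← mul_assoc] at hs
  rw [ent_law, ent_law]
  linarith

/-- A coordinate of a product weight can be averaged out against functions that do not depend on
it. -/
theorem sum_prod_mul_coord {ι : Type*} [Fintype ι] [DecidableEq ι] (w : ι → α → ℝ) (i : ι)
    (hw : ∑ z, w i z = 1) (G : (ι → α) → ℝ)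
    (hG : ∀ x z, G (Function.update x i z) = G x) (H : α → ℝ) :
    ∑ x : ι → α, (∏ j, w j (x j)) * (G x * H (x i)) =
      ∑ x : ι → α, (∏ j, w j (x j)) * (G x * ∑ z, w i z * H z) := by
  rcases isEmpty_or_nonempty α with h | ⟨⟨z₀⟩⟩
  · simp at hw
  have key : ∀ H : α → ℝ, ∑ x : ι → α, (∏ j, w j (x j)) * (G x * H (x i)) =
      (∑ z, w i z * H z) * ∑ y : {j // j ≠ i} → α, (∏ j : {j // j ≠ i}, w j (y j)) *
        G ((Equiv.funSplitAt i α).symm (z₀, y)) := by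
    intro H
    rw [← (Equiv.funSplitAt i α).symm.sum_comp, Fintype.sum_prod_type, Finset.sum_mul_sum]
    refine Finset.sum_congr rfl fun z _ => Finset.sum_congr rfl fun y _ => ?_
    have e1 : (Equiv.funSplitAt i α).symm (z, y) i = z := by simp [Equiv.funSplitAt]
    have e2 : ∀ j : {j // j ≠ i}, (Equiv.funSplitAt i α).symm (z, y) j = y j := by
      intro j; simp [Equiv.funSplitAt, j.2]
    have e3 : G ((Equiv.funSplitAt i α).symm (z₀, y)) =
        G ((Equiv.funSplitAt i α).symm (z, y)) := by
      rw [← hG ((Equiv.funSplitAt i α).symm (z, y)) z₀]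
      congr 1
      funext j
      by_cases hj : j = i
      · subst hj; simp [Equiv.funSplitAt]
      · simp [Equiv.funSplitAt, hj]
    rw [Fintype.prod_eq_mul_prod_subtype_ne _ i, e1, e3]
    simp only [e2]
    rw [mul_comm (G _) (H z), mul_mul_mul_comm]
  rw [key H]
  have := key (fun _ => ∑ z, w i z * H z)
  simp only [← Finset.sum_mul, hw, one_mul] at this
  rw [this]

end Entropy

/-! ### The law induced by a code -/

section Converse

variable {S A B E : Type*} [Fintype S] [Fintype A] [Fintype B] [Fintype E] {n μ κ : ℕ}

variable (c : Code S A B n μ κ) (Q : stdSimplex ℝ S) (W : A → S → stdSimplex ℝ (B × E))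

theorem sum_inducedLaw_mul (F : Outcome S A B E n μ κ → ℝ) :
    ∑ ω, c.inducedLaw Q W ω * F ω = ∑ m, ∑ s : Fin n → S, ∑ x : (Fin n → A) × Fin κ,
      ∑ y : (Fin n → B) × (Fin n → E), 1 / (μ : ℝ) * (∏ i, Q (s i)) * c.enc m s x *
        ((∏ i, W (x.1 i) (s i) (y.1 i, y.2 i)) * ∑ d, c.dec y.1 s d * F (m, s, x, y, d)) := by
  simp only [Fintype.sum_prod_type (α₁ := Fin μ), Fintype.sum_prod_type (α₁ := Fin n → S),
    Fintype.sum_prod_type (α₁ := (Fin n → A) × Fin κ),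
    Fintype.sum_prod_type (α₁ := (Fin n → B) × (Fin n → E)), Finset.mul_sum]
  refine Finset.sum_congr rfl fun m _ => Finset.sum_congr rfl fun s _ =>
    Finset.sum_congr rfl fun x _ => Finset.sum_congr rfl fun y _ =>
    Finset.sum_congr rfl fun d _ => ?_
  simp only [Code.inducedLaw, mul_assoc]

theorem inducedLaw_nonneg (ω : Outcome S A B E n μ κ) : 0 ≤ c.inducedLaw Q W ω := by
  obtain ⟨m, s, ⟨a, k⟩, ⟨b, e⟩, d⟩ := ω
  simp only [Code.inducedLaw]
  have h1 : 0 ≤ ∏ i, Q (s i) := Finset.prod_nonneg fun i _ => stdSimplex.zero_le _ _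
  have h2 : 0 ≤ ∏ i, W (a i) (s i) (b i, e i) :=
    Finset.prod_nonneg fun i _ => stdSimplex.zero_le _ _
  have h3 := stdSimplex.zero_le (c.enc m s) (a, k)
  have h4 := stdSimplex.zero_le (c.dec b s) d
  positivity

theorem sum_memoryless (a : Fin n → A) (s : Fin n → S) :
    ∑ y : (Fin n → B) × (Fin n → E), ∏ i, W (a i) (s i) (y.1 i, y.2 i) = 1 := by
  rw [← (Equiv.arrowProdEquivProdArrow (Fin n) (fun _ => B) (fun _ => E)).sum_comp]
  have := Finset.prod_univ_sum (fun _ : Fin n => (Finset.univ : Finset (B × E)))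
    (fun i z => W (a i) (s i) z)
  simp only [stdSimplex.sum_eq_one, Finset.prod_const_one, Fintype.piFinset_univ] at this
  exact this.symm

theorem sum_inducedLaw_message_state (F : Fin μ → (Fin n → S) → ℝ) :
    ∑ ω, c.inducedLaw Q W ω * F ω.1 ω.2.1 =
      ∑ m, ∑ s : Fin n → S, 1 / (μ : ℝ) * (∏ i, Q (s i)) * F m s := by
  rw [sum_inducedLaw_mul c Q W (fun ω => F ω.1 ω.2.1)]
  refine Finset.sum_congr rfl fun m _ => Finset.sum_congr rfl fun s _ => ?_
  simp only [← Finset.sum_mul, ← Finset.mul_sum, stdSimplex.sum_eq_one, one_mul, sum_memoryless,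
    ← mul_assoc, mul_one]

theorem law_message_state :
    law (c.inducedLaw Q W) (fun ω => (ω.1, ω.2.1)) =
      fun z => 1 / (μ : ℝ) * ∏ i, Q (z.2 i) := by
  classical
  funext ⟨m, s⟩
  rw [law_apply]
  refine (Finset.sum_congr rfl fun ω _ => by congr).trans
    ((sum_inducedLaw_message_state c Q W
      (fun m' s' => if (m', s') = (m, s) then 1 else 0)).trans ?_)
  simp [Prod.mk.injEq, ite_and]

theorem sum_inducedLaw (hμ : 0 < μ) : ∑ ω, c.inducedLaw Q W ω = 1 := by
  have h := sum_inducedLaw_message_state c Q W (fun _ _ => 1)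
  have : (μ : ℝ) ≠ 0 := by positivity
  simp only [mul_one, ← Finset.mul_sum, sum_prod_pi, stdSimplex.sum_eq_one] at h
  rw [h]
  simp [this]

/-- Sums out the decoder's randomness, giving the form in which Fano's inequality measures the
error. -/
theorem errorProb_eq : c.errorProb Q W = ∑ ω, c.inducedLaw Q W ω *
    (1 - c.dec ω.2.2.2.1.1 ω.2.1 (ω.1, ω.2.2.1.2)) := by
  classical
  have h1 : c.errorProb Q W = ∑ ω, c.inducedLaw Q W ω *
      (if ω.2.2.2.2 ≠ (ω.1, ω.2.2.1.2) then 1 else 0) := by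
    rw [Code.errorProb]
    refine Finset.sum_congr rfl fun ω _ => ?_
    split_ifs <;> simp
  rw [h1, sum_inducedLaw_mul, sum_inducedLaw_mul]
  refine Finset.sum_congr rfl fun m _ => Finset.sum_congr rfl fun s _ =>
    Finset.sum_congr rfl fun x _ => Finset.sum_congr rfl fun y _ => ?_
  congr 2
  dsimp only
  rw [← Finset.sum_mul, stdSimplex.sum_eq_one, one_mul]
  have : ∀ d, c.dec y.1 s d * (if d ≠ (m, x.2) then 1 else 0) =
      c.dec y.1 s d - if d = (m, x.2) then c.dec y.1 s d else 0 := by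
    intro d; split_ifs <;> simp_all
  simp only [this, Finset.sum_sub_distrib, stdSimplex.sum_eq_one, Finset.sum_ite_eq',
    Finset.mem_univ, if_true]

/-- The channel is memoryless: given the current input and state, the current outputs do not
depend on the remaining variables. -/
theorem sum_inducedLaw_mul_coord (i : Fin n)
    (G : Fin μ → (Fin n → S) → (Fin n → A) × Fin κ → (Fin n → B) × (Fin n → E) → ℝ)
    (hG : ∀ m s x b e β ε, G m s x (Function.update b i β, Function.update e i ε) =
      G m s x (b, e)) (H : B × E → ℝ) :
    ∑ ω, c.inducedLaw Q W ω * (G ω.1 ω.2.1 ω.2.2.1 ω.2.2.2.1 *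
      H (ω.2.2.2.1.1 i, ω.2.2.2.1.2 i)) =
    ∑ ω, c.inducedLaw Q W ω * (G ω.1 ω.2.1 ω.2.2.1 ω.2.2.2.1 *
      ∑ z, W (ω.2.2.1.1 i) (ω.2.1 i) z * H z) := by
  rw [sum_inducedLaw_mul c Q W (fun ω => G ω.1 ω.2.1 ω.2.2.1 ω.2.2.2.1 *
      H (ω.2.2.2.1.1 i, ω.2.2.2.1.2 i)), sum_inducedLaw_mul c Q W (fun ω =>
      G ω.1 ω.2.1 ω.2.2.1 ω.2.2.2.1 * ∑ z, W (ω.2.2.1.1 i) (ω.2.1 i) z * H z)]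
  refine Finset.sum_congr rfl fun m _ => Finset.sum_congr rfl fun s _ =>
    Finset.sum_congr rfl fun x _ => ?_
  simp only [← Finset.sum_mul, ← Finset.mul_sum, stdSimplex.sum_eq_one, one_mul]
  congr 1
  rw [← (Equiv.arrowProdEquivProdArrow (Fin n) (fun _ => B) (fun _ => E)).sum_comp,
    ← (Equiv.arrowProdEquivProdArrow (Fin n) (fun _ => B) (fun _ => E)).sum_comp]
  refine sum_prod_mul_coord (fun j z => W (x.1 j) (s j) z) i (stdSimplex.sum_eq_one _)
    (fun y => G m s x (Equiv.arrowProdEquivProdArrow (Fin n) (fun _ => B) (fun _ => E) y))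
    (fun y z => ?_) H
  refine Eq.trans ?_ (hG m s x (fun j => (y j).1) (fun j => (y j).2) z.1 z.2)
  congr 1
  simp only [Equiv.arrowProdEquivProdArrow, Equiv.coe_fn_mk, Prod.mk.injEq]
  constructor <;> funext j <;> by_cases hj : j = i <;> simp [hj]

end Converse

/-! ### Partial words -/

section Words

variable {B E : Type*} {n : ℕ}

/-- The first `i` letters of a word. -/
def prefixWord (i : ℕ) (b : Fin n → B) : Fin n → Option B :=
  fun j => if (j : ℕ) < i then some (b j) else none

/-- The first `i` letters of `b` followed by the remaining letters of `e`. -/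
def mixedWord (i : ℕ) (b : Fin n → B) (e : Fin n → E) : Fin n → B ⊕ E :=
  fun j => if (j : ℕ) < i then Sum.inl (b j) else Sum.inr (e j)

/-- The letters of `b` before position `i` and the letters of `e` after it. -/
def sideWord (i : Fin n) (b : Fin n → B) (e : Fin n → E) : Fin n → Option (B ⊕ E) :=
  fun j => if j < i then some (Sum.inl (b j)) else if i < j then some (Sum.inr (e j)) else none

/-- Blanking or tagging letters keeps all partial words in a type independent of `i`. The three
criteria of this section reduce "this variable determines that one" to statements about letters, as
`ent_law_le_of_factors` requires. -/
theorem prefixWord_eq_iff {i : ℕ} {b b' : Fin n → B} :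
    prefixWord i b = prefixWord i b' ↔ ∀ j : Fin n, (j : ℕ) < i → b j = b' j := by
  simp only [funext_iff, prefixWord]
  refine forall_congr' fun j => ?_
  by_cases h : (j : ℕ) < i <;> simp [h]

theorem mixedWord_eq_iff {i : ℕ} {b b' : Fin n → B} {e e' : Fin n → E} :
    mixedWord i b e = mixedWord i b' e' ↔
      (∀ j : Fin n, (j : ℕ) < i → b j = b' j) ∧ ∀ j : Fin n, i ≤ (j : ℕ) → e j = e' j := by
  simp only [funext_iff, mixedWord, ← forall_and]
  refine forall_congr' fun j => ?_
  by_cases h : (j : ℕ) < i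
  · simp [h]
  · simp [h, not_lt.1 h]

theorem sideWord_eq_iff {i : Fin n} {b b' : Fin n → B} {e e' : Fin n → E} :
    sideWord i b e = sideWord i b' e' ↔
      (∀ j, j < i → b j = b' j) ∧ ∀ j, i < j → e j = e' j := by
  simp only [funext_iff, sideWord, ← forall_and]
  refine forall_congr' fun j => ?_
  rcases lt_trichotomy j i with h | rfl | h
  · simp [h, not_lt.2 h.le]
  · simp
  · simp [h, not_lt.2 h.le]

end Words

/-! ### Regrouping of joint laws -/

section Laws

variable {Ω α β γ δ : Type*} [Fintype Ω] [Fintype α] [Fintype β] [Fintype γ] [Fintype δ]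
  (p : Ω → ℝ) (X : Ω → α) (Y : Ω → β) (Z : Ω → γ) (T : Ω → δ)

theorem law_assoc (x : α) (y : β) (z : γ) :
    law p (fun ω => (X ω, Y ω, Z ω)) (x, y, z) =
      law p (fun ω => ((X ω, Y ω), Z ω)) ((x, y), z) := by
  classical
  simp only [law, Prod.mk.injEq, and_assoc]

theorem sum_sum_law_left (x : α) (z : γ) :
    ∑ y, ∑ t, law p (fun ω => (X ω, Y ω, (Z ω, T ω))) (x, y, (z, t)) =
      law p (fun ω => (X ω, Z ω)) (x, z) := by
  have h : ∀ y t, law p (fun ω => (X ω, Y ω, (Z ω, T ω))) (x, y, (z, t)) =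
      law p (fun ω => ((X ω, Z ω), (Y ω, T ω))) ((x, z), (y, t)) := by
    intro y t
    classical
    simp only [law, Prod.mk.injEq]
    exact Finset.sum_congr rfl fun ω _ => if_congr (by tauto) rfl rfl
  simp only [h, ← Fintype.sum_prod_type (f := fun v => law p
    (fun ω => ((X ω, Z ω), (Y ω, T ω))) ((x, z), v)), law_fst p (fun ω => (X ω, Z ω))]

theorem sum_sum_law_right (x : α) (t : δ) :
    ∑ y, ∑ z, law p (fun ω => (X ω, Y ω, (Z ω, T ω))) (x, y, (z, t)) =
      law p (fun ω => (X ω, T ω)) (x, t) := by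
  have h : ∀ y z, law p (fun ω => (X ω, Y ω, (Z ω, T ω))) (x, y, (z, t)) =
      law p (fun ω => ((X ω, T ω), (Y ω, Z ω))) ((x, t), (y, z)) := by
    intro y z
    classical
    simp only [law, Prod.mk.injEq]
    exact Finset.sum_congr rfl fun ω _ => if_congr (by tauto) rfl rfl
  simp only [h, ← Fintype.sum_prod_type (f := fun v => law p
    (fun ω => ((X ω, T ω), (Y ω, Z ω))) ((x, t), v)), law_fst p (fun ω => (X ω, T ω))]

end Laws

/-! ### The auxiliary variable of the converse -/

section Converse

variable {S A B E : Type*} [Fintype S] [Fintype A] [Fintype B] [Fintype E] {n μ κ : ℕ}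

/-- The auxiliary variable of the converse at time `i`: the outputs of the receiver before `i`,
those of the warden after `i`, the message, the key and the state sequence. -/
def auxVar (i : Fin n) (ω : Outcome S A B E n μ κ) :
    (Fin n → Option (B ⊕ E)) × Fin μ × Fin κ × (Fin n → S) :=
  (sideWord i ω.2.2.2.1.1 ω.2.2.2.1.2, ω.1, ω.2.2.1.2, ω.2.1)

variable (c : Code S A B n μ κ) (Q : stdSimplex ℝ S) (W : A → S → stdSimplex ℝ (B × E))

/-- The law of the auxiliary variable, the state and the input at time `i`. -/
def auxLaw (i : Fin n) (u : (Fin n → Option (B ⊕ E)) × Fin μ × Fin κ × (Fin n → S)) (x : S × A) :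
    ℝ :=
  law (c.inducedLaw Q W) (fun ω => (auxVar i ω, ω.2.1 i, ω.2.2.1.1 i)) (u, x)

theorem auxLaw_nonneg (i : Fin n) (u) (x : S × A) : 0 ≤ auxLaw c Q W i u x :=
  law_nonneg (inducedLaw_nonneg c Q W) _ _

/-- The Markov property of the auxiliary variable: it involves outputs only at times other than `i`,
so by memorylessness the outputs at `i` are drawn from `W` given the current input and state. -/
theorem law_aux_outputs (i : Fin n) (u) (s : S) (a : A) (z : B × E) :
    law (c.inducedLaw Q W) (fun ω => ((auxVar i ω, ω.2.1 i), ω.2.2.1.1 i,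
      (ω.2.2.2.1.1 i, ω.2.2.2.1.2 i))) ((u, s), a, z) = auxLaw c Q W i u (s, a) * W a s z := by
  classical
  rw [auxLaw, law_apply, law_apply, Finset.sum_mul]
  refine Eq.trans ?_ ((sum_inducedLaw_mul_coord c Q W i (fun m s' x y =>
    if (sideWord i y.1 y.2, m, x.2, s') = u ∧ s' i = s ∧ x.1 i = a then 1 else 0)
    (fun m s' x b e β ε => ?_) (fun z' => if z' = z then 1 else 0)).trans ?_)
  · refine Finset.sum_congr rfl fun ω _ => ?_
    congr 1
    simp only [Prod.mk.injEq, auxVar, and_assoc, ite_and, mul_ite, mul_one, mul_zero]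
    split_ifs <;> simp_all
  · have : sideWord i (Function.update b i β) (Function.update e i ε) = sideWord i b e := by
      rw [sideWord_eq_iff]
      exact ⟨fun j hj => Function.update_of_ne hj.ne _ _,
        fun j hj => Function.update_of_ne hj.ne' _ _⟩
    simp only [this]
  · refine Finset.sum_congr rfl fun ω _ => ?_
    rw [mul_assoc]
    congr 1
    simp only [mul_ite, mul_one, mul_zero, Finset.sum_ite_eq', Finset.mem_univ, if_true]
    by_cases h : (sideWord i ω.2.2.2.1.1 ω.2.2.2.1.2, ω.1, ω.2.2.1.2, ω.2.1) = u ∧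
      ω.2.1 i = s ∧ ω.2.2.1.1 i = a
    · obtain ⟨h1, h2, h3⟩ := h
      simp [auxVar, h1, h2, h3]
    · rw [if_neg h, if_neg, zero_mul, zero_mul]
      simpa [auxVar] using h

theorem law_aux_state (i : Fin n) (u) (s : S) :
    law (c.inducedLaw Q W) (fun ω => (auxVar i ω, ω.2.1 i)) (u, s) =
      ∑ a, auxLaw c Q W i u (s, a) := by
  simp only [auxLaw, law_assoc (c.inducedLaw Q W) (auxVar i) (fun ω => ω.2.1 i)
    (fun ω => ω.2.2.1.1 i)]
  exact (law_fst _ _ _ _).symm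

theorem law_aux_state_receiver (i : Fin n) (u) (s : S) (b : B) :
    law (c.inducedLaw Q W) (fun ω => ((auxVar i ω, ω.2.1 i), ω.2.2.2.1.1 i)) ((u, s), b) =
      ∑ a, auxLaw c Q W i u (s, a) * receiverChannel W a s b := by
  simp only [receiverChannel, Finset.mul_sum, ← law_aux_outputs]
  exact (sum_sum_law_left _ _ _ _ _ _ _).symm

theorem law_aux_state_warden (i : Fin n) (u) (s : S) (e : E) :
    law (c.inducedLaw Q W) (fun ω => ((auxVar i ω, ω.2.1 i), ω.2.2.2.1.2 i)) ((u, s), e) =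
      ∑ a, auxLaw c Q W i u (s, a) * wardenChannel W a s e := by
  simp only [wardenChannel, Finset.mul_sum, ← law_aux_outputs]
  exact (sum_sum_law_right _ _ _ _ _ _ _).symm

end Converse

/-! ### Chain rules and Csiszár's sum identity -/

section Chain

variable {Ω S B E γ τ : Type*} [Fintype Ω] [Fintype S] [Fintype B] [Fintype E] [Fintype γ]
  [Fintype τ] {n : ℕ} {p : Ω → ℝ}

theorem sum_fin_sub (f : ℕ → ℝ) : ∑ i : Fin n, (f (i + 1) - f i) = f n - f 0 := by
  rw [Fin.sum_univ_eq_sum_range (fun i => f (i + 1) - f i), Finset.sum_range_sub]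

/-- Each term of the chain rule for `H(Bⁿ|Sⁿ)` grows when the conditioning is reduced to the current
state. -/
theorem ent_outputs_state_le (hp : ∀ ω, 0 ≤ p ω) (s : Ω → Fin n → S) (b : Ω → Fin n → B) :
    ent (law p fun ω => (b ω, s ω)) ≤ ent (law p s) +
      ∑ i, (ent (law p fun ω => (s ω i, b ω i)) - ent (law p fun ω => s ω i)) := by
  set f : ℕ → ℝ := fun i => ent (law p fun ω => (prefixWord i (b ω), s ω)) with hf
  have hstep : ∀ i : Fin n, f (i + 1) - f i ≤
      ent (law p fun ω => (s ω i, b ω i)) - ent (law p fun ω => s ω i) := by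
    intro i
    have h1 := ent_submodular hp (fun ω => b ω i) (fun ω => (prefixWord i (b ω), s ω))
      (fun ω => s ω i)
    have h2 : f (i + 1) ≤
        ent (law p fun ω => (b ω i, (prefixWord i (b ω), s ω), s ω i)) := by
      refine ent_law_le_of_factors hp fun ω ω' h => ?_
      simp only [Prod.mk.injEq, prefixWord_eq_iff] at h ⊢
      refine ⟨fun j hj => ?_, h.2.1.2⟩
      rcases Nat.lt_succ_iff_lt_or_eq.1 hj with hj | hj
      · exact h.2.1.1 j hj
      · rw [Fin.ext hj]; exact h.1
    have h3 : ent (law p fun ω => ((prefixWord i (b ω), s ω), s ω i)) ≤ f i := by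
      refine ent_law_le_of_factors hp fun ω ω' h => ?_
      simp only [Prod.mk.injEq] at h ⊢
      exact ⟨h, by rw [h.2]⟩
    have h4 : ent (law p fun ω => (b ω i, s ω i)) ≤ ent (law p fun ω => (s ω i, b ω i)) :=
      ent_law_le_of_eq hp Prod.swap fun _ => rfl
    linarith
  have hsum := Finset.sum_le_sum fun i (_ : i ∈ Finset.univ) => hstep i
  rw [sum_fin_sub] at hsum
  have h0 : f 0 ≤ ent (law p s) := by
    refine ent_law_le_of_factors hp fun ω ω' h => ?_
    simp only [Prod.mk.injEq, prefixWord_eq_iff]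
    exact ⟨fun j hj => absurd hj (Nat.not_lt_zero _), h⟩
  have hn : ent (law p fun ω => (b ω, s ω)) ≤ f n := by
    refine ent_law_le_of_factors hp fun ω ω' h => ?_
    simp only [Prod.mk.injEq, prefixWord_eq_iff] at h ⊢
    exact ⟨funext fun j => h.1 j j.2, h.2⟩
  linarith

variable (C : Ω → γ) (b : Ω → Fin n → B) (e : Ω → Fin n → E) {T : Fin n → Ω → τ}

/-- Each term of the chain rule for `H(Bⁿ|C)` shrinks when the later letters of `e` and `T i` join
the conditioning. In the application `T i` is the current state. -/
theorem sum_ent_aux_le (hp : ∀ ω, 0 ≤ p ω) :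
    ∑ i, (ent (law p fun ω => (((sideWord i (b ω) (e ω), C ω), T i ω), b ω i)) -
      ent (law p fun ω => ((sideWord i (b ω) (e ω), C ω), T i ω))) ≤
      ent (law p fun ω => (C ω, b ω)) - ent (law p C) := by
  set f : ℕ → ℝ := fun i => ent (law p fun ω => (prefixWord i (b ω), C ω)) with hf
  have hstep : ∀ i : Fin n,
      ent (law p fun ω => (((sideWord i (b ω) (e ω), C ω), T i ω), b ω i)) -
      ent (law p fun ω => ((sideWord i (b ω) (e ω), C ω), T i ω)) ≤ f (i + 1) - f i := by
    intro i
    have h1 := ent_submodular hp (fun ω => b ω i)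
      (fun ω => ((sideWord i (b ω) (e ω), C ω), T i ω)) (fun ω => (prefixWord i (b ω), C ω))
    have h2 : ent (law p fun ω => (((sideWord i (b ω) (e ω), C ω), T i ω), b ω i)) ≤
        ent (law p fun ω => (b ω i, ((sideWord i (b ω) (e ω), C ω), T i ω),
          (prefixWord i (b ω), C ω))) := by
      refine ent_law_le_of_factors hp fun ω ω' h => ?_
      simp only [Prod.mk.injEq] at h ⊢
      tauto
    have h3 : ent (law p fun ω => (((sideWord i (b ω) (e ω), C ω), T i ω),
        (prefixWord i (b ω), C ω))) ≤
        ent (law p fun ω => ((sideWord i (b ω) (e ω), C ω), T i ω)) := by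
      refine ent_law_le_of_factors hp fun ω ω' h => ?_
      have h' := h
      simp only [Prod.mk.injEq, prefixWord_eq_iff, sideWord_eq_iff] at h h' ⊢
      exact ⟨h, fun j hj => h.1.1.1 j hj, h.1.2⟩
    have h4 : ent (law p fun ω => (b ω i, (prefixWord i (b ω), C ω))) ≤ f (i + 1) := by
      refine ent_law_le_of_factors hp fun ω ω' h => ?_
      simp only [Prod.mk.injEq, prefixWord_eq_iff] at h ⊢
      exact ⟨h.1 i (Nat.lt_succ_self _), fun j hj => h.1 j (hj.trans (Nat.lt_succ_self _)), h.2⟩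
    linarith
  have hsum := Finset.sum_le_sum fun i (_ : i ∈ Finset.univ) => hstep i
  rw [sum_fin_sub] at hsum
  have h0 : ent (law p C) ≤ f 0 := ent_law_le_of_eq hp Prod.snd fun _ => rfl
  have hn : f n ≤ ent (law p fun ω => (C ω, b ω)) := by
    refine ent_law_le_of_factors hp fun ω ω' h => ?_
    simp only [Prod.mk.injEq, prefixWord_eq_iff] at h ⊢
    exact ⟨fun j _ => by rw [h.2], h.1⟩
  linarith

/-- Csiszár's sum identity, in the form needed for the converse. -/
theorem ent_warden_le (hp : ∀ ω, 0 ≤ p ω) (hT : ∀ i ω ω', C ω = C ω' → T i ω = T i ω') :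
    ent (law p fun ω => (C ω, e ω)) ≤ ent (law p fun ω => (C ω, b ω)) -
      ∑ i, (ent (law p fun ω => (((sideWord i (b ω) (e ω), C ω), T i ω), b ω i)) -
        ent (law p fun ω => (((sideWord i (b ω) (e ω), C ω), T i ω), e ω i))) := by
  -- The hybrid entropies `H(C, b_{<i}, e_{≥i})` telescope from `H(C,e)` to `H(C,b)`. The words at
  -- `i` and `i + 1` share the side word and differ in having `e i` or `b i`; `T i` comes for free
  -- as a function of `C`.
  set f : ℕ → ℝ := fun i => ent (law p fun ω => (C ω, mixedWord i (b ω) (e ω))) with hf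
  have hstep : ∀ i : Fin n,
      ent (law p fun ω => (((sideWord i (b ω) (e ω), C ω), T i ω), b ω i)) -
      ent (law p fun ω => (((sideWord i (b ω) (e ω), C ω), T i ω), e ω i)) ≤ f (i + 1) - f i := by
    intro i
    have h1 : ent (law p fun ω => (((sideWord i (b ω) (e ω), C ω), T i ω), b ω i)) ≤
        f (i + 1) := by
      refine ent_law_le_of_factors hp fun ω ω' h => ?_
      simp only [Prod.mk.injEq, mixedWord_eq_iff, sideWord_eq_iff] at h ⊢
      exact ⟨⟨⟨⟨fun j hj => h.2.1 j (Nat.lt_succ_of_lt hj), fun j hj => h.2.2 j hj⟩, h.1⟩,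
        hT _ _ _ h.1⟩, h.2.1 i (Nat.lt_succ_self _)⟩
    have h2 : f i ≤ ent (law p fun ω => (((sideWord i (b ω) (e ω), C ω), T i ω), e ω i)) := by
      refine ent_law_le_of_factors hp fun ω ω' h => ?_
      simp only [Prod.mk.injEq, mixedWord_eq_iff, sideWord_eq_iff] at h ⊢
      refine ⟨h.1.1.2, fun j hj => h.1.1.1.1 j hj, fun j hj => ?_⟩
      rcases hj.eq_or_lt with hj | hj
      · rw [← Fin.ext hj]; exact h.2
      · exact h.1.1.1.2 j hj
    linarith
  have hsum := Finset.sum_le_sum fun i (_ : i ∈ Finset.univ) => hstep i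
  rw [sum_fin_sub] at hsum
  have h0 : ent (law p fun ω => (C ω, e ω)) ≤ f 0 := by
    refine ent_law_le_of_factors hp fun ω ω' h => ?_
    simp only [Prod.mk.injEq, mixedWord_eq_iff] at h ⊢
    exact ⟨h.1, funext fun j => h.2.2 j (Nat.zero_le _)⟩
  have hn : f n ≤ ent (law p fun ω => (C ω, b ω)) := by
    refine ent_law_le_of_factors hp fun ω ω' h => ?_
    simp only [Prod.mk.injEq, mixedWord_eq_iff] at h ⊢
    exact ⟨h.1, fun j _ => by rw [h.2], fun j hj => absurd j.2 (not_lt.2 hj)⟩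
  linarith

end Chain

/-! ### Output entropies of the auxiliary laws -/

section Converse

variable {S A B E : Type*} [Fintype S] [Fintype A] [Fintype B] [Fintype E] {n μ κ : ℕ}
variable (c : Code S A B n μ κ) (Q : stdSimplex ℝ S) (W : A → S → stdSimplex ℝ (B × E))

/-- The right side is `H(B_i|U_i,S_i)`: it links the multi-letter chain rules to coordinates of a
hull point. -/
theorem sum_outputCondEnt_aux_receiver (i : Fin n) :
    ∑ u, outputCondEnt (receiverChannel W) (auxLaw c Q W i u) =
      ent (law (c.inducedLaw Q W) fun ω => ((auxVar i ω, ω.2.1 i), ω.2.2.2.1.1 i)) -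
        ent (law (c.inducedLaw Q W) fun ω => (auxVar i ω, ω.2.1 i)) := by
  simp only [ent, Fintype.sum_prod_type (α₁ := _ × S),
    Fintype.sum_prod_type (α₁ := (Fin n → Option (B ⊕ E)) × Fin μ × Fin κ × (Fin n → S)),
    law_aux_state_receiver, law_aux_state, outputCondEnt, Finset.sum_sub_distrib]

theorem sum_outputCondEnt_aux_warden (i : Fin n) :
    ∑ u, outputCondEnt (wardenChannel W) (auxLaw c Q W i u) =
      ent (law (c.inducedLaw Q W) fun ω => ((auxVar i ω, ω.2.1 i), ω.2.2.2.1.2 i)) -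
        ent (law (c.inducedLaw Q W) fun ω => (auxVar i ω, ω.2.1 i)) := by
  simp only [ent, Fintype.sum_prod_type (α₁ := _ × S),
    Fintype.sum_prod_type (α₁ := (Fin n → Option (B ⊕ E)) × Fin μ × Fin κ × (Fin n → S)),
    law_aux_state_warden, law_aux_state, outputCondEnt, Finset.sum_sub_distrib]

theorem law_state_eq_sum (i : Fin n) (s : S) :
    law (c.inducedLaw Q W) (fun ω => ω.2.1 i) s = ∑ a, (∑ u, auxLaw c Q W i u) (s, a) := by
  rw [← law_snd (c.inducedLaw Q W) (auxVar i) (fun ω => ω.2.1 i) s]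
  simp only [law_aux_state, Finset.sum_apply]
  exact Finset.sum_comm

theorem law_state_receiver_eq_sum (i : Fin n) (s : S) (b : B) :
    law (c.inducedLaw Q W) (fun ω => (ω.2.1 i, ω.2.2.2.1.1 i)) (s, b) =
      ∑ a, (∑ u, auxLaw c Q W i u) (s, a) * receiverChannel W a s b := by
  rw [← law_snd (c.inducedLaw Q W) (auxVar i) (fun ω => (ω.2.1 i, ω.2.2.2.1.1 i))]
  simp only [law_assoc, law_aux_state_receiver, Finset.sum_apply, Finset.sum_mul]
  exact Finset.sum_comm

theorem law_warden_eq_sum (i : Fin n) (e : E) :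
    law (c.inducedLaw Q W) (fun ω => ω.2.2.2.1.2 i) e =
      wardenOutput W (∑ u, auxLaw c Q W i u) e := by
  rw [← law_snd (c.inducedLaw Q W) (fun ω => (auxVar i ω, ω.2.1 i)) (fun ω => ω.2.2.2.1.2 i),
    Fintype.sum_prod_type, Finset.sum_comm]
  simp only [law_aux_state_warden, wardenOutput, Finset.sum_apply, Finset.sum_mul]
  exact Finset.sum_congr rfl fun s _ => Finset.sum_comm

theorem outputCondEnt_sum_aux (i : Fin n) :
    outputCondEnt (receiverChannel W) (∑ u, auxLaw c Q W i u) =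
      ent (law (c.inducedLaw Q W) fun ω => (ω.2.1 i, ω.2.2.2.1.1 i)) -
        ent (law (c.inducedLaw Q W) fun ω => ω.2.1 i) := by
  simp only [ent, Fintype.sum_prod_type (α₁ := S), law_state_eq_sum, law_state_receiver_eq_sum,
    outputCondEnt]

end Converse

/-! ### Hull points from unnormalized laws, and the ideal law -/

section Aux

variable {S A B E : Type*} [Fintype S] [Fintype A] [Fintype B] [Fintype E]

/-- The masses of the `ρ i` are the convex weights; homogeneity moves them inside the output
entropies. -/
theorem sum_mem_featureHull [Nonempty S] [Nonempty A] {ι : Type*} [Fintype ι]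
    (W : A → S → stdSimplex ℝ (B × E)) {ρ : ι → S × A → ℝ} (hρ : ∀ i x, 0 ≤ ρ i x)
    (h1 : ∑ i, ∑ x, ρ i x = 1) :
    (∑ i, ρ i, ∑ i, outputCondEnt (receiverChannel W) (ρ i),
      ∑ i, outputCondEnt (wardenChannel W) (ρ i)) ∈ featureHull W := by
  choose q hq using fun i => exists_stdSimplex_smul (hρ i)
  have hq' : ∀ i, ρ i = (∑ x, ρ i x) • (q i : S × A → ℝ) := fun i => funext fun x => (hq i x).symm
  have hmem := (convex_convexHull ℝ (feature W '' stdSimplex ℝ (S × A))).sum_mem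
    (t := Finset.univ) (w := fun i => ∑ x, ρ i x) (z := fun i => feature W (q i))
    (fun i _ => Finset.sum_nonneg fun x _ => hρ i x) h1
    (fun i _ => subset_convexHull ℝ _ ⟨_, (q i).2, rfl⟩)
  rw [featureHull]
  convert hmem using 1
  symm
  refine Prod.ext ?_ (Prod.ext ?_ ?_)
  · rw [Prod.fst_sum]
    exact Finset.sum_congr rfl fun i _ => (hq' i).symm
  · rw [Prod.snd_sum, Prod.fst_sum]
    refine Finset.sum_congr rfl fun i _ => ?_
    conv_rhs => rw [hq' i, outputCondEnt_smul (sum_receiverChannel W)]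
    rfl
  · rw [Prod.snd_sum, Prod.snd_sum]
    refine Finset.sum_congr rfl fun i _ => ?_
    conv_rhs => rw [hq' i, outputCondEnt_smul (sum_wardenChannel W)]
    rfl

theorem wardenOutput_sum_smul {ι : Type*} [Fintype ι] (W : A → S → stdSimplex ℝ (B × E))
    (w : ι → ℝ) (q : ι → S × A → ℝ) (e : E) :
    wardenOutput W (∑ i, w i • q i) e = ∑ i, w i * wardenOutput W (q i) e := by
  simp only [wardenOutput, Finset.sum_apply (_ : S × A), Pi.smul_apply, smul_eq_mul,
    Finset.sum_mul, Finset.mul_sum, mul_assoc]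
  rw [Finset.sum_comm_cycle]

theorem innocentOutput_nonneg (Q : stdSimplex ℝ S) (φ₀ : stdSimplex ℝ A)
    (W : A → S → stdSimplex ℝ (B × E)) (e : E) : 0 ≤ innocentOutput Q φ₀ W e :=
  Finset.sum_nonneg fun _ _ => Finset.sum_nonneg fun _ _ => Finset.sum_nonneg fun _ _ =>
    mul_nonneg (mul_nonneg (stdSimplex.zero_le _ _) (stdSimplex.zero_le _ _))
      (stdSimplex.zero_le _ _)

theorem innocentOutput_eq (Q : stdSimplex ℝ S) (φ₀ : stdSimplex ℝ A)
    (W : A → S → stdSimplex ℝ (B × E)) (e : E) :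
    innocentOutput Q φ₀ W e = ∑ s, ∑ a, Q s * φ₀ a * wardenChannel W a s e := by
  simp only [innocentOutput, wardenChannel, Finset.mul_sum]

theorem sum_innocentOutput (Q : stdSimplex ℝ S) (φ₀ : stdSimplex ℝ A)
    (W : A → S → stdSimplex ℝ (B × E)) : ∑ e, innocentOutput Q φ₀ W e = 1 := by
  simp only [innocentOutput_eq]
  rw [Finset.sum_comm]
  have : ∀ s, ∑ e, ∑ a, Q s * φ₀ a * wardenChannel W a s e = Q s := by
    intro s
    rw [Finset.sum_comm]
    simp only [← Finset.mul_sum, sum_wardenChannel, mul_one, stdSimplex.sum_eq_one]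
  simp only [this, stdSimplex.sum_eq_one]

variable {Ω α : Type*} [Fintype Ω] [Fintype α]

theorem tvDist_nonneg (p q : Ω → ℝ) : 0 ≤ tvDist p q :=
  mul_nonneg (by norm_num) (Finset.sum_nonneg fun _ _ => abs_nonneg _)

/-- Passing to a marginal contracts the `ℓ¹` distance; the factor `2` undoes the one half in
`tvDist`. -/
theorem abs_law_sub_law_le (p q : Ω → ℝ) (X : Ω → α) (x : α) :
    |law p X x - law q X x| ≤ 2 * tvDist p q := by
  classical
  rw [law, law, ← Finset.sum_sub_distrib, tvDist, ← mul_assoc,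
    show (2 : ℝ) * (1 / 2) = 1 by norm_num, one_mul]
  refine (Finset.abs_sum_le_sum_abs _ _).trans (Finset.sum_le_sum fun ω _ => ?_)
  split_ifs <;> simp

theorem sum_prod_mul_ite [DecidableEq α] {n : ℕ} {q : α → ℝ} (hq : ∑ x, q x = 1) (i : Fin n)
    (x : α) : ∑ y : Fin n → α, (∏ j, q (y j)) * (if y i = x then 1 else 0) = q x := by
  have := sum_prod_mul_coord (fun _ : Fin n => q) i hq (fun _ => 1) (fun _ _ => rfl)
    (fun z => if z = x then 1 else 0)
  simp only [one_mul, ← Finset.sum_mul, sum_prod_pi, hq, one_pow, mul_ite, mul_one, mul_zero,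
    Finset.sum_ite_eq', Finset.mem_univ, if_true] at this
  simpa using this

variable {n μ κ : ℕ}

theorem idealLaw_nonneg {q : α → ℝ} (hq : ∀ x, 0 ≤ q x) (z) : 0 ≤ idealLaw q n μ κ z := by
  have := Finset.prod_nonneg fun (i : Fin n) (_ : i ∈ Finset.univ) => hq (z.2.2 i)
  simp only [idealLaw]
  positivity

theorem sum_idealLaw_mul {q : α → ℝ} (hμ : 0 < μ) (hκ : 0 < κ) (F : (Fin n → α) → ℝ) :
    ∑ z, idealLaw q n μ κ z * F z.2.2 = ∑ x : Fin n → α, (∏ i, q (x i)) * F x := by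
  have h1 : (μ : ℝ) ≠ 0 := by positivity
  have h2 : (κ : ℝ) ≠ 0 := by positivity
  simp only [Fintype.sum_prod_type, idealLaw, mul_assoc, ← Finset.mul_sum, Finset.sum_const,
    Finset.card_univ, Fintype.card_fin, nsmul_eq_mul]
  field_simp

theorem ent_idealLaw {q : α → ℝ} (hq : ∑ x, q x = 1) (hμ : 0 < μ) (hκ : 0 < κ) :
    ent (idealLaw q n μ κ) = log μ + log κ + n * ent q := by
  have h1 : (μ : ℝ) ≠ 0 := by positivity
  have h2 : (κ : ℝ) ≠ 0 := by positivity
  have e1 := ent_prod (fun _ : Fin κ => 1 / (κ : ℝ)) (fun x : Fin n → α => ∏ i, q (x i))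
  have e2 := ent_prod (fun _ : Fin μ => 1 / (μ : ℝ))
    (fun x : Fin κ × (Fin n → α) => 1 / (κ : ℝ) * ∏ i, q (x.2 i))
  rw [sum_prod_pi, hq, one_pow, one_mul, ent_const κ hκ, ent_pi n hq] at e1
  rw [e1, ent_const μ hμ, Fintype.sum_prod_type] at e2
  simp only [← Finset.mul_sum, sum_prod_pi, hq, one_pow, Finset.sum_const, Finset.card_univ,
    Fintype.card_fin, nsmul_eq_mul, mul_one, mul_one_div_cancel h1, mul_one_div_cancel h2,
    one_mul] at e2
  have : idealLaw q n μ κ = fun z : Fin μ × Fin κ × (Fin n → α) =>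
      1 / (μ : ℝ) * (1 / (κ : ℝ) * ∏ i, q (z.2.2 i)) := by
    funext z; simp only [idealLaw, mul_assoc]
  rw [this, e2]
  ring

end Aux

/-! ### The single-letter bounds for one code -/

section Converse

variable {S A B E : Type*} [Fintype S] [Fintype A] [Fintype B] [Fintype E] {n μ κ : ℕ}
variable (c : Code S A B n μ κ) (Q : stdSimplex ℝ S) (W : A → S → stdSimplex ℝ (B × E))

theorem law_state (hμ : 0 < μ) :
    law (c.inducedLaw Q W) (fun ω => ω.2.1) = fun s => ∏ i, Q (s i) := by
  have h1 : (μ : ℝ) ≠ 0 := by positivity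
  funext s
  rw [← law_snd (c.inducedLaw Q W) (fun ω => ω.1) (fun ω => ω.2.1), law_message_state]
  simp only [Finset.sum_const, Finset.card_univ, Fintype.card_fin, nsmul_eq_mul]
  field_simp

theorem law_state_coord (hμ : 0 < μ) (i : Fin n) (s : S) :
    law (c.inducedLaw Q W) (fun ω => ω.2.1 i) s = Q s := by
  classical
  have := congrFun (law_law (c.inducedLaw Q W) (fun ω => ω.2.1) (fun x => x i)) s
  rw [← this, law_state c Q W hμ, law_apply, ← sum_prod_mul_ite (stdSimplex.sum_eq_one Q) i s]

theorem abs_law_warden_sub_le (φ₀ : stdSimplex ℝ A) (hμ : 0 < μ) (hκ : 0 < κ) (i : Fin n)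
    (e : E) : |law (c.inducedLaw Q W) (fun ω => ω.2.2.2.1.2 i) e - innocentOutput Q φ₀ W e| ≤
      2 * tvDist (c.wardenLaw Q W) (idealLaw (innocentOutput Q φ₀ W) n μ κ) := by
  classical
  have h := abs_law_sub_law_le (c.wardenLaw Q W) (idealLaw (innocentOutput Q φ₀ W) n μ κ)
    (fun z => z.2.2 i) e
  have h1 := congrFun (law_law (c.inducedLaw Q W)
    (fun ω => (ω.1, ω.2.2.1.2, ω.2.2.2.1.2)) (fun z => z.2.2 i)) e
  have h2 : law (idealLaw (innocentOutput Q φ₀ W) n μ κ) (fun z => z.2.2 i) e =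
      innocentOutput Q φ₀ W e := by
    rw [law_apply, ← sum_prod_mul_ite (sum_innocentOutput Q φ₀ W) i e]
    exact (Finset.sum_congr rfl fun _ _ => by congr).trans
      (sum_idealLaw_mul hμ hκ fun y => if y i = e then 1 else 0)
  rw [Code.wardenLaw, h1, h2] at h
  exact h

theorem log_card_message_add (hμ : 0 < μ) :
    ent (law (c.inducedLaw Q W) fun ω => (ω.1, ω.2.1)) =
      log μ + ent (law (c.inducedLaw Q W) fun ω => ω.2.1) := by
  have h1 : (μ : ℝ) ≠ 0 := by positivity
  have e := ent_prod (fun _ : Fin μ => 1 / (μ : ℝ)) (fun x : Fin n → S => ∏ i, Q (x i))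
  rw [law_message_state, law_state c Q W hμ, e, ent_const μ hμ, sum_prod_pi]
  simp [h1]

/-- The entropy of the message, the key, the state and the receiver's output is at most that of
the state and the receiver's output up to the slack of Fano's inequality. -/
theorem ent_message_key_receiver_le (hμ : 0 < μ) (hκ : 0 < κ) :
    ent (law (c.inducedLaw Q W) fun ω => ((ω.1, ω.2.2.1.2, ω.2.1), ω.2.2.2.1.1)) ≤
      ent (law (c.inducedLaw Q W) fun ω => (ω.2.2.2.1.1, ω.2.1)) + log 2 +
        c.errorProb Q W * (log μ + log κ) := by
  have : Nonempty (Fin μ × Fin κ) := ⟨⟨0, hμ⟩, ⟨0, hκ⟩⟩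
  have h := ent_le_of_estimator (inducedLaw_nonneg c Q W) (sum_inducedLaw c Q W hμ)
    (fun ω => (ω.1, ω.2.2.1.2)) (fun ω => (ω.2.2.2.1.1, ω.2.1)) (fun y => c.dec y.1 y.2)
  rw [errorProb_eq]
  rw [Fintype.card_prod, Fintype.card_fin, Fintype.card_fin, Nat.cast_mul,
    log_mul (by positivity) (by positivity)] at h
  refine le_trans (ent_law_le_of_factors (inducedLaw_nonneg c Q W) fun ω ω' hω => ?_) h
  simp only [Prod.mk.injEq] at hω ⊢
  tauto

/-- The single-letter bounds implied by one code. -/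
theorem exists_feature_of_code (φ₀ : stdSimplex ℝ A) (hn : 0 < n) (hμ : 0 < μ) (hκ : 0 < κ) :
    ∃ g ∈ featureHull W, (∀ s, ∑ a, g.1 (s, a) = Q s) ∧
      (∀ e, |wardenOutput W g.1 e - innocentOutput Q φ₀ W e| ≤
        2 * tvDist (c.wardenLaw Q W) (idealLaw (innocentOutput Q φ₀ W) n μ κ)) ∧
      log μ ≤ n * (outputCondEnt (receiverChannel W) g.1 - g.2.1) +
        (log 2 + c.errorProb Q W * (log μ + log κ)) ∧
      log μ + log κ ≤ n * (outputCondEnt (receiverChannel W) g.1 - g.2.1 + g.2.2 +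
        ent (Q : S → ℝ) - ent (innocentOutput Q φ₀ W)) +
        (log 2 + c.errorProb Q W * (log μ + log κ)) +
        (tvDist (c.wardenLaw Q W) (idealLaw (innocentOutput Q φ₀ W) n μ κ) +
          tvDist (c.wardenLaw Q W) (idealLaw (innocentOutput Q φ₀ W) n μ κ) *
            (log μ + log κ + n * log (Fintype.card E)) +
          negMulLog (tvDist (c.wardenLaw Q W) (idealLaw (innocentOutput Q φ₀ W) n μ κ))) := by
  have hA : Nonempty A := by
    by_contra h
    rw [not_nonempty_iff] at h
    simpa using stdSimplex.sum_eq_one φ₀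
  have hS : Nonempty S := by
    by_contra h
    rw [not_nonempty_iff] at h
    simpa using stdSimplex.sum_eq_one Q
  have hE : Nonempty E := by
    by_contra h
    rw [not_nonempty_iff] at h
    simpa using sum_wardenChannel W (Classical.arbitrary A) (Classical.arbitrary S)
  have hn0 : (n : ℝ) ≠ 0 := by positivity
  have hp := inducedLaw_nonneg c Q W
  set δ := tvDist (c.wardenLaw Q W) (idealLaw (innocentOutput Q φ₀ W) n μ κ) with hδ
  -- Time sharing: a uniform time index becomes part of the auxiliary variable.
  set ρ : Fin n × ((Fin n → Option (B ⊕ E)) × Fin μ × Fin κ × (Fin n → S)) → S × A → ℝ :=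
    fun j => (1 / (n : ℝ)) • auxLaw c Q W j.1 j.2 with hρ
  have hρ0 : ∀ j x, 0 ≤ ρ j x := fun j x =>
    mul_nonneg (by positivity) (auxLaw_nonneg c Q W j.1 j.2 x)
  have hsum : ∑ j, ρ j = ∑ i, (1 / (n : ℝ)) • ∑ u, auxLaw c Q W i u := by
    rw [Fintype.sum_prod_type]
    simp only [hρ, Finset.smul_sum]
  have hstate : ∀ s, ∑ a, (∑ j, ρ j) (s, a) = Q s := by
    intro s
    rw [hsum]
    simp only [Finset.sum_apply (_ : S × A), Pi.smul_apply, smul_eq_mul]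
    rw [Finset.sum_comm]
    simp only [← Finset.mul_sum, ← Finset.sum_apply (_ : S × A), ← law_state_eq_sum,
      law_state_coord c Q W hμ]
    simp [hn0]
  have h1 : ∑ j, ∑ x, ρ j x = 1 := by
    rw [Finset.sum_comm, Fintype.sum_prod_type]
    simp only [← Finset.sum_apply (_ : S × A), hstate, stdSimplex.sum_eq_one]
  refine ⟨_, sum_mem_featureHull W hρ0 h1, hstate, fun e => ?_, ?_⟩
  · have hw : wardenOutput W (∑ j, ρ j) e =
        ∑ i, 1 / (n : ℝ) * law (c.inducedLaw Q W) (fun ω => ω.2.2.2.1.2 i) e := by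
      simp only [law_warden_eq_sum]
      rw [hsum, wardenOutput_sum_smul W fun _ => 1 / (n : ℝ)]
    have hq : innocentOutput Q φ₀ W e = ∑ i : Fin n, 1 / (n : ℝ) * innocentOutput Q φ₀ W e := by
      simp [hn0]
    rw [hw, hq, ← Finset.sum_sub_distrib]
    refine (Finset.abs_sum_le_sum_abs _ _).trans ?_
    calc ∑ i : Fin n, |1 / (n : ℝ) * law (c.inducedLaw Q W) (fun ω => ω.2.2.2.1.2 i) e -
          1 / (n : ℝ) * innocentOutput Q φ₀ W e| ≤ ∑ i : Fin n, 1 / (n : ℝ) * (2 * δ) := by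
          refine Finset.sum_le_sum fun i _ => ?_
          rw [← mul_sub, abs_mul, abs_of_nonneg (by positivity : (0 : ℝ) ≤ 1 / n)]
          exact mul_le_mul_of_nonneg_left (abs_law_warden_sub_le c Q W φ₀ hμ hκ i e)
            (by positivity)
      _ = 2 * δ := by simp [hn0]
  · have hB : n * ∑ j, outputCondEnt (receiverChannel W) (ρ j) =
        ∑ i, ∑ u, outputCondEnt (receiverChannel W) (auxLaw c Q W i u) := by
      simp only [hρ, outputCondEnt_smul (sum_receiverChannel W), ← Finset.mul_sum,
        Fintype.sum_prod_type (α₁ := Fin n)]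
      field_simp
    have hEn : n * ∑ j, outputCondEnt (wardenChannel W) (ρ j) =
        ∑ i, ∑ u, outputCondEnt (wardenChannel W) (auxLaw c Q W i u) := by
      simp only [hρ, outputCondEnt_smul (sum_wardenChannel W), ← Finset.mul_sum,
        Fintype.sum_prod_type (α₁ := Fin n)]
      field_simp
    -- Only the unconditioned `H(B_i|S_i)` needs concavity. The sums over auxiliary values are
    -- additive in the time index, and `H(E|S)` does not occur.
    have hconc : ∑ i, outputCondEnt (receiverChannel W) (∑ u, auxLaw c Q W i u) ≤
        n * outputCondEnt (receiverChannel W) (∑ j, ρ j) := by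
      have := sum_outputCondEnt_le (receiverChannel_nonneg W) (sum_receiverChannel W)
        (q := fun i : Fin n => (1 / (n : ℝ)) • ∑ u, auxLaw c Q W i u) (fun i x => by
          simp only [Pi.smul_apply, Finset.sum_apply, smul_eq_mul]
          exact mul_nonneg (by positivity)
            (Finset.sum_nonneg fun u _ => auxLaw_nonneg c Q W i u x))
      simp only [outputCondEnt_smul (sum_receiverChannel W), ← Finset.mul_sum, ← hsum] at this
      rw [one_div, inv_mul_le_iff₀ (by positivity)] at this
      exact this
    simp only [outputCondEnt_sum_aux] at hconc
    simp only [sum_outputCondEnt_aux_receiver] at hB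
    simp only [sum_outputCondEnt_aux_warden] at hEn
    have c1 := ent_outputs_state_le hp (fun ω => ω.2.1) (fun ω => ω.2.2.2.1.1)
    have c2 := sum_ent_aux_le (fun ω : Outcome S A B E n μ κ => (ω.1, ω.2.2.1.2, ω.2.1))
      (fun ω => ω.2.2.2.1.1) (fun ω => ω.2.2.2.1.2) (T := fun i ω => ω.2.1 i) hp
    have c3 := ent_warden_le (fun ω : Outcome S A B E n μ κ => (ω.1, ω.2.2.1.2, ω.2.1))
      (fun ω => ω.2.2.2.1.1) (fun ω => ω.2.2.2.1.2) (T := fun i ω => ω.2.1 i) hp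
      (fun i ω ω' h => by
        simp only [Prod.mk.injEq] at h
        exact congrFun h.2.2 i)
    have c4 := ent_message_key_receiver_le c Q W hμ hκ
    have c5 := log_card_message_add c Q W hμ
    have c6 : ent (law (c.inducedLaw Q W) fun ω => (ω.1, ω.2.1)) ≤
        ent (law (c.inducedLaw Q W) fun ω => (ω.1, ω.2.2.1.2, ω.2.1)) :=
      ent_law_le_of_eq hp (fun z => (z.1, z.2.2)) fun _ => rfl
    have c7 : ent (c.wardenLaw Q W) ≤
        ent (law (c.inducedLaw Q W) fun ω => ((ω.1, ω.2.2.1.2, ω.2.1), ω.2.2.2.1.2)) :=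
      ent_law_le_of_eq hp (fun z => (z.1.1, z.1.2.1, z.2)) fun _ => rfl
    have c8 : ent (law (c.inducedLaw Q W) fun ω => ω.2.1) = n * ent (Q : S → ℝ) := by
      rw [law_state c Q W hμ, ent_pi n (stdSimplex.sum_eq_one Q)]
    have hne : Nonempty (Fin μ × Fin κ × (Fin n → E)) :=
      ⟨⟨0, hμ⟩, ⟨0, hκ⟩, fun _ => Classical.arbitrary E⟩
    have c9 := ent_le_ent_add (p := c.wardenLaw Q W)
      (q := idealLaw (innocentOutput Q φ₀ W) n μ κ) (fun z => law_nonneg hp _ z)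
      (idealLaw_nonneg (innocentOutput_nonneg Q φ₀ W))
      (by rw [Code.wardenLaw, sum_law, sum_inducedLaw c Q W hμ])
      (by
        have := sum_idealLaw_mul (n := n) (q := innocentOutput Q φ₀ W) hμ hκ (fun _ => 1)
        simpa only [mul_one, sum_prod_pi, sum_innocentOutput, one_pow] using this)
    rw [ent_idealLaw (sum_innocentOutput Q φ₀ W) hμ hκ, ← hδ, Fintype.card_prod,
      Fintype.card_prod, Fintype.card_fin, Fintype.card_fin, Fintype.card_fun, Fintype.card_fin,
      Nat.cast_mul, Nat.cast_mul, Nat.cast_pow, log_mul (by positivity) (by positivity),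
      log_mul (by positivity) (by positivity), log_pow] at c9
    simp only [auxVar] at hB hEn
    simp only [Finset.sum_sub_distrib] at c1 c2 c3 hB hEn hconc
    -- With `C = (M,K,Sⁿ)`: the first bound is `log μ ≤ H(C) - H(Sⁿ)`, followed by `c2` to bring in
    -- `Bⁿ`, Fano `c4` to remove `(M,K)`, and `c1`. The second starts from `c9` and `c7`, replaces
    -- `Eⁿ` by `Bⁿ` through `c3`, and ends with `c4`, `c1` and `c8`.
    constructor
    · rw [mul_sub, hB]
      linarith
    · rw [mul_sub, mul_add, mul_add, mul_sub, hB, hEn]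
      linarith

end Converse

/-! ### Rounded index counts -/

theorem two_rpow_eq_exp (n : ℕ) (R : ℝ) : (2 : ℝ) ^ ((n : ℝ) * R) = exp (n * (R * log 2)) := by
  rw [rpow_def_of_pos two_pos]
  ring_nf

theorem numIndices_le (n : ℕ) (R : ℝ) : (numIndices n R : ℝ) ≤ exp (n * (R * log 2)) := by
  rw [← two_rpow_eq_exp]
  exact Nat.floor_le (by positivity)

theorem numIndices_pos (n : ℕ) {R : ℝ} (hR : 0 ≤ R) : 0 < numIndices n R :=
  Nat.floor_pos.2 (one_le_rpow one_le_two (by positivity))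

/-- Rounding down a number that is at least `1` loses at most a factor `2`. -/
theorem exp_le_two_mul_numIndices (n : ℕ) {R : ℝ} (hR : 0 ≤ R) :
    exp (n * (R * log 2)) ≤ 2 * numIndices n R := by
  rw [← two_rpow_eq_exp]
  have h1 : (1 : ℝ) ≤ numIndices n R := by exact_mod_cast numIndices_pos n hR
  have h2 : (2 : ℝ) ^ ((n : ℝ) * R) < numIndices n R + 1 := Nat.lt_floor_add_one _
  linarith

theorem log_numIndices_le (n : ℕ) {R : ℝ} (hR : 0 ≤ R) :
    log (numIndices n R) ≤ n * (R * log 2) := by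
  have h : (0 : ℝ) < numIndices n R := by exact_mod_cast numIndices_pos n hR
  exact (log_le_iff_le_exp h).2 (numIndices_le n R)

theorem le_log_numIndices (n : ℕ) {R : ℝ} (hR : 0 ≤ R) :
    n * (R * log 2) - log 2 ≤ log (numIndices n R) := by
  have h : (0 : ℝ) < numIndices n R := by exact_mod_cast numIndices_pos n hR
  have := (le_log_iff_exp_le (by positivity)).2 (exp_le_two_mul_numIndices n hR)
  rw [log_mul two_ne_zero h.ne'] at this
  linarith

/-! ### The converse in the limit -/

section Converse

variable {S A B E : Type*} [Fintype S] [Fintype A] [Fintype B] [Fintype E]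

theorem errorProb_nonneg {n μ κ : ℕ} (c : Code S A B n μ κ) (Q : stdSimplex ℝ S)
    (W : A → S → stdSimplex ℝ (B × E)) : 0 ≤ c.errorProb Q W := by
  classical
  refine Finset.sum_nonneg fun ω _ => ?_
  split_ifs
  · exact inducedLaw_nonneg c Q W ω
  · exact le_rfl

/-- An achievable pair satisfies the single-letter constraints up to an arbitrarily small slack. -/
theorem exists_feature_of_achievable {Q : stdSimplex ℝ S} {φ₀ : stdSimplex ℝ A}
    {W : A → S → stdSimplex ℝ (B × E)} {R RK : ℝ} (h : Achievable Q φ₀ W R RK) {ε : ℝ}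
    (hε : 0 < ε) : ∃ g ∈ featureHull W, (∀ s, ∑ a, g.1 (s, a) = Q s) ∧
      (∀ e, |wardenOutput W g.1 e - innocentOutput Q φ₀ W e| ≤ ε) ∧
      R * log 2 ≤ outputCondEnt (receiverChannel W) g.1 - g.2.1 + ε ∧
      (R + RK) * log 2 ≤ outputCondEnt (receiverChannel W) g.1 - g.2.1 + g.2.2 +
        ent (Q : S → ℝ) - ent (innocentOutput Q φ₀ W) + ε := by
  obtain ⟨hR, hRK, c, herr, htv⟩ := h
  set x : ℕ → ℝ := fun n => (c n).errorProb Q W with hx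
  set δ : ℕ → ℝ := fun n => tvDist ((c n).wardenLaw Q W)
    (idealLaw (innocentOutput Q φ₀ W) n (numIndices n R) (numIndices n RK)) with hδ
  have hx0 : ∀ n, 0 ≤ x n := fun n => errorProb_nonneg _ _ _
  have hδ0 : ∀ n, 0 ≤ δ n := fun n => tvDist_nonneg _ _
  set L : ℝ := (R + RK) * log 2 with hL
  have hinv : Tendsto (fun n : ℕ => 1 / (n : ℝ)) atTop (𝓝 0) := tendsto_one_div_atTop_nhds_zero_nat
  -- One `log 2` is Fano's, the other two pay for rounding the numbers of messages and of keys.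
  have t1 : Tendsto (fun n : ℕ => 3 * log 2 * (1 / (n : ℝ)) + x n * L) atTop (𝓝 0) := by
    simpa using (hinv.const_mul (3 * log 2)).add (herr.mul_const L)
  have t2 : Tendsto (fun n : ℕ => (δ n + negMulLog (δ n)) * (1 / (n : ℝ)) +
      δ n * (L + log (Fintype.card E))) atTop (𝓝 0) := by
    have := (continuous_negMulLog.tendsto 0).comp htv
    rw [negMulLog_zero] at this
    simpa using ((htv.add this).mul hinv).add (htv.mul_const (L + log (Fintype.card E)))
  have t3 : Tendsto (fun n => 2 * δ n) atTop (𝓝 0) := by simpa using htv.const_mul 2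
  have hε2 : 0 < ε / 2 := by positivity
  obtain ⟨n, h1, h2, h3, hn⟩ := ((t1.eventually_lt_const hε2).and
    ((t2.eventually_lt_const hε2).and ((t3.eventually_lt_const hε).and
      (eventually_gt_atTop 0)))).exists
  have hn0 : (0 : ℝ) < n := by exact_mod_cast hn
  obtain ⟨g, hg, hgS, hgE, hg1, hg2⟩ := exists_feature_of_code (c n) Q W φ₀ hn
    (numIndices_pos n hR) (numIndices_pos n hRK)
  change ∀ e, _ ≤ 2 * δ n at hgE
  change _ ≤ _ + (log 2 + x n * _) at hg1
  change _ ≤ _ + (log 2 + x n * _) + (δ n + δ n * _ + negMulLog (δ n)) at hg2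
  have hlog2 : 0 < log 2 := log_pos one_lt_two
  have u1 := log_numIndices_le n hR
  have u2 := log_numIndices_le n hRK
  have l1 := le_log_numIndices n hR
  have l2 := le_log_numIndices n hRK
  have hsum : log (numIndices n R) + log (numIndices n RK) ≤ n * L := by
    rw [hL]; linarith
  have p1 := mul_le_mul_of_nonneg_left hsum (hx0 n)
  have p2 := mul_le_mul_of_nonneg_left hsum (hδ0 n)
  have h1' : 3 * log 2 + n * (x n * L) ≤ n * (ε / 2) := by
    have := mul_le_mul_of_nonneg_left h1.le hn0.le
    have e : n * (3 * log 2 * (1 / (n : ℝ)) + x n * L) = 3 * log 2 + n * (x n * L) := by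
      field_simp
    linarith
  have h2' : (δ n + negMulLog (δ n)) + n * (δ n * (L + log (Fintype.card E))) ≤ n * (ε / 2) := by
    have := mul_le_mul_of_nonneg_left h2.le hn0.le
    have e : n * ((δ n + negMulLog (δ n)) * (1 / (n : ℝ)) + δ n * (L + log (Fintype.card E))) =
      (δ n + negMulLog (δ n)) + n * (δ n * (L + log (Fintype.card E))) := by
      field_simp
    linarith
  refine ⟨g, hg, hgS, fun e => (hgE e).trans h3.le, ?_, ?_⟩
  · refine le_of_mul_le_mul_left ?_ hn0
    nlinarith
  · refine le_of_mul_le_mul_left ?_ hn0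
    nlinarith

theorem capacityRegion_subset (Q : stdSimplex ℝ S) (φ₀ : stdSimplex ℝ A)
    (W : A → S → stdSimplex ℝ (B × E)) :
    capacityRegion Q φ₀ W ⊆ singleLetterRegion Q φ₀ W := by
  intro r hr
  rw [capacityRegion, Metric.mem_closure_iff] at hr
  have hclose : ∀ ε > 0, ∃ r' : ℝ × ℝ, Achievable Q φ₀ W r'.1 r'.2 ∧ r.1 ≤ r'.1 + ε ∧
      r.2 ≤ r'.2 + ε ∧ r'.1 ≤ r.1 + ε ∧ r'.2 ≤ r.2 + ε := by
    intro ε hε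
    obtain ⟨r', hr', hd⟩ := hr ε hε
    rw [Prod.dist_eq, max_lt_iff, Real.dist_eq, Real.dist_eq, abs_lt, abs_lt] at hd
    exact ⟨r', hr', by linarith, by linarith, by linarith, by linarith⟩
  have hlog2 : 0 < log 2 := log_pos one_lt_two
  refine mem_singleLetterRegion_of_forall_approx ?_ ?_ fun ε hε => ?_
  · refine le_of_forall_pos_le_add fun ε hε => ?_
    obtain ⟨r', h, -, -, h1, -⟩ := hclose ε hε
    exact h.1.trans h1
  · refine le_of_forall_pos_le_add fun ε hε => ?_
    obtain ⟨r', h, -, -, -, h2⟩ := hclose ε hε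
    exact h.2.1.trans h2
  -- Moving each rate to a nearby achievable pair costs `ε / 4` nats; the remaining `ε / 2` is the
  -- slack granted to that pair.
  · obtain ⟨r', h, h1, h2, -, -⟩ := hclose (ε / (4 * log 2)) (by positivity)
    obtain ⟨g, hg, hgS, hgE, hg1, hg2⟩ := exists_feature_of_achievable h (half_pos hε)
    have e : ε / (4 * log 2) * log 2 = ε / 4 := by field_simp
    have k1 := mul_le_mul_of_nonneg_right h1 hlog2.le
    have k2 := mul_le_mul_of_nonneg_right h2 hlog2.le
    rw [add_mul, e] at k1 k2
    refine ⟨g, hg, hgS, fun e => (hgE e).trans (half_le_self hε.le), by linarith, ?_⟩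
    rw [add_mul] at hg2 ⊢
    linarith

end Converse

/-! ### Large deviations of product weights -/

section Typicality

variable {Z : Type*} [Fintype Z]

/-- The exponential moment is `1` at `t = 0`, and its derivative there is the mean of `f - m`, which
is negative. -/
theorem exists_exponential_moment_lt_one {p : Z → ℝ} (hp1 : ∑ z, p z = 1) {f : Z → ℝ} {m : ℝ}
    (hm : ∑ z, p z * f z < m) : ∃ t > 0, ∑ z, p z * exp (t * (f z - m)) < 1 := by
  set g : ℝ → ℝ := fun t => ∑ z, p z * exp (t * (f z - m)) with hg
  have hd : HasDerivAt g (∑ z, p z * (f z - m)) 0 := by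
    refine HasDerivAt.fun_sum fun z _ => HasDerivAt.const_mul _ ?_
    have h1 : HasDerivAt (fun t : ℝ => t * (f z - m)) (f z - m) 0 := by
      simpa using (hasDerivAt_id (0 : ℝ)).mul_const (f z - m)
    simpa using h1.exp
  have hneg : ∑ z, p z * (f z - m) < 0 := by
    simp only [mul_sub, Finset.sum_sub_distrib, ← Finset.sum_mul, hp1]
    linarith
  have hs := (hd.tendsto_slope_zero_right.eventually_lt_const hneg).and self_mem_nhdsWithin
  obtain ⟨t, ht, ht0⟩ := hs.exists
  have ht0 : 0 < t := ht0
  have g0 : g 0 = 1 := by simp [hg, hp1]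
  rw [zero_add, g0, smul_eq_mul] at ht
  have : g t - 1 < 0 := by
    by_contra! h
    exact absurd ht (not_lt.2 (mul_nonneg (inv_nonneg.2 ht0.le) h))
  exact ⟨t, ht0, by linarith⟩

open Classical in
/-- Large deviations: the product of i.i.d. copies of `r` exceeds `exp (n m)` with vanishing
probability when `m` is larger than the mean of `log r`. -/
theorem tendsto_sum_prod_exp_le {p r : Z → ℝ} (hp : ∀ z, 0 ≤ p z) (hp1 : ∑ z, p z = 1)
    (hr : ∀ z, 0 < p z → 0 < r z) {m : ℝ} (hm : ∑ z, p z * log (r z) < m) :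
    Tendsto (fun n : ℕ => ∑ z : Fin n → Z, (∏ i, p (z i)) *
      if exp (n * m) ≤ ∏ i, r (z i) then 1 else 0) atTop (𝓝 0) := by
  obtain ⟨t, ht, hlt⟩ := exists_exponential_moment_lt_one hp1 hm
  have h0 : 0 ≤ ∑ z, p z * exp (t * (log (r z) - m)) :=
    Finset.sum_nonneg fun z _ => mul_nonneg (hp z) (exp_nonneg _)
  refine squeeze_zero (fun n => Finset.sum_nonneg fun z _ => mul_nonneg
    (Finset.prod_nonneg fun i _ => hp _) (by split_ifs <;> norm_num)) (fun n => ?_)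
    (tendsto_pow_atTop_nhds_zero_of_lt_one h0 hlt)
  -- Chernoff's bound: the indicator is at most the product of the exponential weights. Words with a
  -- letter of probability zero are treated apart, as `r` need not be positive there.
  rw [← sum_prod_pi]
  refine Finset.sum_le_sum fun z _ => ?_
  rw [Finset.prod_mul_distrib]
  by_cases hz : ∀ i, 0 < p (z i)
  · refine mul_le_mul_of_nonneg_left ?_ (Finset.prod_nonneg fun i _ => hp _)
    split_ifs with h
    · rw [← exp_sum, one_le_exp_iff, ← Finset.mul_sum, Finset.sum_sub_distrib]
      refine mul_nonneg ht.le ?_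
      rw [← log_prod fun i _ => (hr _ (hz i)).ne']
      have := (le_log_iff_exp_le (Finset.prod_pos fun i _ => hr _ (hz i))).2 h
      simpa using this
    · exact Finset.prod_nonneg fun i _ => exp_nonneg _
  · push Not at hz
    obtain ⟨i, hi⟩ := hz
    rw [Finset.prod_eq_zero (Finset.mem_univ i) (le_antisymm hi (hp _))]
    simp

end Typicality

/-! ### Uniformly random functions and leftover hashing -/

section RandomBinning

variable {X J K : Type*} [Fintype X] [Fintype J] [Fintype K]

open Classical in
/-- The average over all functions `X → J`. -/
def avg (F : (X → J) → ℝ) : ℝ := ∑ h : X → J, (∏ _x : X, 1 / (Fintype.card J : ℝ)) * F h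

theorem avg_mono {F G : (X → J) → ℝ} (h : ∀ x, F x ≤ G x) : avg F ≤ avg G :=
  Finset.sum_le_sum fun x _ => mul_le_mul_of_nonneg_left (h x)
    (Finset.prod_nonneg fun _ _ => by positivity)

theorem avg_sum {ι : Type*} (s : Finset ι) (F : ι → (X → J) → ℝ) :
    avg (fun h => ∑ i ∈ s, F i h) = ∑ i ∈ s, avg (F i) := by
  simp only [avg, Finset.mul_sum]
  exact Finset.sum_comm

theorem avg_add (F G : (X → J) → ℝ) : avg (fun h => F h + G h) = avg F + avg G := by
  simp only [avg, mul_add, Finset.sum_add_distrib]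

theorem avg_const_mul (a : ℝ) (F : (X → J) → ℝ) : avg (fun h => a * F h) = a * avg F := by
  simp only [avg, Finset.mul_sum]
  exact Finset.sum_congr rfl fun _ _ => by ring

variable [Nonempty J]

theorem card_ne_zero_real : (Fintype.card J : ℝ) ≠ 0 := by
  exact_mod_cast Fintype.card_ne_zero

theorem avg_const (a : ℝ) : avg (fun _ : X → J => a) = a := by
  classical
  have h : (Fintype.card J : ℝ) ≠ 0 := card_ne_zero_real
  simp [avg, h]

theorem exists_le_avg (F : (X → J) → ℝ) : ∃ h, F h ≤ avg F := by
  by_contra! hF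
  have hJ : (0 : ℝ) < Fintype.card J := by exact_mod_cast Fintype.card_pos
  have : avg (fun _ : X → J => avg F) < avg F := by
    classical
    exact Finset.sum_lt_sum_of_nonempty Finset.univ_nonempty fun h _ =>
      mul_lt_mul_of_pos_left (hF h) (Finset.prod_pos fun _ _ => by positivity)
  rw [avg_const] at this
  exact lt_irrefl _ this

/-- The mean of a function on a nonempty finite type. -/
def mean (f : J → ℝ) : ℝ := ∑ j, 1 / (Fintype.card J : ℝ) * f j

/-- The value of a uniformly random function at one point is uniform and independent of its values
elsewhere. -/
theorem avg_mul_eval (x : X) (G : (X → J) → ℝ) [DecidableEq X]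
    (hG : ∀ h j, G (Function.update h x j) = G h) (f : J → ℝ) :
    avg (fun h => G h * f (h x)) = avg G * mean f := by
  have h : (Fintype.card J : ℝ) ≠ 0 := card_ne_zero_real
  have := sum_prod_mul_coord (fun _ : X => fun _ : J => 1 / (Fintype.card J : ℝ)) x (by simp [h])
    G hG f
  simp only [avg, mean]
  rw [Finset.sum_mul]
  simp only [mul_assoc]
  convert this using 3

theorem avg_eval (x : X) (f : J → ℝ) : avg (fun h : X → J => f (h x)) = mean f := by
  classical
  have := avg_mul_eval x (fun _ : X → J => 1) (fun _ _ => rfl) f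
  simpa [avg_const] using this

theorem avg_eval_mul_eval {x x' : X} (hx : x ≠ x') (f g : J → ℝ) :
    avg (fun h : X → J => f (h x) * g (h x')) = mean f * mean g := by
  classical
  rw [avg_mul_eval x' (fun h => f (h x)) (fun h j => by rw [Function.update_of_ne hx]) g, avg_eval]

theorem mean_sub_const (f : J → ℝ) (a : ℝ) : mean (fun j => f j - a) = mean f - a := by
  have h : (Fintype.card J : ℝ) ≠ 0 := card_ne_zero_real
  simp [mean, mul_sub, Finset.sum_sub_distrib, h]

open Classical in
theorem avg_abs_sq_le (F : (X → J) → ℝ) : avg (fun h => |F h|) ^ 2 ≤ avg (fun h => F h ^ 2) := by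
  have h : avg (fun h => |F h|) ^ 2 ≤ avg (fun _ : X → J => 1) * avg (fun h => F h ^ 2) :=
    Finset.sum_sq_le_sum_mul_sum_of_sq_le_mul (Finset.univ : Finset (X → J))
      (fun _ _ => mul_nonneg (Finset.prod_nonneg fun _ _ => by positivity) zero_le_one)
      (fun _ _ => mul_nonneg (Finset.prod_nonneg fun _ _ => by positivity) (sq_nonneg _))
      (fun h _ => by rw [mul_pow, sq_abs]; exact le_of_eq (by ring))
  rwa [avg_const, one_mul] at h

/-- The second moment of a weighted count of the elements hashed into a set. -/
theorem avg_sq_le (a : X → ℝ) {χ : J → ℝ} (hχ : ∀ j, χ j ^ 2 = χ j) :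
    avg (fun h => (∑ x, a x * (χ (h x) - mean χ)) ^ 2) ≤ mean χ * ∑ x, a x ^ 2 := by
  have e : ∀ h : X → J, (∑ x, a x * (χ (h x) - mean χ)) ^ 2 =
      ∑ x, ∑ x', a x * a x' * ((χ (h x) - mean χ) * (χ (h x') - mean χ)) := by
    intro h
    rw [sq, Finset.sum_mul_sum]
    exact Finset.sum_congr rfl fun x _ => Finset.sum_congr rfl fun x' _ => by ring
  simp only [e, avg_sum, avg_const_mul]
  rw [Finset.mul_sum]
  refine Finset.sum_le_sum fun x _ => ?_
  -- Values at distinct points are independent, so cross terms have mean zero. A diagonal term is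
  -- the variance `mean χ - mean χ ^ 2` of an indicator.
  rw [Finset.sum_eq_single x]
  · have h2 : avg (fun h : X → J => (χ (h x) - mean χ) * (χ (h x) - mean χ)) =
        mean χ - mean χ ^ 2 := by
      rw [avg_eval x (fun j => (χ j - mean χ) * (χ j - mean χ))]
      have : (fun j => (χ j - mean χ) * (χ j - mean χ)) =
          fun j => (1 - 2 * mean χ) * χ j - (-mean χ ^ 2) := by
        funext j
        linear_combination hχ j
      rw [this, mean_sub_const]
      have : mean (fun j => (1 - 2 * mean χ) * χ j) = (1 - 2 * mean χ) * mean χ := by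
        conv_rhs => rw [mean, Finset.mul_sum]
        rw [mean]
        exact Finset.sum_congr rfl fun j _ => by simp only [mean]; ring
      rw [this]
      ring
    rw [h2]
    nlinarith [mul_nonneg (sq_nonneg (a x)) (sq_nonneg (mean χ))]
  · intro x' _ hx'
    rw [avg_eval_mul_eval hx'.symm (fun j => χ j - mean χ) (fun j => χ j - mean χ),
      mean_sub_const, sub_self, zero_mul, mul_zero]
  · simp

theorem avg_abs_le (a : X → ℝ) {χ : J → ℝ} (hχ : ∀ j, χ j ^ 2 = χ j) :
    avg (fun h => |∑ x, a x * (χ (h x) - mean χ)|) ≤ √(mean χ * ∑ x, a x ^ 2) :=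
  le_sqrt_of_sq_le ((avg_abs_sq_le _).trans (avg_sq_le a hχ))

open Classical in
/-- Leftover hashing with a uniformly random function: if `p (x, y) ≤ c p(y)` on the set `T`,
the hash of `x` is nearly uniform and independent of `y`. -/
theorem avg_leftover_hash_le [Nonempty K] [DecidableEq K] {Y : Type*} [Fintype Y] {p : X → Y → ℝ}
    (hp : ∀ x y, 0 ≤ p x y) {T : X → Y → Prop} {c : ℝ} (hc : 0 ≤ c)
    (hT : ∀ x y, T x y → p x y ≤ c * ∑ x', p x' y) {proj : J → K}
    (hproj : ∀ k, mean (fun j => if proj j = k then 1 else 0) = 1 / (Fintype.card K : ℝ)) :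
    avg (fun h : X → J => ∑ y, ∑ k, |(∑ x, p x y) / Fintype.card K -
      ∑ x, p x y * if proj (h x) = k then 1 else 0|) ≤
    2 * ∑ y, ∑ x, p x y * (if T x y then 0 else 1) +
      (∑ y, ∑ x, p x y) * √(c * Fintype.card K) := by
  have hK : (0 : ℝ) < Fintype.card K := by exact_mod_cast Fintype.card_pos
  set N : ℝ := (Fintype.card K : ℝ) with hN
  set χ : K → J → ℝ := fun k j => if proj j = k then 1 else 0 with hχ
  have hχm : ∀ k, mean (χ k) = 1 / N := hproj
  have hχ2 : ∀ k j, χ k j ^ 2 = χ k j := fun k j => by simp only [hχ]; split_ifs <;> norm_num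
  have hχ0 : ∀ k j, 0 ≤ χ k j := fun k j => by simp only [hχ]; split_ifs <;> norm_num
  -- The second moment is used only for the mass on `T`, where the weights are small; the rest is
  -- bounded trivially.
  set good : X → Y → ℝ := fun x y => p x y * if T x y then 1 else 0 with hgood
  set bad : X → Y → ℝ := fun x y => p x y * if T x y then 0 else 1 with hbad
  have hgb : ∀ x y, p x y = good x y + bad x y := fun x y => by
    simp only [hgood, hbad]; split_ifs <;> ring
  have hgood0 : ∀ x y, 0 ≤ good x y := fun x y => by
    simp only [hgood]; split_ifs <;> simp [hp]
  have hbad0 : ∀ x y, 0 ≤ bad x y := fun x y => by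
    simp only [hbad]; split_ifs <;> simp [hp]
  have hgoodle : ∀ x y, good x y ≤ p x y := fun x y => by linarith [hgb x y, hbad0 x y]
  have hpoint : ∀ (h : X → J) y k, |(∑ x, p x y) / N - ∑ x, p x y * χ k (h x)| ≤
      |∑ x, good x y * (χ k (h x) - mean (χ k))| + ∑ x, bad x y * (1 / N + χ k (h x)) := by
    intro h y k
    have e : (∑ x, p x y) / N - ∑ x, p x y * χ k (h x) =
        -(∑ x, good x y * (χ k (h x) - mean (χ k))) + ∑ x, bad x y * (1 / N - χ k (h x)) := by
      rw [Finset.sum_div, ← Finset.sum_sub_distrib, ← Finset.sum_neg_distrib,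
        ← Finset.sum_add_distrib]
      refine Finset.sum_congr rfl fun x _ => ?_
      rw [hχm, hgb x y]
      ring
    rw [e]
    refine (abs_add_le _ _).trans (add_le_add (abs_neg _).le ?_)
    refine (Finset.abs_sum_le_sum_abs _ _).trans (Finset.sum_le_sum fun x _ => ?_)
    rw [abs_mul, abs_of_nonneg (hbad0 x y)]
    refine mul_le_mul_of_nonneg_left ?_ (hbad0 x y)
    have := hχ0 k (h x)
    have : 0 ≤ 1 / N := by positivity
    rw [abs_le]
    constructor <;> linarith
  -- Bad mass counts twice: once spread uniformly over the keys, once at its actual key.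
  have hbadsum : ∀ (h : X → J) y, ∑ k, ∑ x, bad x y * (1 / N + χ k (h x)) =
      2 * ∑ x, bad x y := by
    intro h y
    rw [Finset.sum_comm, Finset.mul_sum]
    refine Finset.sum_congr rfl fun x _ => ?_
    rw [← Finset.mul_sum, Finset.sum_add_distrib]
    have h1 : ∑ _k : K, 1 / N = 1 := by
      rw [Finset.sum_const, Finset.card_univ, nsmul_eq_mul, ← hN, mul_one_div_cancel hK.ne']
    have h2 : ∑ k, χ k (h x) = 1 := by simp [hχ]
    rw [h1, h2]
    ring
  have hroot : ∀ y k, avg (fun h : X → J => |∑ x, good x y * (χ k (h x) - mean (χ k))|) ≤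
      (∑ x, p x y) * √(c / N) := by
    intro y k
    have hP : 0 ≤ ∑ x, p x y := Finset.sum_nonneg fun x _ => hp x y
    refine (avg_abs_le _ (hχ2 k)).trans ?_
    rw [← sqrt_sq hP, ← sqrt_mul (sq_nonneg _)]
    refine sqrt_le_sqrt ?_
    rw [hχm]
    have h1 : ∑ x, good x y ^ 2 ≤ c * (∑ x, p x y) ^ 2 := by
      rw [sq (∑ x, p x y), ← mul_assoc, Finset.mul_sum]
      refine Finset.sum_le_sum fun x _ => ?_
      rw [sq]
      by_cases hx : T x y
      · exact mul_le_mul ((hgoodle x y).trans (hT x y hx)) (hgoodle x y) (hgood0 x y)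
          (mul_nonneg hc hP)
      · have : good x y = 0 := by simp [hgood, hx]
        rw [this, mul_zero]
        exact mul_nonneg (mul_nonneg hc hP) (hp x y)
    calc 1 / N * ∑ x, good x y ^ 2 ≤ 1 / N * (c * (∑ x, p x y) ^ 2) :=
          mul_le_mul_of_nonneg_left h1 (by positivity)
      _ = (∑ x, p x y) ^ 2 * (c / N) := by ring
  -- The root bound holds for each of the `N` keys, and these bounds are added.
  have hNroot : N * √(c / N) = √(c * N) := by
    rw [← sqrt_sq hK.le, ← sqrt_mul (sq_nonneg _), sqrt_sq hK.le]
    congr 1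
    field_simp
  refine (avg_mono fun h => Finset.sum_le_sum fun y _ =>
    Finset.sum_le_sum fun k _ => hpoint h y k).trans ?_
  simp only [Finset.sum_add_distrib, hbadsum]
  rw [avg_add, avg_const, ← Finset.mul_sum, add_comm]
  refine add_le_add le_rfl ?_
  simp only [avg_sum]
  rw [Finset.sum_mul]
  refine Finset.sum_le_sum fun y _ => ?_
  refine (Finset.sum_le_sum fun k _ => hroot y k).trans (le_of_eq ?_)
  rw [Finset.sum_const, Finset.card_univ, nsmul_eq_mul, ← hN, ← hNroot]
  ring

/-- Distinct elements collide with probability `1 / |K|`. -/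
theorem avg_collision [Nonempty K] [DecidableEq K] {proj : J → K}
    (hproj : ∀ k, mean (fun j => if proj j = k then 1 else 0) = 1 / (Fintype.card K : ℝ))
    {x x' : X} (hx : x ≠ x') :
    avg (fun h : X → J => if proj (h x) = proj (h x') then 1 else 0) =
      1 / (Fintype.card K : ℝ) := by
  have hK : (Fintype.card K : ℝ) ≠ 0 := card_ne_zero_real
  have e : ∀ h : X → J, (if proj (h x) = proj (h x') then (1 : ℝ) else 0) =
      ∑ k, (if proj (h x) = k then 1 else 0) * (if proj (h x') = k then 1 else 0) := by
    intro h
    simp [eq_comm]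
  simp only [e, avg_sum]
  have : ∀ k, avg (fun h : X → J => (if proj (h x) = k then (1 : ℝ) else 0) *
      (if proj (h x') = k then 1 else 0)) = 1 / Fintype.card K * (1 / Fintype.card K) :=
    fun k => by
      rw [avg_eval_mul_eval hx (fun j => if proj j = k then (1 : ℝ) else 0)
        (fun j => if proj j = k then (1 : ℝ) else 0), hproj]
  simp only [this, Finset.sum_const, Finset.card_univ, nsmul_eq_mul]
  field_simp

end RandomBinning

/-! ### One-shot binning: reversing the random experiment and decoding -/

section OneShot

variable {𝒮 𝒰 ℬ ℰ : Type*} [Fintype 𝒮] [Fintype 𝒰] [Fintype ℬ] [Fintype ℰ] {μ κ φ : ℕ}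

theorem sum_comm_pairs {α β γ δ : Type*} [Fintype α] [Fintype β] [Fintype γ] [Fintype δ]
    (F : α → β → γ → δ → ℝ) :
    ∑ a, ∑ b, ∑ c, ∑ d, F a b c d = ∑ c, ∑ d, ∑ a, ∑ b, F a b c d := by
  have := Finset.sum_comm (s := (Finset.univ : Finset (α × β)))
    (t := (Finset.univ : Finset (γ × δ))) (f := fun z w => F z.1 z.2 w.1 w.2)
  simpa only [Fintype.sum_prod_type] using this

open Classical in
/-- The indicator that the pair `(u, s)` is in the bins of the message `m` and of the public
index `f`. -/
def binInd (h : 𝒰 × 𝒮 → Fin μ × Fin κ × Fin φ) (f : Fin φ) (m : Fin μ) (s : 𝒮) (u : 𝒰) : ℝ :=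
  if ((h (u, s)).1, (h (u, s)).2.2) = (m, f) then 1 else 0

open Classical in
/-- The indicator that the key of the pair `(u, s)` is `k`. -/
def keyInd (h : 𝒰 × 𝒮 → Fin μ × Fin κ × Fin φ) (k : Fin κ) (s : 𝒮) (u : 𝒰) : ℝ :=
  if k = (h (u, s)).2.1 then 1 else 0

open Classical in
/-- The indicator of a wrong estimate of the message or of the key. -/
def decErr (h : 𝒰 × 𝒮 → Fin μ × Fin κ × Fin φ) (est : ℬ → 𝒮 → Fin φ → 𝒰) (f : Fin φ) (m : Fin μ)
    (s : 𝒮) (u : 𝒰) (b : ℬ) : ℝ :=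
  if ((h (est b s f, s)).1, (h (est b s f, s)).2.1) = (m, (h (u, s)).2.1) then 0 else 1

/-- How far the message and the public index are from uniform and independent of the state. -/
def stateGap (q : 𝒮 → ℝ) (PU : 𝒮 → 𝒰 → ℝ) (h : 𝒰 × 𝒮 → Fin μ × Fin κ × Fin φ) : ℝ :=
  ∑ f, ∑ m, ∑ s, |1 / (φ : ℝ) * (1 / (μ : ℝ) * q s) - q s * ∑ u, PU s u * binInd h f m s u|

/-- How far the message, the key and the public index are from uniform and independent of the
warden's output. -/
def wardenGap (q : 𝒮 → ℝ) (PU : 𝒮 → 𝒰 → ℝ) (VE : 𝒰 → 𝒮 → ℰ → ℝ) (Q₀ : ℰ → ℝ)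
    (h : 𝒰 × 𝒮 → Fin μ × Fin κ × Fin φ) : ℝ :=
  ∑ f, ∑ m, ∑ k, ∑ e, |(∑ s, ∑ u, q s * PU s u * binInd h f m s u * (keyInd h k s u * VE u s e)) -
    1 / (φ : ℝ) * (1 / (μ : ℝ) * (1 / (κ : ℝ)) * Q₀ e)|

open Classical in
/-- The probability that the receiver does not recover the auxiliary variable. -/
def estErr (q : 𝒮 → ℝ) (PU : 𝒮 → 𝒰 → ℝ) (VB : 𝒰 → 𝒮 → ℬ → ℝ)
    (h : 𝒰 × 𝒮 → Fin μ × Fin κ × Fin φ) (est : ℬ → 𝒮 → Fin φ → 𝒰) : ℝ :=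
  ∑ s, ∑ u, ∑ b, q s * PU s u * VB u s b * if est b s (h (u, s)).2.2 = u then 0 else 1

theorem binInd_nonneg (h : 𝒰 × 𝒮 → Fin μ × Fin κ × Fin φ) (f m s u) : 0 ≤ binInd h f m s u := by
  unfold binInd; split_ifs <;> norm_num

theorem keyInd_nonneg (h : 𝒰 × 𝒮 → Fin μ × Fin κ × Fin φ) (k s u) : 0 ≤ keyInd h k s u := by
  unfold keyInd; split_ifs <;> norm_num

theorem sum_keyInd (h : 𝒰 × 𝒮 → Fin μ × Fin κ × Fin φ) (s u) : ∑ k, keyInd h k s u = 1 := by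
  simp [keyInd]

theorem decErr_nonneg (h : 𝒰 × 𝒮 → Fin μ × Fin κ × Fin φ) (est : ℬ → 𝒮 → Fin φ → 𝒰) (f m s u b) :
    0 ≤ decErr h est f m s u b := by
  unfold decErr; split_ifs <;> norm_num

theorem decErr_le_one (h : 𝒰 × 𝒮 → Fin μ × Fin κ × Fin φ) (est : ℬ → 𝒮 → Fin φ → 𝒰) (f m s u b) :
    decErr h est f m s u b ≤ 1 := by
  unfold decErr; split_ifs <;> norm_num

open Classical in
theorem sum_binInd_mul_decErr_le (h : 𝒰 × 𝒮 → Fin μ × Fin κ × Fin φ) (est : ℬ → 𝒮 → Fin φ → 𝒰)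
    (s u b) : ∑ f, ∑ m, binInd h f m s u * decErr h est f m s u b ≤
      if est b s (h (u, s)).2.2 = u then 0 else 1 := by
  have : ∑ f, ∑ m, binInd h f m s u * decErr h est f m s u b =
      decErr h est (h (u, s)).2.2 (h (u, s)).1 s u b := by
    simp [binInd, Prod.ext_iff, ite_and]
  rw [this]
  split_ifs with h1
  · simp [decErr, h1]
  · exact decErr_le_one _ _ _ _ _ _ _

/-- The public index can be fixed so that the resulting code is as good as the average over the
public index. -/
theorem exists_public_index {q : 𝒮 → ℝ} (hq : ∀ s, 0 ≤ q s) {PU : 𝒮 → 𝒰 → ℝ}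
    (hPU : ∀ s u, 0 ≤ PU s u) {VB : 𝒰 → 𝒮 → ℬ → ℝ} (hVB : ∀ u s b, 0 ≤ VB u s b)
    (hVB1 : ∀ u s, ∑ b, VB u s b = 1) {VE : 𝒰 → 𝒮 → ℰ → ℝ} (hVE : ∀ u s e, 0 ≤ VE u s e)
    (hVE1 : ∀ u s, ∑ e, VE u s e = 1) (Q₀ : ℰ → ℝ) (hφ : 0 < φ)
    (h : 𝒰 × 𝒮 → Fin μ × Fin κ × Fin φ) (est : ℬ → 𝒮 → Fin φ → 𝒰)
    {post : Fin φ → Fin μ → 𝒮 → stdSimplex ℝ 𝒰}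
    (hpost : ∀ f m s u, (∑ u', PU s u' * binInd h f m s u') * post f m s u =
      PU s u * binInd h f m s u) :
    ∃ f, (∑ m, ∑ s, 1 / (μ : ℝ) * q s * ∑ u, post f m s u * ∑ b, VB u s b *
        decErr h est f m s u b) +
      ∑ m, ∑ k, ∑ e, |(∑ s, 1 / (μ : ℝ) * q s * ∑ u, post f m s u * (keyInd h k s u * VE u s e)) -
        1 / (μ : ℝ) * (1 / (κ : ℝ)) * Q₀ e| ≤
      2 * stateGap q PU h + estErr q PU VB h est + wardenGap q PU VE Q₀ h := by
  classical
  have hφ0 : (0 : ℝ) < φ := by exact_mod_cast hφ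
  have hφi : (0 : ℝ) ≤ 1 / φ := by positivity
  -- `ω` is the operational law, with uniform indices independent of the state; `p` is the law of
  -- the binning experiment. Both have the same conditional law `post` of `u`, so their `ℓ¹`
  -- distance is exactly the state gap, paid once for the error and once for the secrecy.
  set ω : Fin φ → Fin μ → 𝒮 → 𝒰 → ℝ := fun f m s u =>
    1 / (φ : ℝ) * (1 / (μ : ℝ) * q s) * post f m s u with hω
  set p : Fin φ → Fin μ → 𝒮 → 𝒰 → ℝ := fun f m s u => q s * PU s u * binInd h f m s u with hp
  have hp0 : ∀ f m s u, 0 ≤ p f m s u := fun f m s u =>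
    mul_nonneg (mul_nonneg (hq s) (hPU s u)) (binInd_nonneg _ _ _ _ _)
  have hD : ∑ f, ∑ m, ∑ s, ∑ u, |ω f m s u - p f m s u| = stateGap q PU h := by
    refine Finset.sum_congr rfl fun f _ => Finset.sum_congr rfl fun m _ =>
      Finset.sum_congr rfl fun s _ => ?_
    have : ∀ u, |ω f m s u - p f m s u| = |1 / (φ : ℝ) * (1 / (μ : ℝ) * q s) -
        q s * ∑ u, PU s u * binInd h f m s u| * post f m s u := by
      intro u
      have e : ω f m s u - p f m s u = (1 / (φ : ℝ) * (1 / (μ : ℝ) * q s) -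
          q s * ∑ u, PU s u * binInd h f m s u) * post f m s u := by
        rw [sub_mul, mul_assoc (q s), hpost]
        simp only [hω, hp, mul_assoc]
      rw [e, abs_mul, abs_of_nonneg (stdSimplex.zero_le (post f m s) u)]
    simp only [this]
    rw [← Finset.mul_sum, stdSimplex.sum_eq_one, mul_one]
  have hE : ∑ f, 1 / (φ : ℝ) * (∑ m, ∑ s, 1 / (μ : ℝ) * q s * ∑ u, post f m s u * ∑ b, VB u s b *
      decErr h est f m s u b) ≤ stateGap q PU h + estErr q PU VB h est := by
    have e1 : ∑ f, 1 / (φ : ℝ) * (∑ m, ∑ s, 1 / (μ : ℝ) * q s * ∑ u, post f m s u * ∑ b, VB u s b *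
        decErr h est f m s u b) =
        ∑ f, ∑ m, ∑ s, ∑ u, ω f m s u * ∑ b, VB u s b * decErr h est f m s u b := by
      simp only [hω, Finset.mul_sum, mul_assoc]
    have e2 : ∑ f, ∑ m, ∑ s, ∑ u, p f m s u * ∑ b, VB u s b * decErr h est f m s u b ≤
        estErr q PU VB h est := by
      have : ∑ f, ∑ m, ∑ s, ∑ u, p f m s u * ∑ b, VB u s b * decErr h est f m s u b =
          ∑ s, ∑ u, ∑ b, q s * PU s u * VB u s b *
            ∑ f, ∑ m, binInd h f m s u * decErr h est f m s u b := by
        rw [sum_comm_pairs]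
        refine Finset.sum_congr rfl fun s _ => Finset.sum_congr rfl fun u _ => ?_
        simp only [Finset.mul_sum]
        rw [Finset.sum_comm_cycle]
        refine Finset.sum_congr rfl fun b _ => Finset.sum_congr rfl fun f _ =>
          Finset.sum_congr rfl fun m _ => ?_
        simp only [hp]
        ring
      rw [this]
      refine Finset.sum_le_sum fun s _ => Finset.sum_le_sum fun u _ =>
        Finset.sum_le_sum fun b _ => mul_le_mul_of_nonneg_left
          (sum_binInd_mul_decErr_le h est s u b)
          (mul_nonneg (mul_nonneg (hq s) (hPU s u)) (hVB u s b))
    rw [e1, ← hD]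
    refine le_trans ?_ (add_le_add le_rfl e2)
    simp only [← Finset.sum_add_distrib]
    refine Finset.sum_le_sum fun f _ => Finset.sum_le_sum fun m _ => Finset.sum_le_sum fun s _ =>
      Finset.sum_le_sum fun u _ => ?_
    have t0 : 0 ≤ ∑ b, VB u s b * decErr h est f m s u b :=
      Finset.sum_nonneg fun b _ => mul_nonneg (hVB u s b) (decErr_nonneg _ _ _ _ _ _ _)
    have t1 : ∑ b, VB u s b * decErr h est f m s u b ≤ 1 := by
      rw [← hVB1 u s]
      exact Finset.sum_le_sum fun b _ =>
        mul_le_of_le_one_right (hVB u s b) (decErr_le_one _ _ _ _ _ _ _)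
    have t2 : (ω f m s u - p f m s u) * ∑ b, VB u s b * decErr h est f m s u b ≤
        |ω f m s u - p f m s u| :=
      (mul_le_mul_of_nonneg_right (le_abs_self _) t0).trans
        (mul_le_of_le_one_right (abs_nonneg _) t1)
    rw [sub_mul] at t2
    linarith
  have hT : ∑ f, 1 / (φ : ℝ) * (∑ m, ∑ k, ∑ e, |(∑ s, 1 / (μ : ℝ) * q s * ∑ u, post f m s u *
      (keyInd h k s u * VE u s e)) - 1 / (μ : ℝ) * (1 / (κ : ℝ)) * Q₀ e|) ≤
      stateGap q PU h + wardenGap q PU VE Q₀ h := by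
    have e1 : ∑ f, ∑ m, ∑ k, ∑ e, ∑ s, ∑ u, |ω f m s u - p f m s u| * (keyInd h k s u * VE u s e) =
        stateGap q PU h := by
      rw [← hD]
      refine Finset.sum_congr rfl fun f _ => Finset.sum_congr rfl fun m _ => ?_
      have : ∀ s u, ∑ k, ∑ e, |ω f m s u - p f m s u| * (keyInd h k s u * VE u s e) =
          |ω f m s u - p f m s u| := by
        intro s u
        simp only [← Finset.mul_sum, hVE1, mul_one, sum_keyInd]
      rw [sum_comm_pairs]
      simp only [this]
    rw [← e1, wardenGap]
    rw [← Finset.sum_add_distrib]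
    refine Finset.sum_le_sum fun f _ => ?_
    rw [Finset.mul_sum, ← Finset.sum_add_distrib]
    refine Finset.sum_le_sum fun m _ => ?_
    rw [Finset.mul_sum, ← Finset.sum_add_distrib]
    refine Finset.sum_le_sum fun k _ => ?_
    rw [Finset.mul_sum, ← Finset.sum_add_distrib]
    refine Finset.sum_le_sum fun e _ => ?_
    have e0 : ∀ y : ℝ, 1 / (φ : ℝ) * |y| = |1 / (φ : ℝ) * y| := fun y => by
      rw [abs_mul, abs_of_nonneg hφi]
    rw [e0, mul_sub]
    have e2 : 1 / (φ : ℝ) * (∑ s, 1 / (μ : ℝ) * q s * ∑ u, post f m s u *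
        (keyInd h k s u * VE u s e)) = ∑ s, ∑ u, ω f m s u * (keyInd h k s u * VE u s e) := by
      simp only [hω, Finset.mul_sum, mul_assoc]
    rw [e2]
    have e3 : ∑ s, ∑ u, ω f m s u * (keyInd h k s u * VE u s e) -
        1 / (φ : ℝ) * (1 / (μ : ℝ) * (1 / (κ : ℝ)) * Q₀ e) =
        ∑ s, ∑ u, (ω f m s u - p f m s u) * (keyInd h k s u * VE u s e) +
        ((∑ s, ∑ u, p f m s u * (keyInd h k s u * VE u s e)) -
          1 / (φ : ℝ) * (1 / (μ : ℝ) * (1 / (κ : ℝ)) * Q₀ e)) := by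
      simp only [sub_mul, Finset.sum_sub_distrib]
      ring
    rw [e3]
    refine (abs_add_le _ _).trans (add_le_add ?_ le_rfl)
    refine (Finset.abs_sum_le_sum_abs _ _).trans (Finset.sum_le_sum fun s _ => ?_)
    refine (Finset.abs_sum_le_sum_abs _ _).trans (Finset.sum_le_sum fun u _ => ?_)
    rw [abs_mul, abs_of_nonneg (mul_nonneg (keyInd_nonneg h k s u) (hVE u s e))]
  have : Nonempty (Fin φ) := ⟨⟨0, hφ⟩⟩
  -- The average over the public index meets the bound, hence so does some single value, for
  -- reliability and secrecy together.
  by_contra! hcon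
  have hlt := Finset.sum_lt_sum_of_nonempty (Finset.univ_nonempty (α := Fin φ)) fun f _ =>
    mul_lt_mul_of_pos_left (hcon f) (show 0 < 1 / (φ : ℝ) by positivity)
  simp only [mul_add (1 / (φ : ℝ)) (∑ m, ∑ s, _), Finset.sum_add_distrib] at hlt
  rw [Finset.sum_const, Finset.card_univ, Fintype.card_fin, nsmul_eq_mul, ← mul_assoc,
    mul_one_div_cancel hφ0.ne', one_mul] at hlt
  linarith

open Classical in
/-- Slepian-Wolf decoding with random binning. -/
theorem exists_estimator [Nonempty 𝒰] {q : 𝒮 → ℝ} (hq : ∀ s, 0 ≤ q s) {PU : 𝒮 → 𝒰 → ℝ}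
    (hPU : ∀ s u, 0 ≤ PU s u) {VB : 𝒰 → 𝒮 → ℬ → ℝ} (hVB : ∀ u s b, 0 ≤ VB u s b)
    (hsum : ∑ s, ∑ u, ∑ b, q s * PU s u * VB u s b = 1) (hμ : 0 < μ) (hκ : 0 < κ) (hφ : 0 < φ)
    {T : 𝒰 → 𝒮 → ℬ → Prop} {M : ℝ} (hM : ∀ s b, ∑ u, (if T u s b then (1 : ℝ) else 0) ≤ M)
    (hproj : ∀ f : Fin φ, mean (fun j : Fin μ × Fin κ × Fin φ => if j.2.2 = f then 1 else 0) =
      1 / (Fintype.card (Fin φ) : ℝ)) :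
    ∃ est : (𝒰 × 𝒮 → Fin μ × Fin κ × Fin φ) → ℬ → 𝒮 → Fin φ → 𝒰,
      avg (fun h => estErr q PU VB h (est h)) ≤
        (∑ s, ∑ u, ∑ b, q s * PU s u * VB u s b * if T u s b then 0 else 1) + M / φ := by
  have : Nonempty (Fin φ) := ⟨⟨0, hφ⟩⟩
  have : Nonempty (Fin μ × Fin κ × Fin φ) := ⟨⟨0, hμ⟩, ⟨0, hκ⟩, ⟨0, hφ⟩⟩
  -- The estimator takes any typical element of the bin `f`. It fails only if the true `u` is
  -- atypical or another typical element lies in the same bin, which is the pointwise union bound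
  -- `hpt`.
  refine ⟨fun h b s f => if hex : ∃ u, T u s b ∧ (h (u, s)).2.2 = f then hex.choose
    else Classical.arbitrary 𝒰, ?_⟩
  set est : (𝒰 × 𝒮 → Fin μ × Fin κ × Fin φ) → ℬ → 𝒮 → Fin φ → 𝒰 := fun h b s f =>
    if hex : ∃ u, T u s b ∧ (h (u, s)).2.2 = f then hex.choose else Classical.arbitrary 𝒰
  have hpt : ∀ (h : 𝒰 × 𝒮 → Fin μ × Fin κ × Fin φ) s u b,
      (if est h b s (h (u, s)).2.2 = u then (0 : ℝ) else 1) ≤ (if T u s b then 0 else 1) +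
        ∑ u', (if u' ≠ u ∧ T u' s b then (1 : ℝ) else 0) *
          if (h (u', s)).2.2 = (h (u, s)).2.2 then 1 else 0 := by
    intro h s u b
    have hnn : ∀ u', 0 ≤ (if u' ≠ u ∧ T u' s b then (1 : ℝ) else 0) *
          if (h (u', s)).2.2 = (h (u, s)).2.2 then 1 else 0 := fun u' =>
      mul_nonneg (by split_ifs <;> norm_num) (by split_ifs <;> norm_num)
    have hs := Finset.sum_nonneg fun u' (_ : u' ∈ Finset.univ) => hnn u'
    by_cases hT : T u s b
    · by_cases he : est h b s (h (u, s)).2.2 = u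
      · rw [if_pos he, if_pos hT, zero_add]
        exact hs
      · rw [if_neg he, if_pos hT, zero_add]
        have hex : ∃ u', T u' s b ∧ (h (u', s)).2.2 = (h (u, s)).2.2 := ⟨u, hT, rfl⟩
        have hval : est h b s (h (u, s)).2.2 = hex.choose := dif_pos hex
        have hspec := hex.choose_spec
        rw [← hval] at hspec
        refine le_trans ?_ (Finset.single_le_sum (fun u' _ => hnn u')
          (Finset.mem_univ (est h b s (h (u, s)).2.2)))
        rw [if_pos ⟨he, hspec.1⟩, if_pos hspec.2, one_mul]
    · rw [if_neg hT]
      split_ifs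
      · linarith
      · linarith
  have hp0 : ∀ s u b, 0 ≤ q s * PU s u * VB u s b := fun s u b =>
    mul_nonneg (mul_nonneg (hq s) (hPU s u)) (hVB u s b)
  have hcoll : ∀ s u b, avg (fun h : 𝒰 × 𝒮 → Fin μ × Fin κ × Fin φ =>
      ∑ u', (if u' ≠ u ∧ T u' s b then (1 : ℝ) else 0) *
          if (h (u', s)).2.2 = (h (u, s)).2.2 then 1 else 0) ≤ M / φ := by
    intro s u b
    rw [avg_sum]
    simp only [avg_const_mul]
    calc ∑ u', (if u' ≠ u ∧ T u' s b then (1 : ℝ) else 0) *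
          avg (fun h : 𝒰 × 𝒮 → Fin μ × Fin κ × Fin φ =>
            if (h (u', s)).2.2 = (h (u, s)).2.2 then 1 else 0)
        ≤ ∑ u', (if T u' s b then (1 : ℝ) else 0) * (1 / φ) := by
          refine Finset.sum_le_sum fun u' _ => ?_
          by_cases hu : u' ≠ u ∧ T u' s b
          · have hcol := avg_collision (X := 𝒰 × 𝒮) (x := (u', s)) (x' := (u, s)) hproj
              (fun hx => hu.1 (congrArg Prod.fst hx))
            rw [Fintype.card_fin] at hcol
            rw [if_pos hu, if_pos hu.2, hcol]
          · rw [if_neg hu, zero_mul]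
            exact mul_nonneg (by split_ifs <;> norm_num) (by positivity)
      _ ≤ M / φ := by
          rw [← Finset.sum_mul, mul_one_div]
          exact div_le_div_of_nonneg_right (hM s b) (by positivity)
  calc avg (fun h => estErr q PU VB h (est h)) ≤
        avg (fun h : 𝒰 × 𝒮 → Fin μ × Fin κ × Fin φ => ∑ s, ∑ u, ∑ b,
          (q s * PU s u * VB u s b * (if T u s b then 0 else 1) +
          q s * PU s u * VB u s b * ∑ u', (if u' ≠ u ∧ T u' s b then (1 : ℝ) else 0) *
              if (h (u', s)).2.2 = (h (u, s)).2.2 then 1 else 0)) := by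
        refine avg_mono fun h => Finset.sum_le_sum fun s _ => Finset.sum_le_sum fun u _ =>
          Finset.sum_le_sum fun b _ => ?_
        rw [← mul_add]
        exact mul_le_mul_of_nonneg_left (hpt h s u b) (hp0 s u b)
    _ ≤ ∑ s, ∑ u, ∑ b, (q s * PU s u * VB u s b * (if T u s b then 0 else 1) +
          q s * PU s u * VB u s b * (M / φ)) := by
        rw [avg_sum]
        refine Finset.sum_le_sum fun s _ => ?_
        rw [avg_sum]
        refine Finset.sum_le_sum fun u _ => ?_
        rw [avg_sum]
        refine Finset.sum_le_sum fun b _ => ?_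
        rw [avg_add, avg_const, avg_const_mul]
        exact add_le_add le_rfl (mul_le_mul_of_nonneg_left (hcoll s u b) (hp0 s u b))
    _ = _ := by
        simp only [Finset.sum_add_distrib, ← Finset.sum_mul, hsum, one_mul]

end OneShot

/-! ### Codes built from a binning -/

section BinningCode

variable {S A B E 𝒰 : Type*} [Fintype S] [Fintype A] [Fintype B] [Fintype E] [Fintype 𝒰]
  {n μ κ φ : ℕ}

/-- The law of the receiver's output block given the auxiliary variable and the state sequence. -/
def blockReceiver (PA : 𝒰 → (Fin n → S) → stdSimplex ℝ (Fin n → A))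
    (W : A → S → stdSimplex ℝ (B × E)) (u : 𝒰) (s : Fin n → S) (b : Fin n → B) : ℝ :=
  ∑ a, PA u s a * ∏ i, receiverChannel W (a i) (s i) (b i)

/-- The law of the warden's output block given the auxiliary variable and the state sequence. -/
def blockWarden (PA : 𝒰 → (Fin n → S) → stdSimplex ℝ (Fin n → A))
    (W : A → S → stdSimplex ℝ (B × E)) (u : 𝒰) (s : Fin n → S) (e : Fin n → E) : ℝ :=
  ∑ a, PA u s a * ∏ i, wardenChannel W (a i) (s i) (e i)

theorem sum_pi_prod {α : Type*} [Fintype α] (w : Fin n → α → ℝ) :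
    ∑ x : Fin n → α, ∏ i, w i (x i) = ∏ i, ∑ z, w i z := by
  have := Finset.prod_univ_sum (fun _ : Fin n => (Finset.univ : Finset α)) w
  rw [Fintype.piFinset_univ] at this
  exact this.symm

theorem blockReceiver_nonneg (PA : 𝒰 → (Fin n → S) → stdSimplex ℝ (Fin n → A))
    (W : A → S → stdSimplex ℝ (B × E)) (u s b) : 0 ≤ blockReceiver PA W u s b :=
  Finset.sum_nonneg fun _ _ => mul_nonneg (stdSimplex.zero_le _ _)
    (Finset.prod_nonneg fun _ _ => receiverChannel_nonneg _ _ _ _)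

theorem blockWarden_nonneg (PA : 𝒰 → (Fin n → S) → stdSimplex ℝ (Fin n → A))
    (W : A → S → stdSimplex ℝ (B × E)) (u s e) : 0 ≤ blockWarden PA W u s e :=
  Finset.sum_nonneg fun _ _ => mul_nonneg (stdSimplex.zero_le _ _)
    (Finset.prod_nonneg fun _ _ => wardenChannel_nonneg _ _ _ _)

theorem sum_blockReceiver (PA : 𝒰 → (Fin n → S) → stdSimplex ℝ (Fin n → A))
    (W : A → S → stdSimplex ℝ (B × E)) (u s) : ∑ b, blockReceiver PA W u s b = 1 := by
  simp only [blockReceiver]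
  rw [Finset.sum_comm]
  simp only [← Finset.mul_sum, sum_pi_prod, sum_receiverChannel, Finset.prod_const_one, mul_one,
    stdSimplex.sum_eq_one]

theorem sum_blockWarden (PA : 𝒰 → (Fin n → S) → stdSimplex ℝ (Fin n → A))
    (W : A → S → stdSimplex ℝ (B × E)) (u s) : ∑ e, blockWarden PA W u s e = 1 := by
  simp only [blockWarden]
  rw [Finset.sum_comm]
  simp only [← Finset.mul_sum, sum_pi_prod, sum_wardenChannel, Finset.prod_const_one, mul_one,
    stdSimplex.sum_eq_one]

theorem sum_memoryless_mul_receiver (W : A → S → stdSimplex ℝ (B × E)) (a : Fin n → A)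
    (s : Fin n → S) (F : (Fin n → B) → ℝ) :
    ∑ y : (Fin n → B) × (Fin n → E), (∏ i, W (a i) (s i) (y.1 i, y.2 i)) * F y.1 =
      ∑ b, (∏ i, receiverChannel W (a i) (s i) (b i)) * F b := by
  rw [Fintype.sum_prod_type]
  refine Finset.sum_congr rfl fun b _ => ?_
  dsimp only
  rw [← Finset.sum_mul]
  simp only [receiverChannel, sum_pi_prod (fun i e => W (a i) (s i) (b i, e))]

theorem sum_memoryless_mul_warden (W : A → S → stdSimplex ℝ (B × E)) (a : Fin n → A)
    (s : Fin n → S) (F : (Fin n → E) → ℝ) :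
    ∑ y : (Fin n → B) × (Fin n → E), (∏ i, W (a i) (s i) (y.1 i, y.2 i)) * F y.2 =
      ∑ e, (∏ i, wardenChannel W (a i) (s i) (e i)) * F e := by
  rw [Fintype.sum_prod_type, Finset.sum_comm]
  refine Finset.sum_congr rfl fun e _ => ?_
  dsimp only
  rw [← Finset.sum_mul]
  simp only [wardenChannel, sum_pi_prod (fun i b => W (a i) (s i) (b, e i))]

open Classical in
/-- The code that draws the auxiliary variable from `post`, the channel input from `PA`, and uses
the key `key` and the decision rule `est`. -/
def binCode (post : Fin μ → (Fin n → S) → stdSimplex ℝ 𝒰)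
    (PA : 𝒰 → (Fin n → S) → stdSimplex ℝ (Fin n → A)) (key : 𝒰 → (Fin n → S) → Fin κ)
    (est : (Fin n → B) → (Fin n → S) → Fin μ × Fin κ) : Code S A B n μ κ where
  enc m s := ⟨fun x => ∑ u, post m s u * PA u s x.1 * if x.2 = key u s then 1 else 0, by
    refine ⟨fun x => Finset.sum_nonneg fun u _ => mul_nonneg
      (mul_nonneg (stdSimplex.zero_le _ _) (stdSimplex.zero_le _ _))
      (by split_ifs <;> norm_num), ?_⟩
    rw [Finset.sum_comm]
    simp only [Fintype.sum_prod_type, mul_ite, mul_one, mul_zero, Finset.sum_ite_eq',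
      Finset.mem_univ, if_true, ← Finset.mul_sum, stdSimplex.sum_eq_one]⟩
  dec b s := stdSimplex.vertex (est b s)

variable (post : Fin μ → (Fin n → S) → stdSimplex ℝ 𝒰)
    (PA : 𝒰 → (Fin n → S) → stdSimplex ℝ (Fin n → A)) (key : 𝒰 → (Fin n → S) → Fin κ)
    (est : (Fin n → B) → (Fin n → S) → Fin μ × Fin κ)
    (Q : stdSimplex ℝ S) (W : A → S → stdSimplex ℝ (B × E))

theorem sum_inducedLaw_binCode (F : Fin μ → (Fin n → S) → Fin κ →
    (Fin n → B) × (Fin n → E) → ℝ) :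
    ∑ ω, (binCode post PA key est).inducedLaw Q W ω * F ω.1 ω.2.1 ω.2.2.1.2 ω.2.2.2.1 =
      ∑ m, ∑ s, 1 / (μ : ℝ) * (∏ i, Q (s i)) * ∑ u, post m s u * ∑ a, PA u s a *
        ∑ y : (Fin n → B) × (Fin n → E), (∏ i, W (a i) (s i) (y.1 i, y.2 i)) *
          F m s (key u s) y := by
  classical
  rw [sum_inducedLaw_mul _ Q W (fun ω => F ω.1 ω.2.1 ω.2.2.1.2 ω.2.2.2.1)]
  refine Finset.sum_congr rfl fun m _ => Finset.sum_congr rfl fun s _ => ?_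
  simp only [← Finset.sum_mul, stdSimplex.sum_eq_one, one_mul, ← Finset.mul_sum,
    mul_assoc (1 / (μ : ℝ) * ∏ i, Q (s i))]
  congr 1
  have henc : ∀ x, (binCode post PA key est).enc m s x =
    ∑ u, post m s u * PA u s x.1 * if x.2 = key u s then 1 else 0 := fun x => rfl
  simp only [henc, Finset.sum_mul]
  rw [Finset.sum_comm]
  refine Finset.sum_congr rfl fun u _ => ?_
  rw [Fintype.sum_prod_type, Finset.mul_sum]
  refine Finset.sum_congr rfl fun a _ => ?_
  rw [Finset.sum_eq_single (key u s)]
  · simp only [if_true, mul_one, mul_assoc]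
  · intro k _ hk
    simp [hk]
  · simp

open Classical in
theorem errorProb_binCode :
    (binCode post PA key est).errorProb Q W = ∑ m, ∑ s, 1 / (μ : ℝ) * (∏ i, Q (s i)) *
      ∑ u, post m s u * ∑ b, blockReceiver PA W u s b *
        if est b s = (m, key u s) then 0 else 1 := by
  have hdec : ∀ b s x, (1 : ℝ) - (binCode post PA key est).dec b s x =
      if est b s = x then 0 else 1 := by
    intro b s x
    simp only [binCode, stdSimplex.vertex_coe, Pi.single_apply, eq_comm]
    split_ifs <;> norm_num
  rw [errorProb_eq]
  simp only [hdec]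
  rw [sum_inducedLaw_binCode post PA key est Q W
    (fun m s k y => if est y.1 s = (m, k) then 0 else 1)]
  simp only [blockReceiver, Finset.sum_mul]
  refine Finset.sum_congr rfl fun m _ => Finset.sum_congr rfl fun s _ => ?_
  congr 1
  refine Finset.sum_congr rfl fun u _ => ?_
  congr 1
  rw [Finset.sum_comm]
  refine Finset.sum_congr rfl fun a _ => ?_
  rw [sum_memoryless_mul_receiver W a s (fun b => if est b s = (m, key u s) then 0 else 1),
    Finset.mul_sum]
  simp only [mul_assoc]

open Classical in
theorem wardenLaw_binCode (m : Fin μ) (k : Fin κ) (e : Fin n → E) :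
    (binCode post PA key est).wardenLaw Q W (m, k, e) = ∑ s, 1 / (μ : ℝ) * (∏ i, Q (s i)) *
      ∑ u, post m s u * ((if k = key u s then 1 else 0) * blockWarden PA W u s e) := by
  rw [Code.wardenLaw, law_apply]
  refine (Finset.sum_congr rfl fun ω _ => ?_).trans
    ((sum_inducedLaw_binCode post PA key est Q W (fun m' s k' y =>
      (if m' = m then 1 else 0) * ((if k = k' then 1 else 0) * if y.2 = e then 1 else 0))).trans ?_)
  · congr 1
    simp only [show (k = ω.2.2.1.2) ↔ (ω.2.2.1.2 = k) from eq_comm]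
    by_cases h1 : ω.1 = m <;> by_cases h2 : ω.2.2.1.2 = k <;> by_cases h3 : ω.2.2.2.1.2 = e <;>
      simp [h1, h2, h3]
  · rw [Finset.sum_eq_single m]
    · refine Finset.sum_congr rfl fun s _ => ?_
      congr 1
      refine Finset.sum_congr rfl fun u _ => ?_
      congr 1
      rw [blockWarden, Finset.mul_sum]
      refine Finset.sum_congr rfl fun a _ => ?_
      rw [sum_memoryless_mul_warden W a s (fun e' => (if m = m then 1 else 0) *
        ((if k = key u s then 1 else 0) * if e' = e then 1 else 0))]
      simp
    · intro m' _ hm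
      simp [hm]
    · simp

/-- Random binning codes: for every assignment of message, key and public index to the pairs of
auxiliary variable and state sequence there is a code whose reliability and covert secrecy are
controlled by the gaps of the binning. -/
theorem exists_code_of_binning [Nonempty 𝒰] {φ₀ : stdSimplex ℝ A}
    (PU : (Fin n → S) → stdSimplex ℝ 𝒰) (hφ : 0 < φ)
    (h : 𝒰 × (Fin n → S) → Fin μ × Fin κ × Fin φ) (est : (Fin n → B) → (Fin n → S) → Fin φ → 𝒰) :
    ∃ c : Code S A B n μ κ, c.errorProb Q W +
        2 * tvDist (c.wardenLaw Q W) (idealLaw (innocentOutput Q φ₀ W) n μ κ) ≤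
      2 * stateGap (fun s => ∏ i, Q (s i)) (fun s u => PU s u) h +
        estErr (fun s => ∏ i, Q (s i)) (fun s u => PU s u) (blockReceiver PA W) h est +
        wardenGap (fun s => ∏ i, Q (s i)) (fun s u => PU s u) (blockWarden PA W)
          (fun e => ∏ i, innocentOutput Q φ₀ W (e i)) h := by
  classical
  choose post hpost using fun (f : Fin φ) (m : Fin μ) (s : Fin n → S) =>
    exists_stdSimplex_smul (f := fun u => PU s u * binInd h f m s u)
      (fun u => mul_nonneg (stdSimplex.zero_le _ _) (binInd_nonneg _ _ _ _ _))
  obtain ⟨f, hf⟩ := exists_public_index (q := fun s : Fin n → S => ∏ i, Q (s i))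
    (fun s => Finset.prod_nonneg fun i _ => stdSimplex.zero_le _ _)
    (PU := fun s u => PU s u) (fun s u => stdSimplex.zero_le _ _)
    (blockReceiver_nonneg PA W) (sum_blockReceiver PA W) (blockWarden_nonneg PA W)
    (sum_blockWarden PA W) (fun e => ∏ i, innocentOutput Q φ₀ W (e i)) hφ h est hpost
  refine ⟨binCode (post f) PA (fun u s => (h (u, s)).2.1)
    (fun b s => ((h (est b s f, s)).1, (h (est b s f, s)).2.1)), le_trans (le_of_eq ?_) hf⟩
  congr 1
  · rw [errorProb_binCode]
    rfl
  · rw [tvDist, ← mul_assoc, show (2 : ℝ) * (1 / 2) = 1 by norm_num, one_mul]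
    simp only [Fintype.sum_prod_type, wardenLaw_binCode, idealLaw]
    rfl

end BinningCode

/-! ### Average gaps of a random binning -/

section Averaging

variable {𝒮 𝒰 ℰ : Type*} [Fintype 𝒮] [Fintype 𝒰] [Fintype ℰ] {μ κ φ : ℕ}

theorem mean_ite_eq {J : Type*} [Fintype J] [Nonempty J] [DecidableEq J] (k : J) :
    mean (fun j : J => if j = k then 1 else 0) = 1 / (Fintype.card J : ℝ) := by
  simp [mean]

theorem mean_ite_message_public [NeZero κ] (k : Fin μ × Fin φ) :
    mean (fun j : Fin μ × Fin κ × Fin φ => if (j.1, j.2.2) = k then 1 else 0) =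
      1 / (Fintype.card (Fin μ × Fin φ) : ℝ) := by
  have hκ : (κ : ℝ) ≠ 0 := by exact_mod_cast NeZero.ne κ
  simp only [mean, Fintype.sum_prod_type, Prod.ext_iff, ite_and, mul_ite, mul_one, mul_zero,
    Finset.sum_ite_eq', Finset.mem_univ, if_true, Finset.sum_const, Finset.card_univ,
    Fintype.card_prod, Fintype.card_fin, nsmul_eq_mul, Nat.cast_mul, Finset.sum_ite_irrel]
  field_simp

theorem mean_ite_public [NeZero μ] [NeZero κ] (k : Fin φ) :
    mean (fun j : Fin μ × Fin κ × Fin φ => if j.2.2 = k then 1 else 0) =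
      1 / (Fintype.card (Fin φ) : ℝ) := by
  have hκ : (κ : ℝ) ≠ 0 := by exact_mod_cast NeZero.ne κ
  have hμ : (μ : ℝ) ≠ 0 := by exact_mod_cast NeZero.ne μ
  simp only [mean, Fintype.sum_prod_type, mul_ite, mul_one, mul_zero,
    Finset.sum_ite_eq', Finset.mem_univ, if_true, Finset.sum_const, Finset.card_univ,
    Fintype.card_prod, Fintype.card_fin, nsmul_eq_mul, Nat.cast_mul]
  field_simp

open Classical in
-- Leftover hashing with the state as side information. The hashed pair contains the state, so its
-- joint law with the state lives on the diagonal and only the randomness of `u` given `s` counts.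
theorem avg_stateGap_le [NeZero μ] [NeZero κ] [NeZero φ] {q : 𝒮 → ℝ} (hq : ∀ s, 0 ≤ q s)
    (hq1 : ∑ s, q s = 1) {PU : 𝒮 → 𝒰 → ℝ} (hPU : ∀ s u, 0 ≤ PU s u)
    (hPU1 : ∀ s, ∑ u, PU s u = 1) {c : ℝ} (hc : 0 ≤ c) :
    avg (fun h : 𝒰 × 𝒮 → Fin μ × Fin κ × Fin φ => stateGap q PU h) ≤
      2 * (∑ s, ∑ u, q s * PU s u * if q s * PU s u ≤ c * q s then 0 else 1) +
        √(c * (μ * φ)) := by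
  set p : 𝒰 × 𝒮 → 𝒮 → ℝ := fun x s => if x.2 = s then q s * PU s x.1 else 0 with hp
  have hsum : ∀ (G : 𝒰 × 𝒮 → ℝ) s, ∑ x, p x s * G x = ∑ u, q s * PU s u * G (u, s) := by
    intro G s
    simp [hp, Fintype.sum_prod_type, ite_mul]
  have hp1 : ∀ s, ∑ x, p x s = q s := by
    intro s
    have := hsum (fun _ => 1) s
    simp only [mul_one, ← Finset.mul_sum, hPU1] at this
    exact this
  have key := avg_leftover_hash_le (X := 𝒰 × 𝒮) (J := Fin μ × Fin κ × Fin φ) (p := p)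
    (fun x s => by simp only [hp]; split_ifs; exacts [mul_nonneg (hq s) (hPU s _), le_rfl])
    (T := fun x s => q s * PU s x.1 ≤ c * q s) hc
    (fun x s hx => by
      rw [hp1]
      simp only [hp]
      split_ifs
      exacts [hx, mul_nonneg hc (hq s)])
    (proj := fun j => (j.1, j.2.2)) mean_ite_message_public
  simp only [hsum (fun x => if q _ * PU _ x.1 ≤ c * q _ then 0 else 1), hp1, hq1, one_mul,
    Fintype.card_prod, Fintype.card_fin, Nat.cast_mul] at key
  refine le_trans (le_of_eq ?_) key
  congr 1
  funext h
  rw [stateGap, Finset.sum_comm_cycle]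
  refine Finset.sum_congr rfl fun s _ => ?_
  rw [Fintype.sum_prod_type, Finset.sum_comm]
  refine Finset.sum_congr rfl fun m _ => Finset.sum_congr rfl fun f _ => ?_
  rw [hsum (fun x => if ((h x).1, (h x).2.2) = (m, f) then 1 else 0)]
  congr 2
  · field_simp
  · simp only [Finset.mul_sum, mul_assoc]
    rfl

open Classical in
-- Leftover hashing of the whole pair `(u, s)` against the warden's output. The state counts as
-- secret randomness here, which is the origin of `H(S|E)` in the sum rate.
theorem avg_wardenGap_le [NeZero μ] [NeZero κ] [NeZero φ] {q : 𝒮 → ℝ} (hq : ∀ s, 0 ≤ q s)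
    {PU : 𝒮 → 𝒰 → ℝ} (hPU : ∀ s u, 0 ≤ PU s u) {VE : 𝒰 → 𝒮 → ℰ → ℝ}
    (hVE : ∀ u s e, 0 ≤ VE u s e) {Q₀ : ℰ → ℝ} (hQ₀ : ∀ e, ∑ s, ∑ u, q s * PU s u * VE u s e = Q₀ e)
    (hQ₀1 : ∑ e, Q₀ e = 1) {c : ℝ} (hc : 0 ≤ c) :
    avg (fun h : 𝒰 × 𝒮 → Fin μ × Fin κ × Fin φ => wardenGap q PU VE Q₀ h) ≤
      2 * (∑ s, ∑ u, ∑ e, q s * PU s u * VE u s e *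
        if q s * PU s u * VE u s e ≤ c * Q₀ e then 0 else 1) + √(c * (μ * (κ * φ))) := by
  have hsum : ∀ G : 𝒮 → 𝒰 → ℝ, ∑ x : 𝒰 × 𝒮, G x.2 x.1 = ∑ s, ∑ u, G s u := by
    intro G
    rw [Fintype.sum_prod_type, Finset.sum_comm]
  have hp1 : ∀ e, ∑ x : 𝒰 × 𝒮, q x.2 * PU x.2 x.1 * VE x.1 x.2 e = Q₀ e := fun e => by
    rw [hsum (fun s u => q s * PU s u * VE u s e), hQ₀]
  have key := avg_leftover_hash_le (X := 𝒰 × 𝒮) (J := Fin μ × Fin κ × Fin φ)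
    (p := fun x e => q x.2 * PU x.2 x.1 * VE x.1 x.2 e)
    (fun x e => mul_nonneg (mul_nonneg (hq _) (hPU _ _)) (hVE _ _ _))
    (T := fun x e => q x.2 * PU x.2 x.1 * VE x.1 x.2 e ≤ c * Q₀ e) hc
    (fun x e hx => by rwa [hp1]) (proj := fun j => j) mean_ite_eq
  simp only [hp1, hQ₀1, one_mul, Fintype.card_prod, Fintype.card_fin, Nat.cast_mul] at key
  refine le_trans (le_of_eq ?_) (key.trans (le_of_eq ?_))
  · congr 1
    funext h
    rw [wardenGap]
    have : ∀ F : Fin φ → Fin μ → Fin κ → ℰ → ℝ, ∑ f, ∑ m, ∑ k, ∑ e, F f m k e =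
        ∑ e, ∑ j : Fin μ × Fin κ × Fin φ, F j.2.2 j.1 j.2.1 e := by
      intro F
      simp only [Fintype.sum_prod_type]
      rw [Finset.sum_comm]
      symm
      rw [Finset.sum_comm]
      refine Finset.sum_congr rfl fun m _ => ?_
      rw [Finset.sum_comm_cycle]
      refine Finset.sum_congr rfl fun f _ => ?_
      rw [Finset.sum_comm]
    rw [this]
    refine Finset.sum_congr rfl fun e _ => Finset.sum_congr rfl fun j _ => ?_
    rw [abs_sub_comm]
    congr 2
    · field_simp
    · rw [← hsum (fun s u => q s * PU s u * binInd h j.2.2 j.1 s u *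
        (keyInd h j.2.1 s u * VE u s e))]
      refine Finset.sum_congr rfl fun x _ => ?_
      have : binInd h j.2.2 j.1 x.2 x.1 * keyInd h j.2.1 x.2 x.1 = if h x = j then 1 else 0 := by
        simp only [binInd, keyInd, Prod.ext_iff]
        split_ifs <;> simp_all
      rw [← this]
      ring
  · congr 2
    have : ∀ e, ∑ x : 𝒰 × 𝒮, q x.2 * PU x.2 x.1 * VE x.1 x.2 e *
        (if q x.2 * PU x.2 x.1 * VE x.1 x.2 e ≤ c * Q₀ e then 0 else 1) =
        ∑ s, ∑ u, q s * PU s u * VE u s e *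
          if q s * PU s u * VE u s e ≤ c * Q₀ e then 0 else 1 := fun e =>
      hsum (fun s u => q s * PU s u * VE u s e *
        if q s * PU s u * VE u s e ≤ c * Q₀ e then 0 else 1)
    simp only [this]
    rw [Finset.sum_comm]
    refine Finset.sum_congr rfl fun s _ => ?_
    rw [Finset.sum_comm]

end Averaging

/-! ### Memoryless blocks -/

section Blocks

/-- The law of independent variables with given laws. -/
def blockSimplex {α : Type*} [Fintype α] {n : ℕ} (p : Fin n → stdSimplex ℝ α) :
    stdSimplex ℝ (Fin n → α) :=
  ⟨fun x => ∏ i, p i (x i), fun x => Finset.prod_nonneg fun i _ => stdSimplex.zero_le _ _, by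
    rw [sum_pi_prod (fun i => p i)]
    simp [stdSimplex.sum_eq_one]⟩

theorem blockSimplex_apply {α : Type*} [Fintype α] {n : ℕ} (p : Fin n → stdSimplex ℝ α)
    (x : Fin n → α) : blockSimplex p x = ∏ i, p i (x i) := rfl

theorem sum_arrow_prod {X Y : Type*} [Fintype X] [Fintype Y] {n : ℕ}
    (F : (Fin n → X) → (Fin n → Y) → ℝ) :
    ∑ z : Fin n → X × Y, F (fun i => (z i).1) (fun i => (z i).2) = ∑ x, ∑ y, F x y := by
  rw [← Fintype.sum_prod_type']
  exact Fintype.sum_equiv (Equiv.arrowProdEquivProdArrow (Fin n) (fun _ => X) (fun _ => Y)) _ _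
    fun _ => rfl

open Classical in
-- The large deviation bound for an abstract typical set: outside `T` the product of `r` must be
-- large, but this is demanded only on words of positive probability.
theorem tendsto_sum_prod_ite_two {S U : Type*} [Fintype S] [Fintype U] {p r : S → U → ℝ}
    (hp : ∀ s u, 0 ≤ p s u) (hp1 : ∑ s, ∑ u, p s u = 1) (hr : ∀ s u, 0 < p s u → 0 < r s u)
    {m : ℝ} (hm : ∑ s, ∑ u, p s u * log (r s u) < m)
    {T : (n : ℕ) → (Fin n → S) → (Fin n → U) → Prop}
    (hT : ∀ n s u, (∀ i, 0 < p (s i) (u i)) → ¬ T n s u → exp (n * m) ≤ ∏ i, r (s i) (u i)) :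
    Tendsto (fun n => ∑ s, ∑ u, (∏ i, p (s i) (u i)) * if T n s u then 0 else 1) atTop (𝓝 0) := by
  have key := tendsto_sum_prod_exp_le (Z := S × U) (p := fun z => p z.1 z.2)
    (r := fun z => r z.1 z.2) (fun z => hp _ _) (by rwa [Fintype.sum_prod_type])
    (fun z => hr _ _) (m := m) (by rwa [Fintype.sum_prod_type])
  refine squeeze_zero (fun n => Finset.sum_nonneg fun s _ => Finset.sum_nonneg fun u _ =>
    mul_nonneg (Finset.prod_nonneg fun i _ => hp _ _) (by split_ifs <;> norm_num))
    (fun n => ?_) key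
  rw [sum_arrow_prod (fun s u => (∏ i, p (s i) (u i)) *
    if exp (n * m) ≤ ∏ i, r (s i) (u i) then 1 else 0)]
  refine Finset.sum_le_sum fun s _ => Finset.sum_le_sum fun u _ => ?_
  by_cases hpos : ∀ i, 0 < p (s i) (u i)
  · refine mul_le_mul_of_nonneg_left ?_ (Finset.prod_nonneg fun i _ => hp _ _)
    by_cases h : T n s u
    · rw [if_pos h]; split_ifs <;> norm_num
    · rw [if_neg h, if_pos (hT n s u hpos h)]
  · push Not at hpos
    obtain ⟨i, hi⟩ := hpos
    rw [Finset.prod_eq_zero (Finset.mem_univ i) (le_antisymm hi (hp _ _)), zero_mul, zero_mul]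

open Classical in
theorem tendsto_sum_prod_ite {S U V : Type*} [Fintype S] [Fintype U] [Fintype V]
    {p r : S → U → V → ℝ}
    (hp : ∀ s u v, 0 ≤ p s u v) (hp1 : ∑ s, ∑ u, ∑ v, p s u v = 1)
    (hr : ∀ s u v, 0 < p s u v → 0 < r s u v)
    {m : ℝ} (hm : ∑ s, ∑ u, ∑ v, p s u v * log (r s u v) < m)
    {T : (n : ℕ) → (Fin n → S) → (Fin n → U) → (Fin n → V) → Prop}
    (hT : ∀ n s u v, (∀ i, 0 < p (s i) (u i) (v i)) → ¬ T n s u v →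
      exp (n * m) ≤ ∏ i, r (s i) (u i) (v i)) :
    Tendsto (fun n => ∑ s, ∑ u, ∑ v, (∏ i, p (s i) (u i) (v i)) * if T n s u v then 0 else 1)
      atTop (𝓝 0) := by
  have key := tendsto_sum_prod_ite_two (S := S) (U := U × V) (p := fun s z => p s z.1 z.2)
    (r := fun s z => r s z.1 z.2) (fun s z => hp _ _ _) (by simpa only [Fintype.sum_prod_type])
    (fun s z => hr _ _ _) (m := m) (by simpa only [Fintype.sum_prod_type])
    (T := fun n s z => T n s (fun i => (z i).1) (fun i => (z i).2))
    (fun n s z hz hnT => hT n s _ _ hz hnT)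
  refine key.congr fun n => Finset.sum_congr rfl fun s _ => ?_
  rw [sum_arrow_prod (fun u v => (∏ i, p (s i) (u i) (v i)) * if T n s u v then 0 else 1)]

variable {S A B E U : Type*} [Fintype S] [Fintype A] [Fintype B] [Fintype E] [Fintype U]

/-- The receiver's channel seen from the auxiliary variable. -/
def auxReceiver (pA : U → S → stdSimplex ℝ A) (W : A → S → stdSimplex ℝ (B × E)) (u : U) (s : S)
    (b : B) : ℝ := ∑ a, pA u s a * receiverChannel W a s b

/-- The warden's channel seen from the auxiliary variable. -/
def auxWarden (pA : U → S → stdSimplex ℝ A) (W : A → S → stdSimplex ℝ (B × E)) (u : U) (s : S)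
    (e : E) : ℝ := ∑ a, pA u s a * wardenChannel W a s e

theorem auxReceiver_nonneg (pA : U → S → stdSimplex ℝ A) (W : A → S → stdSimplex ℝ (B × E))
    (u s b) :
    0 ≤ auxReceiver pA W u s b :=
  Finset.sum_nonneg fun _ _ => mul_nonneg (stdSimplex.zero_le _ _) (receiverChannel_nonneg _ _ _ _)

theorem auxWarden_nonneg (pA : U → S → stdSimplex ℝ A) (W : A → S → stdSimplex ℝ (B × E)) (u s e) :
    0 ≤ auxWarden pA W u s e :=
  Finset.sum_nonneg fun _ _ => mul_nonneg (stdSimplex.zero_le _ _) (wardenChannel_nonneg _ _ _ _)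

theorem sum_auxReceiver (pA : U → S → stdSimplex ℝ A) (W : A → S → stdSimplex ℝ (B × E)) (u s) :
    ∑ b, auxReceiver pA W u s b = 1 := by
  simp only [auxReceiver]
  rw [Finset.sum_comm]
  simp only [← Finset.mul_sum, sum_receiverChannel, mul_one, stdSimplex.sum_eq_one]

theorem sum_auxWarden (pA : U → S → stdSimplex ℝ A) (W : A → S → stdSimplex ℝ (B × E)) (u s) :
    ∑ e, auxWarden pA W u s e = 1 := by
  simp only [auxWarden]
  rw [Finset.sum_comm]
  simp only [← Finset.mul_sum, sum_wardenChannel, mul_one, stdSimplex.sum_eq_one]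

variable {n : ℕ}

/-- The memoryless input law given the auxiliary and the state sequences. -/
def blockInput (pA : U → S → stdSimplex ℝ A) (u : Fin n → U) (s : Fin n → S) :
    stdSimplex ℝ (Fin n → A) := blockSimplex fun i => pA (u i) (s i)

theorem blockReceiver_blockInput (pA : U → S → stdSimplex ℝ A) (W : A → S → stdSimplex ℝ (B × E))
    (u : Fin n → U) (s : Fin n → S) (b : Fin n → B) :
    blockReceiver (blockInput pA) W u s b = ∏ i, auxReceiver pA W (u i) (s i) (b i) := by
  simp only [blockReceiver, auxReceiver, blockInput, blockSimplex_apply,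
    ← Finset.prod_mul_distrib]
  exact sum_pi_prod (fun i a => pA (u i) (s i) a * receiverChannel W a (s i) (b i))

theorem blockWarden_blockInput (pA : U → S → stdSimplex ℝ A) (W : A → S → stdSimplex ℝ (B × E))
    (u : Fin n → U) (s : Fin n → S) (e : Fin n → E) :
    blockWarden (blockInput pA) W u s e = ∏ i, auxWarden pA W (u i) (s i) (e i) := by
  simp only [blockWarden, auxWarden, blockInput, blockSimplex_apply,
    ← Finset.prod_mul_distrib]
  exact sum_pi_prod (fun i a => pA (u i) (s i) a * wardenChannel W a (s i) (e i))

theorem sum_sum_prod_block (w : S → U → ℝ) :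
    ∑ s : Fin n → S, ∑ u : Fin n → U, ∏ i, w (s i) (u i) = (∑ s, ∑ u, w s u) ^ n := by
  rw [← sum_arrow_prod (fun s u => ∏ i, w (s i) (u i)),
    sum_prod_pi n (fun z : S × U => w z.1 z.2), Fintype.sum_prod_type]

theorem sum_blockWarden_state (Q : stdSimplex ℝ S) (pU : S → stdSimplex ℝ U)
    (pA : U → S → stdSimplex ℝ A) (W : A → S → stdSimplex ℝ (B × E)) {Q₀ : E → ℝ}
    (hQ₀ : ∀ e, ∑ s, ∑ u, Q s * pU s u * auxWarden pA W u s e = Q₀ e) (e : Fin n → E) :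
    ∑ s : Fin n → S, ∑ u : Fin n → U, (∏ i, Q (s i)) * (∏ i, pU (s i) (u i)) *
      blockWarden (blockInput pA) W u s e = ∏ i, Q₀ (e i) := by
  simp only [blockWarden_blockInput, ← Finset.prod_mul_distrib]
  rw [← sum_arrow_prod (fun s u =>
      ∏ i, Q (s i) * pU (s i) (u i) * auxWarden pA W (u i) (s i) (e i)),
    sum_pi_prod (fun i (z : S × U) => Q z.1 * pU z.1 z.2 * auxWarden pA W z.2 z.1 (e i))]
  refine Finset.prod_congr rfl fun i _ => ?_
  rw [Fintype.sum_prod_type, hQ₀]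

end Blocks

/-! ### Tail probabilities and achievable binning rates -/

section Achievability

variable {S A B E : Type*} [Fintype S] [Fintype A] [Fintype B] [Fintype E]
  (Q : stdSimplex ℝ S) (φ₀ : stdSimplex ℝ A) (W : A → S → stdSimplex ℝ (B × E))

variable {Q φ₀ W} in
theorem achievable_of_bound {R RK : ℝ} (hR : 0 ≤ R) (hRK : 0 ≤ RK) {δ : ℕ → ℝ}
    (hδ : Tendsto δ atTop (𝓝 0))
    (hc : ∀ n, ∃ c : Code S A B n (numIndices n R) (numIndices n RK), c.errorProb Q W +
      2 * tvDist (c.wardenLaw Q W) (idealLaw (innocentOutput Q φ₀ W) n (numIndices n R)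
        (numIndices n RK)) ≤ δ n) : Achievable Q φ₀ W R RK := by
  choose c hc using hc
  refine ⟨hR, hRK, c, ?_, ?_⟩
  · refine squeeze_zero (fun n => errorProb_nonneg _ _ _) (fun n => ?_) hδ
    have := tvDist_nonneg ((c n).wardenLaw Q W) (idealLaw (innocentOutput Q φ₀ W) n
      (numIndices n R) (numIndices n RK))
    linarith [hc n]
  · refine squeeze_zero (fun n => tvDist_nonneg _ _) (fun n => ?_) hδ
    have := errorProb_nonneg (c n) Q W
    have := tvDist_nonneg ((c n).wardenLaw Q W) (idealLaw (innocentOutput Q φ₀ W) n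
      (numIndices n R) (numIndices n RK))
    linarith [hc n]

theorem tendsto_exp_nat_mul {a : ℝ} (ha : a < 0) :
    Tendsto (fun n : ℕ => exp (n * a)) atTop (𝓝 0) :=
  tendsto_exp_atBot.comp (tendsto_natCast_atTop_atTop.atTop_mul_const_of_neg ha)

/-- The product of an exponentially small factor with index counts of smaller total rate
vanishes. -/
theorem tendsto_sqrt_exp_mul {a b : ℝ} (hab : b < a) {N : ℕ → ℝ}
    (hN : ∀ n, N n ≤ exp (n * b)) :
    Tendsto (fun n : ℕ => √(exp (n * -a) * N n)) atTop (𝓝 0) := by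
  have h1 : Tendsto (fun n : ℕ => √(exp (n * (b - a)))) atTop (𝓝 0) := by
    simpa using (tendsto_exp_nat_mul (sub_neg.2 hab)).sqrt
  refine squeeze_zero (fun n => sqrt_nonneg _) (fun n => sqrt_le_sqrt ?_) h1
  calc exp (n * -a) * N n ≤ exp (n * -a) * exp (n * b) :=
        mul_le_mul_of_nonneg_left (hN n) (exp_nonneg _)
    _ = exp (n * (b - a)) := by rw [← exp_add]; congr 1; ring

theorem numIndices_mul_le (n : ℕ) (R R' : ℝ) :
    (numIndices n R : ℝ) * numIndices n R' ≤ exp (n * ((R + R') * log 2)) := by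
  calc (numIndices n R : ℝ) * numIndices n R' ≤
        exp (n * (R * log 2)) * exp (n * (R' * log 2)) :=
        mul_le_mul (numIndices_le n R) (numIndices_le n R') (by positivity) (exp_nonneg _)
    _ = _ := by rw [← exp_add]; congr 1; ring

section Typical

variable {U : Type*} [Fintype U] (pU : S → stdSimplex ℝ U) (pA : U → S → stdSimplex ℝ A)

open Classical in
/-- The probability that the conditional law of the auxiliary sequence given the state sequence
exceeds `exp (-n l)`. -/
def stateTail (l : ℝ) (n : ℕ) : ℝ :=
  ∑ s : Fin n → S, ∑ u : Fin n → U, (∏ i, Q (s i)) * (∏ i, pU (s i) (u i)) *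
    if (∏ i, Q (s i)) * (∏ i, pU (s i) (u i)) ≤ exp (n * -l) * ∏ i, Q (s i) then 0 else 1

open Classical in
/-- The probability that the conditional law of the auxiliary and state sequences given the
warden's output exceeds `exp (-n l)`. -/
def wardenTail (l : ℝ) (n : ℕ) : ℝ :=
  ∑ s : Fin n → S, ∑ u : Fin n → U, ∑ e : Fin n → E, (∏ i, Q (s i)) * (∏ i, pU (s i) (u i)) *
    blockWarden (blockInput pA) W u s e *
      if (∏ i, Q (s i)) * (∏ i, pU (s i) (u i)) * blockWarden (blockInput pA) W u s e ≤
        exp (n * -l) * ∏ i, innocentOutput Q φ₀ W (e i) then 0 else 1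

/-- The law of the state and the receiver's output. -/
def stateReceiver (s : S) (b : B) : ℝ := ∑ u, Q s * pU s u * auxReceiver pA W u s b

/-- The auxiliary sequences that are typical given the state sequence and the receiver's output. -/
def ReceiverTypical (l : ℝ) (n : ℕ) (u : Fin n → U) (s : Fin n → S) (b : Fin n → B) : Prop :=
  0 < ∏ i, stateReceiver Q W pU pA (s i) (b i) ∧
    exp (n * -l) * ∏ i, stateReceiver Q W pU pA (s i) (b i) ≤
      (∏ i, Q (s i)) * (∏ i, pU (s i) (u i)) * blockReceiver (blockInput pA) W u s b

open Classical in
/-- The probability that the auxiliary sequence is not typical for the receiver. -/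
def receiverTail (l : ℝ) (n : ℕ) : ℝ :=
  ∑ s : Fin n → S, ∑ u : Fin n → U, ∑ b : Fin n → B, (∏ i, Q (s i)) * (∏ i, pU (s i) (u i)) *
    blockReceiver (blockInput pA) W u s b *
      if ReceiverTypical Q W pU pA l n u s b then 0 else 1

variable {Q φ₀ W pU pA}

theorem sum_state_aux : ∑ s, ∑ u, Q s * pU s u = 1 := by
  simp only [← Finset.mul_sum, stdSimplex.sum_eq_one, mul_one]

theorem tendsto_stateTail {l : ℝ} (hl : ∑ s, ∑ u, Q s * pU s u * log (pU s u) < -l) :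
    Tendsto (stateTail Q pU l) atTop (𝓝 0) := by
  classical
  have key := tendsto_sum_prod_ite_two (p := fun s u => Q s * pU s u) (r := fun s u => pU s u)
    (fun s u => mul_nonneg (stdSimplex.zero_le _ _) (stdSimplex.zero_le _ _)) sum_state_aux
    (fun s u h => pos_of_mul_pos_right h (stdSimplex.zero_le _ _)) hl
    (T := fun n s u => (∏ i, Q (s i)) * (∏ i, pU (s i) (u i)) ≤ exp (n * -l) * ∏ i, Q (s i))
    (fun n s u hpos hT => by
      have hQ : 0 < ∏ i, Q (s i) := Finset.prod_pos fun i _ =>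
        pos_of_mul_pos_left (hpos i) (stdSimplex.zero_le _ _)
      rw [mul_comm (∏ i, Q (s i))] at hT
      push Not at hT
      exact (lt_of_mul_lt_mul_right hT hQ.le).le)
  simp only [Finset.prod_mul_distrib] at key
  exact key.congr fun n => rfl

theorem sum_auxReceiver_total : ∑ s, ∑ u, ∑ b, Q s * pU s u * auxReceiver pA W u s b = 1 := by
  simp only [← Finset.mul_sum, sum_auxReceiver, mul_one, stdSimplex.sum_eq_one]

theorem sum_auxWarden_total : ∑ s, ∑ u, ∑ e, Q s * pU s u * auxWarden pA W u s e = 1 := by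
  simp only [← Finset.mul_sum, sum_auxWarden, mul_one, stdSimplex.sum_eq_one]

theorem auxReceiver_joint_nonneg (s u b) : 0 ≤ Q s * pU s u * auxReceiver pA W u s b :=
  mul_nonneg (mul_nonneg (stdSimplex.zero_le _ _) (stdSimplex.zero_le _ _))
    (auxReceiver_nonneg _ _ _ _ _)

theorem auxWarden_joint_nonneg (s u e) : 0 ≤ Q s * pU s u * auxWarden pA W u s e :=
  mul_nonneg (mul_nonneg (stdSimplex.zero_le _ _) (stdSimplex.zero_le _ _))
    (auxWarden_nonneg _ _ _ _ _)

theorem tendsto_wardenTail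
    (hQ₀ : ∀ e, ∑ s, ∑ u, Q s * pU s u * auxWarden pA W u s e = innocentOutput Q φ₀ W e) {l : ℝ}
    (hl : ∑ s, ∑ u, ∑ e, Q s * pU s u * auxWarden pA W u s e *
      log (Q s * pU s u * auxWarden pA W u s e / innocentOutput Q φ₀ W e) < -l) :
    Tendsto (wardenTail Q φ₀ W pU pA l) atTop (𝓝 0) := by
  classical
  have hle : ∀ s u e, Q s * pU s u * auxWarden pA W u s e ≤ innocentOutput Q φ₀ W e := by
    intro s u e
    rw [← hQ₀ e]
    exact (Finset.single_le_sum (f := fun u => Q s * pU s u * auxWarden pA W u s e)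
      (fun u _ => auxWarden_joint_nonneg s u e) (Finset.mem_univ u)).trans
      (Finset.single_le_sum (f := fun s => ∑ u, Q s * pU s u * auxWarden pA W u s e)
        (fun s _ => Finset.sum_nonneg fun u _ => auxWarden_joint_nonneg s u e) (Finset.mem_univ s))
  have key := tendsto_sum_prod_ite (p := fun s u e => Q s * pU s u * auxWarden pA W u s e)
    (r := fun s u e => Q s * pU s u * auxWarden pA W u s e / innocentOutput Q φ₀ W e)
    auxWarden_joint_nonneg sum_auxWarden_total
    (fun s u e h => div_pos h (h.trans_le (hle s u e))) hl
    (T := fun n s u e => (∏ i, Q (s i)) * (∏ i, pU (s i) (u i)) *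
      (∏ i, auxWarden pA W (u i) (s i) (e i)) ≤
        exp (n * -l) * ∏ i, innocentOutput Q φ₀ W (e i))
    (fun n s u e hpos hT => by
      have hQ : 0 < ∏ i, innocentOutput Q φ₀ W (e i) := Finset.prod_pos fun i _ =>
        (hpos i).trans_le (hle _ _ _)
      push Not at hT
      rw [Finset.prod_div_distrib, le_div_iff₀ hQ, Finset.prod_mul_distrib,
        Finset.prod_mul_distrib]
      exact hT.le)
  simp only [Finset.prod_mul_distrib] at key
  refine key.congr fun n => ?_
  simp only [wardenTail, blockWarden_blockInput]

theorem tendsto_receiverTail {l : ℝ}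
    (hl : ∑ s, ∑ u, ∑ b, Q s * pU s u * auxReceiver pA W u s b *
      log (stateReceiver Q W pU pA s b / (Q s * pU s u * auxReceiver pA W u s b)) < l) :
    Tendsto (receiverTail Q W pU pA l) atTop (𝓝 0) := by
  classical
  have hle : ∀ s u b, Q s * pU s u * auxReceiver pA W u s b ≤ stateReceiver Q W pU pA s b :=
    fun s u b => Finset.single_le_sum (f := fun u => Q s * pU s u * auxReceiver pA W u s b)
      (fun u _ => auxReceiver_joint_nonneg s u b) (Finset.mem_univ u)
  have key := tendsto_sum_prod_ite (p := fun s u b => Q s * pU s u * auxReceiver pA W u s b)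
    (r := fun s u b => stateReceiver Q W pU pA s b / (Q s * pU s u * auxReceiver pA W u s b))
    auxReceiver_joint_nonneg sum_auxReceiver_total
    (fun s u b h => div_pos (h.trans_le (hle s u b)) h) hl
    (T := fun n s u b => ReceiverTypical Q W pU pA l n u s b)
    (fun n s u b hpos hT => by
      have hQ : 0 < ∏ i, stateReceiver Q W pU pA (s i) (b i) := Finset.prod_pos fun i _ =>
        (hpos i).trans_le (hle _ _ _)
      have hT : ¬ (exp (n * -l) * ∏ i, stateReceiver Q W pU pA (s i) (b i) ≤
        (∏ i, Q (s i)) * (∏ i, pU (s i) (u i)) * blockReceiver (blockInput pA) W u s b) :=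
        fun h => hT ⟨hQ, h⟩
      push Not at hT
      rw [Finset.prod_div_distrib, le_div_iff₀ (Finset.prod_pos fun i _ => hpos i),
        Finset.prod_mul_distrib, Finset.prod_mul_distrib, ← blockReceiver_blockInput]
      have h1 : exp (n * l) * exp (n * -l) = 1 := by rw [← exp_add]; simp
      calc exp (n * l) * ((∏ i, Q (s i)) * (∏ i, pU (s i) (u i)) *
            blockReceiver (blockInput pA) W u s b) ≤ exp (n * l) * (exp (n * -l) *
            ∏ i, stateReceiver Q W pU pA (s i) (b i)) :=
            mul_le_mul_of_nonneg_left hT.le (exp_nonneg _)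
        _ = _ := by rw [← mul_assoc, h1, one_mul])
  simp only [Finset.prod_mul_distrib] at key
  refine key.congr fun n => ?_
  simp only [receiverTail, blockReceiver_blockInput]

open Classical in
-- Every typical sequence carries at least a fraction `exp (-n l)` of the total weight of `(s, b)`.
-- If that weight is zero, no sequence is typical, thanks to the positivity clause in the
-- definition.
theorem sum_receiverTypical_le (l : ℝ) (n : ℕ) (s : Fin n → S) (b : Fin n → B) :
    ∑ u, (if ReceiverTypical Q W pU pA l n u s b then (1 : ℝ) else 0) ≤ exp (n * l) := by
  set g := ∏ i, stateReceiver Q W pU pA (s i) (b i) with hg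
  by_cases hpos : 0 < g
  · have hsum : ∑ u : Fin n → U, (∏ i, Q (s i)) * (∏ i, pU (s i) (u i)) *
        blockReceiver (blockInput pA) W u s b = g := by
      simp only [blockReceiver_blockInput, ← Finset.prod_mul_distrib]
      rw [sum_pi_prod (fun i u => Q (s i) * pU (s i) u * auxReceiver pA W u (s i) (b i))]
      rfl
    have h1 : (∑ u, (if ReceiverTypical Q W pU pA l n u s b then (1 : ℝ) else 0)) *
        (exp (n * -l) * g) ≤ g := by
      conv_rhs => rw [← hsum]
      rw [Finset.sum_mul]
      refine Finset.sum_le_sum fun u _ => ?_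
      split_ifs with h
      · rw [one_mul]; exact h.2
      · rw [zero_mul]
        exact mul_nonneg (mul_nonneg (Finset.prod_nonneg fun _ _ => stdSimplex.zero_le _ _)
          (Finset.prod_nonneg fun _ _ => stdSimplex.zero_le _ _)) (blockReceiver_nonneg _ _ _ _ _)
    rw [← mul_assoc] at h1
    have h2 := le_of_mul_le_mul_right (h1.trans_eq (one_mul g).symm) hpos
    have h3 := mul_le_mul_of_nonneg_right h2 (exp_nonneg (n * l))
    rwa [mul_assoc, ← exp_add, one_mul, mul_neg, neg_add_cancel, exp_zero, mul_one] at h3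
  · have : ∀ u, ¬ ReceiverTypical Q W pU pA l n u s b := fun u h => hpos h.1
    simp only [this, if_false, Finset.sum_const_zero]
    exact exp_nonneg _

/-- The three gaps are added before averaging over the random binning, so a single binning is good
for all of them. -/
theorem exists_code_le_tails [Nonempty U]
    (hQ₀ : ∀ e, ∑ s, ∑ u, Q s * pU s u * auxWarden pA W u s e = innocentOutput Q φ₀ W e)
    {n μ κ φ : ℕ} (hμ : 0 < μ) (hκ : 0 < κ) (hφ : 0 < φ) (l₁ l₂ l₃ : ℝ) :
    ∃ c : Code S A B n μ κ, c.errorProb Q W +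
        2 * tvDist (c.wardenLaw Q W) (idealLaw (innocentOutput Q φ₀ W) n μ κ) ≤
      2 * (2 * stateTail Q pU l₁ n + √(exp (n * -l₁) * (μ * φ))) +
        (receiverTail Q W pU pA l₂ n + exp (n * l₂) / φ) +
        (2 * wardenTail Q φ₀ W pU pA l₃ n + √(exp (n * -l₃) * (μ * (κ * φ)))) := by
  have : NeZero μ := ⟨hμ.ne'⟩
  have : NeZero κ := ⟨hκ.ne'⟩
  have : NeZero φ := ⟨hφ.ne'⟩
  have hq : ∀ s : Fin n → S, 0 ≤ ∏ i, Q (s i) := fun s =>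
    Finset.prod_nonneg fun _ _ => stdSimplex.zero_le _ _
  have hPU : ∀ (s : Fin n → S) (u : Fin n → U), 0 ≤ ∏ i, pU (s i) (u i) := fun s u =>
    Finset.prod_nonneg fun _ _ => stdSimplex.zero_le _ _
  have hsum : ∑ s : Fin n → S, ∑ u : Fin n → U, ∑ b : Fin n → B, (∏ i, Q (s i)) *
      (∏ i, pU (s i) (u i)) * blockReceiver (blockInput pA) W u s b = 1 := by
    simp only [← Finset.mul_sum, sum_blockReceiver, mul_one]
    simp only [Finset.mul_sum, ← Finset.prod_mul_distrib]
    rw [sum_sum_prod_block (fun s u => Q s * pU s u), sum_state_aux, one_pow]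
  have hM := sum_receiverTypical_le (Q := Q) (W := W) (pU := pU) (pA := pA) l₂ n
  have hV := blockReceiver_nonneg (n := n) (blockInput pA) W
  have hproj := mean_ite_public (μ := μ) (κ := κ) (φ := φ)
  obtain ⟨est, hest⟩ := @exists_estimator (Fin n → S) (Fin n → U) (Fin n → B) _ _ _ μ κ φ _
    (fun s : Fin n → S => ∏ i, Q (s i)) hq (fun s u => ∏ i, pU (s i) (u i)) hPU
    (blockReceiver (blockInput pA) W) hV hsum hμ hκ hφ
    (fun u s b => ReceiverTypical Q W pU pA l₂ n u s b) (exp (n * l₂)) hM hproj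
  have h1 := avg_stateGap_le (μ := μ) (κ := κ) (φ := φ)
    (q := fun s : Fin n → S => ∏ i, Q (s i)) hq
    (by rw [sum_prod_pi, stdSimplex.sum_eq_one, one_pow])
    (PU := fun s (u : Fin n → U) => ∏ i, pU (s i) (u i)) hPU
    (fun s => by
      rw [sum_pi_prod (fun i u => pU (s i) u)]
      simp [stdSimplex.sum_eq_one]) (exp_nonneg (n * -l₁))
  have hVE := blockWarden_nonneg (n := n) (blockInput pA) W
  have hQ := sum_blockWarden_state (n := n) Q pU pA W hQ₀
  have hQ1 : ∑ e : Fin n → E, ∏ i, innocentOutput Q φ₀ W (e i) = 1 := by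
    rw [sum_prod_pi, sum_innocentOutput, one_pow]
  have h3 := @avg_wardenGap_le (Fin n → S) (Fin n → U) (Fin n → E) _ _ _ μ κ φ _ _ _
    (fun s : Fin n → S => ∏ i, Q (s i)) hq (fun s u => ∏ i, pU (s i) (u i)) hPU
    (blockWarden (blockInput pA) W) hVE (fun e => ∏ i, innocentOutput Q φ₀ W (e i)) hQ hQ1
    (exp (n * -l₃)) (exp_nonneg (n * -l₃))
  obtain ⟨h, hh⟩ := exists_le_avg (fun h : (Fin n → U) × (Fin n → S) → Fin μ × Fin κ × Fin φ =>
    2 * stateGap (fun s => ∏ i, Q (s i)) (fun s u => ∏ i, pU (s i) (u i)) h +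
      estErr (fun s => ∏ i, Q (s i)) (fun s u => ∏ i, pU (s i) (u i))
        (blockReceiver (blockInput pA) W) h (est h) +
      wardenGap (fun s => ∏ i, Q (s i)) (fun s u => ∏ i, pU (s i) (u i))
        (blockWarden (blockInput pA) W) (fun e => ∏ i, innocentOutput Q φ₀ W (e i)) h)
  obtain ⟨c, hc⟩ := exists_code_of_binning (blockInput pA) Q W (φ₀ := φ₀)
    (fun s => blockSimplex fun i => pU (s i)) hφ h (est h)
  simp only [blockSimplex_apply] at hc
  rw [avg_add, avg_add, avg_const_mul] at hh
  refine ⟨c, hc.trans (hh.trans ?_)⟩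
  have h1' := mul_le_mul_of_nonneg_left h1 (show (0 : ℝ) ≤ 2 by norm_num)
  exact add_le_add (add_le_add h1' hest) h3

/-- The rates of random binning with a public index of rate `RF`. -/
theorem achievable_of_binning_rates [Nonempty U]
    (hQ₀ : ∀ e, ∑ s, ∑ u, Q s * pU s u * auxWarden pA W u s e = innocentOutput Q φ₀ W e)
    {R RK RF l₁ l₂ l₃ : ℝ} (hR : 0 ≤ R) (hRK : 0 ≤ RK) (hRF : 0 ≤ RF)
    (h₁ : ∑ s, ∑ u, Q s * pU s u * log (pU s u) < -l₁)
    (h₂ : ∑ s, ∑ u, ∑ b, Q s * pU s u * auxReceiver pA W u s b *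
      log (stateReceiver Q W pU pA s b / (Q s * pU s u * auxReceiver pA W u s b)) < l₂)
    (h₃ : ∑ s, ∑ u, ∑ e, Q s * pU s u * auxWarden pA W u s e *
      log (Q s * pU s u * auxWarden pA W u s e / innocentOutput Q φ₀ W e) < -l₃)
    (hr₁ : (R + RF) * log 2 < l₁) (hr₂ : l₂ < RF * log 2)
    (hr₃ : (R + (RK + RF)) * log 2 < l₃) : Achievable Q φ₀ W R RK := by
  have t₁ := tendsto_stateTail h₁
  have t₂ := tendsto_receiverTail h₂
  have t₃ := tendsto_wardenTail hQ₀ h₃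
  have r₁ := tendsto_sqrt_exp_mul hr₁ (fun n => numIndices_mul_le n R RF)
  -- The only place where the number of public indices must be bounded from below; rounding costs
  -- the factor `2`.
  have r₂ : Tendsto (fun n : ℕ => exp (n * l₂) / numIndices n RF) atTop (𝓝 0) := by
    have := (tendsto_exp_nat_mul (sub_neg.2 hr₂)).const_mul 2
    rw [mul_zero] at this
    refine squeeze_zero (fun n => by positivity) (fun n => ?_) this
    have hpos : (0 : ℝ) < numIndices n RF := by exact_mod_cast numIndices_pos n hRF
    rw [div_le_iff₀ hpos]
    have h := mul_le_mul_of_nonneg_left (exp_le_two_mul_numIndices n hRF)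
      (exp_nonneg (n * (l₂ - RF * log 2)))
    rw [← exp_add] at h
    refine (le_of_eq ?_).trans (h.trans_eq (by ring))
    congr 1
    ring
  have r₃ := tendsto_sqrt_exp_mul hr₃ (N := fun n => numIndices n R *
    ((numIndices n RK : ℝ) * numIndices n RF)) (fun n => by
      calc (numIndices n R : ℝ) * ((numIndices n RK : ℝ) * numIndices n RF) ≤
            exp (n * (R * log 2)) * exp (n * ((RK + RF) * log 2)) :=
            mul_le_mul (numIndices_le n R) (numIndices_mul_le n RK RF) (by positivity)
              (exp_nonneg _)
        _ = _ := by rw [← exp_add]; congr 1; ring)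
  refine achievable_of_bound hR hRK ?_ fun n => exists_code_le_tails hQ₀ (numIndices_pos n hR)
    (numIndices_pos n hRK) (numIndices_pos n hRF) l₁ l₂ l₃
  have := ((((t₁.const_mul 2).add r₁).const_mul 2).add (t₂.add r₂)).add ((t₃.const_mul 2).add r₃)
  simpa using this

theorem numIndices_zero (n : ℕ) : numIndices n 0 = 1 := by simp [numIndices]

end Typical

end Achievability

/-! ### From entropies to achievable pairs -/

section SingleLetter

variable {S A B E U : Type*} [Fintype S] [Fintype A] [Fintype B] [Fintype E] [Fintype U]
  {Q : stdSimplex ℝ S} {φ₀ : stdSimplex ℝ A} {W : A → S → stdSimplex ℝ (B × E)}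
  {pU : S → stdSimplex ℝ U} {pA : U → S → stdSimplex ℝ A}

theorem law_jointLaw_rvU_rvS (u : U) (s : S) :
    law (jointLaw Q pU pA W) (fun ω => (rvU ω, rvS ω)) (u, s) = Q s * pU s u := by
  rw [law_rvU_rvS (ρ := fun u x => Q x.1 * pU x.1 u * pA u x.1 x.2) (W := W)
    fun _ _ _ _ _ => rfl]
  simp only [← Finset.mul_sum, stdSimplex.sum_eq_one, mul_one]

theorem law_jointLaw_rvS (s : S) : law (jointLaw Q pU pA W) rvS s = Q s := by
  rw [← law_snd (jointLaw Q pU pA W) rvU rvS s]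
  simp only [law_jointLaw_rvU_rvS, ← Finset.mul_sum, stdSimplex.sum_eq_one, mul_one]

theorem law_jointLaw_rvU_rvB_rvS (u : U) (b : B) (s : S) :
    law (jointLaw Q pU pA W) (fun ω => (rvU ω, rvB ω, rvS ω)) (u, b, s) =
      Q s * pU s u * auxReceiver pA W u s b := by
  rw [law_rvU_rvB_rvS (ρ := fun u x => Q x.1 * pU x.1 u * pA u x.1 x.2) (W := W)
    fun _ _ _ _ _ => rfl]
  simp only [auxReceiver, Finset.mul_sum, mul_assoc]

theorem law_jointLaw_rvB_rvS (b : B) (s : S) :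
    law (jointLaw Q pU pA W) (fun ω => (rvB ω, rvS ω)) (b, s) = stateReceiver Q W pU pA s b := by
  rw [← law_snd (jointLaw Q pU pA W) rvU (fun ω => (rvB ω, rvS ω))]
  simp only [law_jointLaw_rvU_rvB_rvS, stateReceiver]

theorem law_jointLaw_rvU_rvE_rvS (u : U) (e : E) (s : S) :
    law (jointLaw Q pU pA W) (fun ω => (rvU ω, rvE ω, rvS ω)) (u, e, s) =
      Q s * pU s u * auxWarden pA W u s e := by
  rw [law_rvU_rvE_rvS (ρ := fun u x => Q x.1 * pU x.1 u * pA u x.1 x.2) (W := W)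
    fun _ _ _ _ _ => rfl]
  simp only [auxWarden, Finset.mul_sum, mul_assoc]

theorem law_jointLaw_rvE_rvS (e : E) (s : S) :
    law (jointLaw Q pU pA W) (fun ω => (rvE ω, rvS ω)) (e, s) =
      ∑ u, Q s * pU s u * auxWarden pA W u s e := by
  rw [← law_snd (jointLaw Q pU pA W) rvU (fun ω => (rvE ω, rvS ω))]
  simp only [law_jointLaw_rvU_rvE_rvS]

theorem law_jointLaw_rvE (e : E) : law (jointLaw Q pU pA W) rvE e =
    ∑ s, ∑ u, Q s * pU s u * auxWarden pA W u s e := by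
  rw [← law_fst (jointLaw Q pU pA W) rvE rvS]
  simp only [law_jointLaw_rvE_rvS]

theorem logb_two_mul_log_two (x : ℝ) : logb 2 x * log 2 = log x :=
  div_mul_cancel₀ _ (log_pos one_lt_two).ne'

theorem sum_mul_log_aux : ∑ s, ∑ u, Q s * pU s u * log (pU s u) =
    -(condEntropy (jointLaw Q pU pA W) rvU rvS * log 2) := by
  rw [condEntropy, neg_mul, neg_neg, Finset.sum_mul, Finset.sum_comm]
  refine Finset.sum_congr rfl fun u _ => ?_
  rw [Finset.sum_mul]
  refine Finset.sum_congr rfl fun s _ => ?_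
  rw [mul_assoc (law _ _ _), logb_two_mul_log_two, law_jointLaw_rvU_rvS, law_jointLaw_rvS]
  by_cases h : Q s = 0
  · simp [h]
  · rw [mul_div_cancel_left₀ _ h]

theorem sum_mul_log_receiver : ∑ s, ∑ u, ∑ b, Q s * pU s u * auxReceiver pA W u s b *
      log (stateReceiver Q W pU pA s b / (Q s * pU s u * auxReceiver pA W u s b)) =
    condEntropy (jointLaw Q pU pA W) rvU (fun ω => (rvB ω, rvS ω)) * log 2 := by
  rw [condEntropy, Finset.sum_comm, neg_mul, Finset.sum_mul, ← Finset.sum_neg_distrib]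
  refine Finset.sum_congr rfl fun u _ => ?_
  rw [Fintype.sum_prod_type, Finset.sum_comm, Finset.sum_mul, ← Finset.sum_neg_distrib]
  refine Finset.sum_congr rfl fun b _ => ?_
  rw [Finset.sum_mul, ← Finset.sum_neg_distrib]
  refine Finset.sum_congr rfl fun s _ => ?_
  rw [mul_assoc (law _ _ _), logb_two_mul_log_two, law_jointLaw_rvU_rvB_rvS, law_jointLaw_rvB_rvS,
    ← inv_div, log_inv, mul_neg]

theorem sum_mul_log_div {α β : Type*} [Fintype α] [Fintype β] {p : α → β → ℝ} {q : β → ℝ}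
    (hp : ∀ a b, 0 ≤ p a b) (hq : ∀ b, ∑ a, p a b = q b) :
    ∑ a, ∑ b, p a b * log (p a b / q b) =
      ent q - ∑ a, ∑ b, negMulLog (p a b) := by
  have : ∀ a b, p a b * log (p a b / q b) = -negMulLog (p a b) - p a b * log (q b) := by
    intro a b
    rcases (hp a b).eq_or_lt with h | h
    · simp [← h]
    · have : 0 < q b := by
        rw [← hq b]
        exact h.trans_le (Finset.single_le_sum (f := fun a => p a b) (fun a _ => hp a b)
          (Finset.mem_univ a))
      rw [log_div h.ne' this.ne', negMulLog]
      ring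
  simp only [this, Finset.sum_sub_distrib, Finset.sum_neg_distrib]
  rw [Finset.sum_comm (f := fun a b => p a b * log (q b))]
  simp only [← Finset.sum_mul, hq, ent, negMulLog, neg_mul, Finset.sum_neg_distrib]
  ring

/-- The left side is `-H(U,S|E)` in nats, split by the chain rule. -/
theorem sum_mul_log_warden (hQ₀ : law (jointLaw Q pU pA W) rvE = innocentOutput Q φ₀ W) :
    ∑ s, ∑ u, ∑ e, Q s * pU s u * auxWarden pA W u s e *
      log (Q s * pU s u * auxWarden pA W u s e / innocentOutput Q φ₀ W e) =
    -((condEntropy (jointLaw Q pU pA W) rvU (fun ω => (rvE ω, rvS ω)) +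
      condEntropy (jointLaw Q pU pA W) rvS rvE) * log 2) := by
  have hP := jointLaw_nonneg Q pU pA W
  have key := sum_mul_log_div (p := fun (z : S × U) e => Q z.1 * pU z.1 z.2 *
    auxWarden pA W z.2 z.1 e) (q := innocentOutput Q φ₀ W)
    (fun z e => auxWarden_joint_nonneg _ _ _)
    (fun e => by rw [Fintype.sum_prod_type, ← law_jointLaw_rvE, hQ₀])
  simp only [Fintype.sum_prod_type] at key
  rw [key, add_mul, condEntropy_mul_log hP, condEntropy_mul_log hP,
    ent_law_congr hP (X := fun ω => (rvS ω, rvE ω)) (Y := fun ω => (rvE ω, rvS ω)) Prod.swap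
      Prod.swap (fun _ => rfl) (fun _ => rfl), hQ₀]
  have : ent (law (jointLaw Q pU pA W) fun ω => (rvU ω, rvE ω, rvS ω)) =
      ∑ s, ∑ u, ∑ e, negMulLog (Q s * pU s u * auxWarden pA W u s e) := by
    simp only [ent, Fintype.sum_prod_type, law_jointLaw_rvU_rvE_rvS]
    rw [Finset.sum_comm_cycle]
  rw [this]
  ring

theorem sum_mul_log_warden_state (hQ₀ : law (jointLaw Q pU pA W) rvE = innocentOutput Q φ₀ W) :
    ∑ s, ∑ e, (∑ u, Q s * pU s u * auxWarden pA W u s e) *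
      log ((∑ u, Q s * pU s u * auxWarden pA W u s e) / innocentOutput Q φ₀ W e) =
    -(condEntropy (jointLaw Q pU pA W) rvS rvE * log 2) := by
  have hP := jointLaw_nonneg Q pU pA W
  rw [sum_mul_log_div (p := fun s e => ∑ u, Q s * pU s u * auxWarden pA W u s e)
    (fun s e => Finset.sum_nonneg fun u _ => auxWarden_joint_nonneg _ _ _)
    (fun e => by rw [← law_jointLaw_rvE, hQ₀]), condEntropy_mul_log hP,
    ent_law_congr hP (Y := fun ω => (rvS ω, rvE ω)) (X := fun ω => (rvE ω, rvS ω)) Prod.swap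
      Prod.swap (fun _ => rfl) (fun _ => rfl), hQ₀]
  simp only [ent, Fintype.sum_prod_type, law_jointLaw_rvE_rvS]
  rw [Finset.sum_comm (s := (Finset.univ : Finset E))]
  ring

theorem condEntropy_nonneg {Ω α β : Type*} [Fintype Ω] [Fintype α] [Fintype β] {p : Ω → ℝ}
    (hp : ∀ ω, 0 ≤ p ω) (X : Ω → α) (Y : Ω → β) : 0 ≤ condEntropy p X Y := by
  have h := ent_law_comp_le hp (fun ω => (X ω, Y ω)) Prod.snd
  have := condEntropy_mul_log hp X Y
  refine nonneg_of_mul_nonneg_left ?_ (log_pos one_lt_two)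
  rw [this]
  exact sub_nonneg.2 h

theorem condMutualInfo_nonneg {Ω α β γ : Type*} [Fintype Ω] [Fintype α] [Fintype β] [Fintype γ]
    {p : Ω → ℝ} (hp : ∀ ω, 0 ≤ p ω) (X : Ω → α) (Y : Ω → β) (Z : Ω → γ) :
    0 ≤ condMutualInfo p X Y Z := by
  have h := ent_submodular hp X Y Z
  refine nonneg_of_mul_nonneg_left ?_ (log_pos one_lt_two)
  rw [condMutualInfo, sub_mul, condEntropy_mul_log hp, condEntropy_mul_log hp]
  linarith

/-- Elimination of the public rate: it must exceed `H(U|B,S)`, and the two hashing constraints then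
leave the stated bounds. -/
theorem achievable_of_lt [Nonempty U]
    (hQ₀ : law (jointLaw Q pU pA W) rvE = innocentOutput Q φ₀ W) {R RK : ℝ} (hR : 0 ≤ R)
    (hRK : 0 ≤ RK) (h₁ : R < condMutualInfo (jointLaw Q pU pA W) rvU rvB rvS)
    (h₂ : R + RK < condMutualInfo (jointLaw Q pU pA W) rvU rvB rvS -
      condMutualInfo (jointLaw Q pU pA W) rvU rvE rvS + condEntropy (jointLaw Q pU pA W) rvS rvE) :
    Achievable Q φ₀ W R RK := by
  have hl : 0 < log 2 := log_pos one_lt_two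
  have hH := condEntropy_nonneg (jointLaw_nonneg Q pU pA W) rvU (fun ω => (rvB ω, rvS ω))
  rw [condMutualInfo] at h₁
  rw [condMutualInfo, condMutualInfo] at h₂
  have hs₁ := sum_mul_log_aux (Q := Q) (pU := pU) (pA := pA) (W := W)
  have hs₂ := sum_mul_log_receiver (Q := Q) (pU := pU) (pA := pA) (W := W)
  have hs₃ := sum_mul_log_warden hQ₀
  set H₁ := condEntropy (jointLaw Q pU pA W) rvU rvS
  set H₂ := condEntropy (jointLaw Q pU pA W) rvU (fun ω => (rvB ω, rvS ω))
  set H₃ := condEntropy (jointLaw Q pU pA W) rvU (fun ω => (rvE ω, rvS ω))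
  set H₄ := condEntropy (jointLaw Q pU pA W) rvS rvE
  obtain ⟨δ, hδ, hδ₁, hδ₂⟩ : ∃ δ > 0, R + (H₂ + 2 * δ) < H₁ - δ ∧
      R + (RK + (H₂ + 2 * δ)) < H₃ + H₄ - δ := by
    -- Three multiples of `δ` must fit strictly into the smaller slack: two in the public rate, one
    -- in each hashing threshold.
    refine ⟨min (H₁ - H₂ - R) (H₃ + H₄ - H₂ - R - RK) / 4, ?_, ?_, ?_⟩
    · exact div_pos (lt_min (by linarith) (by linarith)) (by norm_num)
    · have := min_le_left (H₁ - H₂ - R) (H₃ + H₄ - H₂ - R - RK)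
      linarith
    · have := min_le_right (H₁ - H₂ - R) (H₃ + H₄ - H₂ - R - RK)
      linarith
  refine achievable_of_binning_rates (pU := pU) (RF := H₂ + 2 * δ) (l₁ := (H₁ - δ) * log 2)
    (l₂ := (H₂ + δ) * log 2) (l₃ := (H₃ + H₄ - δ) * log 2) (pA := pA) (fun e => ?_) hR hRK
    (by linarith) ?_ ?_ ?_ ?_ ?_ ?_
  · rw [← law_jointLaw_rvE, hQ₀]
  · rw [hs₁]
    nlinarith
  · rw [hs₂]
    nlinarith
  · rw [hs₃]
    nlinarith
  · exact mul_lt_mul_of_pos_right hδ₁ hl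
  · nlinarith
  · exact mul_lt_mul_of_pos_right hδ₂ hl

theorem nonempty_aux (Q : stdSimplex ℝ S) (pU : S → stdSimplex ℝ U) : Nonempty U := by
  have hS : Nonempty S := by
    by_contra h
    rw [not_nonempty_iff] at h
    simpa using stdSimplex.sum_eq_one Q
  obtain ⟨s⟩ := hS
  by_contra h
  rw [not_nonempty_iff] at h
  simpa using stdSimplex.sum_eq_one (pU s)

theorem stateGap_eq_zero {𝒮 𝒰 : Type*} [Fintype 𝒮] [Fintype 𝒰] {κ : ℕ} {q : 𝒮 → ℝ}
    {PU : 𝒮 → 𝒰 → ℝ} (hPU : ∀ s, ∑ u, PU s u = 1) (h : 𝒰 × 𝒮 → Fin 1 × Fin κ × Fin 1) :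
    stateGap q PU h = 0 := by
  have : ∀ f m s u, binInd h f m s u = 1 := fun f m s u => if_pos (Subsingleton.elim _ _)
  simp [stateGap, this, hPU]

theorem wardenGap_eq_zero {𝒮 𝒰 ℰ : Type*} [Fintype 𝒮] [Fintype 𝒰] [Fintype ℰ] {q : 𝒮 → ℝ}
    {PU : 𝒮 → 𝒰 → ℝ} {VE : 𝒰 → 𝒮 → ℰ → ℝ} {Q₀ : ℰ → ℝ}
    (hQ₀ : ∀ e, ∑ s, ∑ u, q s * PU s u * VE u s e = Q₀ e)
    (h : 𝒰 × 𝒮 → Fin 1 × Fin 1 × Fin 1) : wardenGap q PU VE Q₀ h = 0 := by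
  have h1 : ∀ f m s u, binInd h f m s u = 1 := fun f m s u => if_pos (Subsingleton.elim _ _)
  have h2 : ∀ k s u, keyInd h k s u = 1 := fun k s u => if_pos (Subsingleton.elim _ _)
  simp [wardenGap, h1, h2, hQ₀]

/-- Without a message and with a trivial auxiliary variable the key is recovered without error. -/
theorem exists_code_of_key [Unique U] {n κ : ℕ}
    (h : (Fin n → U) × (Fin n → S) → Fin 1 × Fin κ × Fin 1) :
    ∃ c : Code S A B n 1 κ, c.errorProb Q W +
        2 * tvDist (c.wardenLaw Q W) (idealLaw (innocentOutput Q φ₀ W) n 1 κ) ≤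
      wardenGap (fun s => ∏ i, Q (s i)) (fun s u => ∏ i, pU (s i) (u i))
        (blockWarden (blockInput pA) W) (fun e => ∏ i, innocentOutput Q φ₀ W (e i)) h := by
  obtain ⟨c, hc⟩ := exists_code_of_binning (blockInput pA) Q W (φ₀ := φ₀)
    (fun s => blockSimplex fun i => pU (s i)) one_pos h (fun _ _ _ => default)
  rw [stateGap_eq_zero (fun s => stdSimplex.sum_eq_one _)] at hc
  have h0 : estErr (fun s : Fin n → S => ∏ i, Q (s i))
      (fun s u => blockSimplex (fun i => pU (s i)) u) (blockReceiver (blockInput pA) W) h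
      (fun _ _ _ => default) = 0 := by
    simp [estErr, eq_iff_true_of_subsingleton]
  rw [h0, mul_zero, zero_add, zero_add] at hc
  exact ⟨c, hc⟩

theorem achievable_key_of_unique [Unique U]
    (hQ₀ : ∀ e, ∑ s, ∑ u, Q s * pU s u * auxWarden pA W u s e = innocentOutput Q φ₀ W e)
    {RK l : ℝ} (hRK : 0 ≤ RK)
    (hl : ∑ s, ∑ u, ∑ e, Q s * pU s u * auxWarden pA W u s e *
      log (Q s * pU s u * auxWarden pA W u s e / innocentOutput Q φ₀ W e) < -l)
    (hr : RK * log 2 < l) : Achievable Q φ₀ W 0 RK := by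
  have t := tendsto_wardenTail hQ₀ hl
  have r := tendsto_sqrt_exp_mul hr (N := fun n => numIndices n RK)
    (fun n => numIndices_le n RK)
  have ht := (t.const_mul 2).add r
  rw [mul_zero, zero_add] at ht
  refine achievable_of_bound le_rfl hRK ht fun n => ?_
  rw [numIndices_zero]
  have hκ : NeZero (numIndices n RK) := ⟨(numIndices_pos n hRK).ne'⟩
  have hq : ∀ s : Fin n → S, 0 ≤ ∏ i, Q (s i) := fun s =>
    Finset.prod_nonneg fun _ _ => stdSimplex.zero_le _ _
  have hPU : ∀ (s : Fin n → S) (u : Fin n → U), 0 ≤ ∏ i, pU (s i) (u i) := fun s u =>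
    Finset.prod_nonneg fun _ _ => stdSimplex.zero_le _ _
  have hVE := blockWarden_nonneg (n := n) (blockInput pA) W
  have hQ := sum_blockWarden_state (n := n) Q pU pA W hQ₀
  have hQ1 : ∑ e : Fin n → E, ∏ i, innocentOutput Q φ₀ W (e i) = 1 := by
    rw [sum_prod_pi, sum_innocentOutput, one_pow]
  have h3 := @avg_wardenGap_le (Fin n → S) (Fin n → U) (Fin n → E) _ _ _ 1 (numIndices n RK) 1
    _ _ _ (fun s : Fin n → S => ∏ i, Q (s i)) hq (fun s u => ∏ i, pU (s i) (u i)) hPU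
    (blockWarden (blockInput pA) W) hVE (fun e => ∏ i, innocentOutput Q φ₀ W (e i)) hQ hQ1
    (exp (n * -l)) (exp_nonneg (n * -l))
  rw [Nat.cast_one, one_mul, mul_one] at h3
  obtain ⟨h, hh⟩ := exists_le_avg
    (fun h : (Fin n → U) × (Fin n → S) → Fin 1 × Fin (numIndices n RK) × Fin 1 =>
    wardenGap (fun s => ∏ i, Q (s i)) (fun s u => ∏ i, pU (s i) (u i))
        (blockWarden (blockInput pA) W) (fun e => ∏ i, innocentOutput Q φ₀ W (e i)) h)
  obtain ⟨c, hc⟩ := exists_code_of_key (Q := Q) (φ₀ := φ₀) (W := W) (pU := pU) (pA := pA) h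
  exact ⟨c, hc.trans (hh.trans h3)⟩

theorem achievable_zero_of_unique [Unique U]
    (hQ₀ : ∀ e, ∑ s, ∑ u, Q s * pU s u * auxWarden pA W u s e = innocentOutput Q φ₀ W e) :
    Achievable Q φ₀ W 0 0 := by
  refine achievable_of_bound le_rfl le_rfl tendsto_const_nhds fun n => ?_
  rw [numIndices_zero]
  obtain ⟨c, hc⟩ := exists_code_of_key (Q := Q) (φ₀ := φ₀) (W := W) (pU := pU) (pA := pA)
    (n := n) (κ := 1) (fun _ => default)
  rw [wardenGap_eq_zero (sum_blockWarden_state Q pU pA W hQ₀)] at hc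
  exact ⟨c, hc⟩

/-- Averaging out the auxiliary variable. -/
theorem exists_trivial_aux (Q : stdSimplex ℝ S) (pU : S → stdSimplex ℝ U)
    (pA : U → S → stdSimplex ℝ A) (W : A → S → stdSimplex ℝ (B × E)) :
    ∃ (pU' : S → stdSimplex ℝ Unit) (pA' : Unit → S → stdSimplex ℝ A), ∀ s e,
      Q s * pU' s () * auxWarden pA' W () s e = ∑ u, Q s * pU s u * auxWarden pA W u s e := by
  classical
  have hmix : ∀ s, ∃ q : stdSimplex ℝ A, ∀ a, q a = ∑ u, pU s u * pA u s a := fun s =>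
    ⟨⟨fun a => ∑ u, pU s u * pA u s a, fun a => Finset.sum_nonneg fun u _ =>
      mul_nonneg (stdSimplex.zero_le _ _) (stdSimplex.zero_le _ _), by
        rw [Finset.sum_comm]
        simp only [← Finset.mul_sum, stdSimplex.sum_eq_one, mul_one]⟩, fun _ => rfl⟩
  choose mix hmix using hmix
  refine ⟨fun _ => stdSimplex.vertex (), fun _ s => mix s, fun s e => ?_⟩
  have h1 : (stdSimplex.vertex () : stdSimplex ℝ Unit) () = 1 := by simp
  simp only [h1, mul_one, auxWarden, hmix, mul_assoc, ← Finset.mul_sum]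
  congr 1
  simp only [Finset.mul_sum, Finset.sum_mul]
  rw [Finset.sum_comm]
  simp only [mul_assoc]

theorem achievable_zero_zero
    (hQ₀ : law (jointLaw Q pU pA W) rvE = innocentOutput Q φ₀ W) : Achievable Q φ₀ W 0 0 := by
  obtain ⟨pU', pA', h⟩ := exists_trivial_aux Q pU pA W
  refine achievable_zero_of_unique (pU := pU') (pA := pA') fun e => ?_
  simp only [Finset.univ_unique, PUnit.default_eq_unit, Finset.sum_singleton, h]
  rw [← law_jointLaw_rvE, hQ₀]

/-- With the auxiliary variable averaged out, the key is a hash of the state sequence, which both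
terminals know. Only secrecy from the warden limits it, and `H(U,S|E)` reduces to `H(S|E)`. -/
theorem achievable_key_of_lt
    (hQ₀ : law (jointLaw Q pU pA W) rvE = innocentOutput Q φ₀ W) {RK : ℝ} (hRK : 0 ≤ RK)
    (hlt : RK < condEntropy (jointLaw Q pU pA W) rvS rvE) : Achievable Q φ₀ W 0 RK := by
  have hl : 0 < log 2 := log_pos one_lt_two
  obtain ⟨pU', pA', h⟩ := exists_trivial_aux Q pU pA W
  obtain ⟨x, hx₁, hx₂⟩ := exists_between hlt
  refine achievable_key_of_unique (pU := pU') (pA := pA') (l := x * log 2) (fun e => ?_) hRK ?_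
    (mul_lt_mul_of_pos_right hx₁ hl)
  · simp only [Finset.univ_unique, PUnit.default_eq_unit, Finset.sum_singleton, h]
    rw [← law_jointLaw_rvE, hQ₀]
  · simp only [Finset.univ_unique, PUnit.default_eq_unit, Finset.sum_singleton, h]
    rw [sum_mul_log_warden_state hQ₀]
    exact neg_lt_neg (mul_lt_mul_of_pos_right hx₂ hl)

end SingleLetter

/-! ### The inner bound, including boundary points -/

section Capacity

variable {S A B E : Type*} [Fintype S] [Fintype A] [Fintype B] [Fintype E]
  (Q : stdSimplex ℝ S) (φ₀ : stdSimplex ℝ A) (W : A → S → stdSimplex ℝ (B × E))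

/-- A point is approached by lowering both rates by `ε`, truncated at zero. Lowering a positive rate
makes the sum constraint strict; the cases are those where some strictness is not gained this way.
-/
theorem singleLetterRegion_subset : singleLetterRegion Q φ₀ W ⊆ capacityRegion Q φ₀ W := by
  rintro ⟨R, RK⟩ ⟨hR, hRK, k, pU, pA, P, rfl, hE, h₁, h₂⟩
  simp only at hR hRK h₁ h₂
  have hach : ∀ ε > 0, Achievable Q φ₀ W (max (R - ε) 0) (max (RK - ε) 0) := by
    intro ε hε
    have hR' : max (R - ε) 0 ≤ R := max_le (by linarith) hR
    have hRK' : max (RK - ε) 0 ≤ RK := max_le (by linarith) hRK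
    have hlt : ∀ x : ℝ, 0 < x → max (x - ε) 0 < x := fun x hx => max_lt (by linarith) hx
    have hzero : max (0 - ε) 0 = 0 := max_eq_right (by linarith)
    have hB := condMutualInfo_nonneg (jointLaw_nonneg Q pU pA W) rvU rvB rvS
    have hW := condMutualInfo_nonneg (jointLaw_nonneg Q pU pA W) rvU rvE rvS
    -- If `I(U;B|S) = 0`, then `R = 0` cannot be strictly below it. The sum constraint then gives
    -- `RK ≤ H(S|E)`, since `I(U;E|S) ≥ 0`, and a state-only key suffices.
    rcases hB.eq_or_lt with hB0 | hBpos
    · have hR0 : R = 0 := le_antisymm (by linarith) hR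
      rw [hR0, hzero]
      rcases hRK.eq_or_lt with hRK0 | hRKpos
      · rw [← hRK0, hzero]
        exact achievable_zero_zero hE
      · exact achievable_key_of_lt hE (le_max_right _ _) (by linarith [hlt RK hRKpos])
    · rcases hR.eq_or_lt with hR0 | hRpos
      · rcases hRK.eq_or_lt with hRK0 | hRKpos
        -- At the origin the sum constraint may be tight, and lowering the rates changes nothing.
        · rw [← hR0, ← hRK0, hzero]
          exact achievable_zero_zero hE
        · have := nonempty_aux Q pU
          refine achievable_of_lt hE (le_max_right _ _) (le_max_right _ _) ?_ ?_
          · rw [← hR0, hzero]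
            exact hBpos
          · linarith [hlt RK hRKpos]
      · have := nonempty_aux Q pU
        refine achievable_of_lt hE (le_max_right _ _) (le_max_right _ _) ?_ ?_
        · linarith [hlt R hRpos]
        · linarith [hlt R hRpos]
  refine mem_closure_of_tendsto (b := 𝓝[>] (0 : ℝ))
    (f := fun ε => (max (R - ε) 0, max (RK - ε) 0)) ?_ ?_
  · have hc : Continuous fun ε : ℝ => (max (R - ε) 0, max (RK - ε) 0) := by fun_prop
    have := (hc.tendsto 0).mono_left (nhdsWithin_le_nhds (s := Set.Ioi 0))
    simpa only [sub_zero, max_eq_left hR, max_eq_left hRK] using this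
  · filter_upwards [self_mem_nhdsWithin] with ε hε
    exact hach ε hε

end Capacity

end CovertSecure

end

open CovertSecure in
theorem theorem7 {S A B E : Type*} [Fintype S] [Fintype A] [Fintype B] [Fintype E]
    (Q : stdSimplex ℝ S) (φ₀ : stdSimplex ℝ A) (W : A → S → stdSimplex ℝ (B × E)) :
    capacityRegion Q φ₀ W =
      {r : ℝ × ℝ | 0 ≤ r.1 ∧ 0 ≤ r.2 ∧
        ∃ (k : ℕ) (pU : S → stdSimplex ℝ (Fin k)) (pA : Fin k → S → stdSimplex ℝ A)
          (P : S × Fin k × A × B × E → ℝ),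
          P = jointLaw Q pU pA W ∧
          law P rvE = innocentOutput Q φ₀ W ∧
          r.1 ≤ condMutualInfo P rvU rvB rvS ∧
          r.1 + r.2 ≤ condMutualInfo P rvU rvB rvS - condMutualInfo P rvU rvE rvS
            + condEntropy P rvS rvE} :=
  Set.Subset.antisymm (capacityRegion_subset Q φ₀ W) (singleLetterRegion_subset Q φ₀ W)
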